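/- **Setting.** For points of $\mathbb R^3$ carrying dipole moments, magnet $j$ at $p_j$ with moment $\mu_j$ produces the field $n^{-3}\,\dfrac{3[(x-p_j)\cdot\mu_j](x-p_j)-\|x-p_j\|^2\mu_j}{\|x-p_j\|^5}$ at $x$. The energy $E_i$ of magnet $i$ is minus the scalar product of $\mu_i$ with the sum at $p_i$ of the fields of all the other magnets, and the dimensionless total energy is $\bar E_{\rm tot}=\frac12\sum_i E_i$. (Lengths are measured in units of $n$ sphere diameters.) A *chain* is a family, for all large $n$, of $n+1$ magnets with $p_i=\tilde r(i/n)$, $\mu_i=\tilde m(i/n)$, $0\le i\le n$, where $\tilde r=\tilde r(\cdot\,;n)$ and $\tilde m=\tilde m(\cdot\,;n)$ may depend on $n$ and: (i) $\tilde r$ is $C^\infty$ and each of its derivatives of order $\ge1$ is bounded on $[0,1]$ uniformly in $n$; (ii) neighbouring magnets touch: $\|\tilde r((i+1)/n)-\tilde r(i/n)\|=1/n$ for $0\le i<n$; (iii) the curve does not come close to itself: $\|\tilde r(s)-\tilde r(\eta)\|\ge c|s-\eta|$ on $[0,1]^2$ with $c>0$ independent of $n$; (iv) $\|\mu_i\|=1$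 and the dipoles point along the tangent in the direction of increasing $s$ up to a small correction: $\big\|\mu_i-\tilde r'(i/n)/\|\tilde r'(i/n)\|\big\|\le C\,n^{-2}\log n$ with $C$ independent of $n$. A *ring* is defined in the same way with $n$ magnets, $0\le i\le n-1$, where in addition $\tilde r$ has period $1$, and (iii) is required for all real $s,\eta$ with $|s-\eta|\le\frac12$. Put $$K(s,\eta)=\frac{3\,[(\tilde r(s)-\tilde r(\eta))\cdot\tilde r'(\eta)]\,[(\tilde r(s)-\tilde r(\eta))\cdot\tilde r'(s)]}{\|\tilde r(s)-\tilde r(\eta)\|^5}-\frac{\tilde r'(\eta)\cdot\tilde r'(s)}{\|\tilde r(s)-\tilde r(\eta)\|^3},$$ $$W(x,y)=\frac{\zeta(3)}4\int_x^y\|\tilde r''(s)\|^2\,ds-\frac12\int_x^y\Big(\mathrm{f.p.}\!\int_0^1K(s,\eta)\,d\eta\Big)ds,$$ where f.p. is the Hadamard finite part at $\eta=s$ (remove $|\eta-s|<\varepsilon$, discard the multiples of negative powers of $\varepsilon$ and of $\log\varepsilon$, let $\varepsilon\to0$). **Ring.** For every ring and all large $n$ the integrals in $W(0,1)$ exist,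 and as $n\to\infty$ $$\bar E_{\rm tot}=-2\zeta(3)\,n+n^{-1}\,W(0,1)+O(n^{-2}).$$ **Chain, without its end layers.** For every chain there is a constant $C'$ such that for all large $n$ and all integers $0<a\le b<n$ the integrals in $W(a/n,b/n)$ exist, and the magnets $a,\dots,b$ contribute to $\bar E_{\rm tot}$ the energy $$\frac12\sum_{i=a}^{b}E_i=-2\zeta(3)\,(b-a)-2\zeta(3)+n^{-1}\,W(a/n,b/n)+\mathcal R,\qquad|\mathcal R|\le C'\Big(\frac1{a^2}+\frac1{(n-b)^2}\Big).$$ In particular $\mathcal R=O(n^{-2})$ when $a/n$ and $1-b/n$ stay bounded away from $0$. (In $E_i$ each magnet still interacts with all the other magnets of the chain.) -/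

import Mathlib

open Filter Topology Asymptotics
open scoped ContDiff

namespace MagnetChain

/-- Physical space with its Euclidean norm and inner product. -/
abbrev E3 : Type := EuclideanSpace ℝ (Fin 3)

/-! ### Dipole field and energy of finitely many magnets -/

/-- Dimensionless field at `x` of a dipole with moment `μ` located at `p`:
`(3 [(x - p) · μ] (x - p) - ‖x - p‖² μ) / ‖x - p‖⁵`. -/
noncomputable def dipoleField (p μ x : E3) : E3 :=
  (1 / ‖x - p‖ ^ 5) • ((3 * inner ℝ (x - p) μ) • (x - p) - ‖x - p‖ ^ 2 • μ)

/-- Dimensionless field at the centre of the `i`-th magnet that is produced by all the other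
magnets, when there are `N` magnets (numbered `0, …, N - 1`), the `j`-th one having its centre at
`r (j / n)` and its dipole moment equal to `m (j / n)`. Lengths are measured in units of `n` sphere
diameters, which is where the factor `n⁻³` comes from. -/
noncomputable def fieldAtMagnet (n N : ℕ) (r m : ℝ → E3) (i : ℕ) : E3 :=
  (1 / (n : ℝ) ^ 3) • ∑ j ∈ (Finset.range N).erase i,
    dipoleField (r ((j : ℝ) / n)) (m ((j : ℝ) / n)) (r ((i : ℝ) / n))

/-- Dimensionless energy of the `i`-th magnet in the field of the other magnets. -/
noncomputable def magnetEnergy (n N : ℕ) (r m : ℝ → E3) (i : ℕ) : ℝ :=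
  -inner ℝ (m ((i : ℝ) / n)) (fieldAtMagnet n N r m i)

/-- Contribution of the magnets in `S` to the total energy: half the sum of their energies, the
factor one half because the energy of every pair is shared between its two members. -/
noncomputable def energyOf (n N : ℕ) (r m : ℝ → E3) (S : Finset ℕ) : ℝ :=
  (1 / 2) * ∑ i ∈ S, magnetEnergy n N r m i

/-- Total dimensionless energy of `N` magnets. -/
noncomputable def totalEnergy (n N : ℕ) (r m : ℝ → E3) : ℝ :=
  energyOf n N r m (Finset.range N)

/-! ### Finite-part integrals -/

/-- `L` is the Hadamard finite part of `∫ η in [a, b], f η`, where `f` may be singular at `s`: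
`f` is integrable away from `s`, and after a symmetric interval of radius `ε` around `s` has been
removed the integral equals a combination of negative integer powers of `ε` and of `log ε`, plus
`L`, plus a term that tends to zero with `ε`. -/
def HasFinitePart (f : ℝ → ℝ) (a b s L : ℝ) : Prop :=
  (∀ ε > 0, MeasureTheory.IntegrableOn f (Set.Icc a b \ Set.Ioo (s - ε) (s + ε))) ∧
  ∃ (N : ℕ) (c : ℕ → ℝ) (d : ℝ),
    Tendsto (fun ε : ℝ => (∫ η in Set.Icc a b \ Set.Ioo (s - ε) (s + ε), f η)
      - ∑ k ∈ Finset.range N, c k / ε ^ (k + 1) - d * Real.log ε) (𝓝[>] 0) (𝓝 L)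

/-- The Hadamard finite part of `∫ η in [a, b], f η` at the singularity `s` (zero if there is
none; see `HasFinitePart.finitePart_eq`). -/
noncomputable def finitePart (f : ℝ → ℝ) (a b s : ℝ) : ℝ :=
  open Classical in if h : ∃ L, HasFinitePart f a b s L then h.choose else 0

/-- Negative powers and the logarithm are independent modulo bounded functions. -/
theorem eq_zero_of_tendsto_sum (N : ℕ) (c : ℕ → ℝ) (d l : ℝ)
    (h : Tendsto (fun ε : ℝ => ∑ k ∈ Finset.range N, c k / ε ^ (k + 1) + d * Real.log ε)
      (𝓝[>] 0) (𝓝 l)) : l = 0 := by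
  induction N with
  | zero =>
    simp only [Finset.range_zero, Finset.sum_empty, zero_add] at h
    have h1 : Tendsto (fun ε : ℝ => d * Real.log ε * (Real.log ε)⁻¹) (𝓝[>] 0) (𝓝 (l * 0)) :=
      h.mul (tendsto_inv_atBot_zero.comp Real.tendsto_log_nhdsGT_zero)
    have h2 : (fun ε : ℝ => d * Real.log ε * (Real.log ε)⁻¹) =ᶠ[𝓝[>] 0] fun _ => d := by
      filter_upwards [Real.tendsto_log_nhdsGT_zero.eventually_lt_atBot 0] with ε hε
      rw [mul_assoc, mul_inv_cancel₀ hε.ne, mul_one]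
    have h3 : d = 0 := by
      have := tendsto_nhds_unique (h1.congr' h2) tendsto_const_nhds
      simpa using this.symm
    subst h3
    simp only [zero_mul] at h
    exact tendsto_nhds_unique h tendsto_const_nhds
  | succ N ih =>
    have hid : Tendsto (fun ε : ℝ => ε) (𝓝[>] 0) (𝓝 0) := nhdsWithin_le_nhds
    have hpow : ∀ j : ℕ, Tendsto (fun ε : ℝ => ε ^ (j + 1)) (𝓝[>] 0) (𝓝 0) := fun j => by
      simpa using hid.pow (j + 1)
    have hlog : Tendsto (fun ε : ℝ => d * Real.log ε * ε ^ (N + 1)) (𝓝[>] 0) (𝓝 0) := by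
      have := (tendsto_log_mul_rpow_nhdsGT_zero (r := (N + 1 : ℕ)) (by positivity)).const_mul d
      simpa only [Real.rpow_natCast, mul_assoc, mul_zero] using this
    have hsum : Tendsto (fun ε : ℝ => ∑ k ∈ Finset.range N, c k * ε ^ (N - 1 - k + 1)) (𝓝[>] 0)
        (𝓝 0) := by
      simpa using tendsto_finsetSum (Finset.range N) fun k _ =>
        (hpow (N - 1 - k)).const_mul (c k)
    have h1 := h.mul (hpow N)
    rw [mul_zero] at h1
    have h2 := (h1.sub hlog).sub hsum
    have h3 : (fun ε : ℝ => (∑ k ∈ Finset.range (N + 1), c k / ε ^ (k + 1) + d * Real.log ε)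
        * ε ^ (N + 1) - d * Real.log ε * ε ^ (N + 1)
        - ∑ k ∈ Finset.range N, c k * ε ^ (N - 1 - k + 1)) =ᶠ[𝓝[>] 0] fun _ => c N := by
      filter_upwards [self_mem_nhdsWithin] with ε hε
      have hε' : (ε : ℝ) ≠ 0 := ne_of_gt hε
      have h4 : ∑ k ∈ Finset.range N, c k * ε ^ (N - 1 - k + 1)
          = (∑ k ∈ Finset.range N, c k / ε ^ (k + 1)) * ε ^ (N + 1) := by
        rw [Finset.sum_mul]
        refine Finset.sum_congr rfl fun k hk => ?_
        have hk' := Finset.mem_range.mp hk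
        have h5 : N + 1 = (N - 1 - k + 1) + (k + 1) := by omega
        rw [h5, pow_add ε (N - 1 - k + 1) (k + 1)]
        field_simp
      rw [h4, Finset.sum_range_succ]
      field_simp
      ring
    have h5 : c N = 0 := by
      have := tendsto_nhds_unique (h2.congr' h3) tendsto_const_nhds
      simpa using this.symm
    apply ih
    simpa [Finset.sum_range_succ, h5] using h

theorem HasFinitePart.unique {f : ℝ → ℝ} {a b s L L' : ℝ} (h : HasFinitePart f a b s L)
    (h' : HasFinitePart f a b s L') : L = L' := by
  obtain ⟨-, N, c, d, hL⟩ := h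
  obtain ⟨-, N', c', d', hL'⟩ := h'
  refine sub_eq_zero.mp (eq_zero_of_tendsto_sum (max N N')
    (fun k => (if k < N' then c' k else 0) - if k < N then c k else 0) (d' - d) _ ?_)
  refine (hL.sub hL').congr fun ε => ?_
  have key : ∀ (M : ℕ) (e : ℕ → ℝ), M ≤ max N N' →
      ∑ k ∈ Finset.range (max N N'), (if k < M then e k else 0) / ε ^ (k + 1)
        = ∑ k ∈ Finset.range M, e k / ε ^ (k + 1) := by
    intro M e hM
    rw [← Finset.sum_subset (Finset.range_mono hM)]
    · refine Finset.sum_congr rfl fun k hk => ?_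
      rw [if_pos (Finset.mem_range.mp hk)]
    · intro k _ hk
      rw [if_neg (by simpa using hk), zero_div]
  simp only [sub_div, Finset.sum_sub_distrib]
  rw [key N' c' (le_max_right _ _), key N c (le_max_left _ _)]
  ring

theorem HasFinitePart.finitePart_eq {f : ℝ → ℝ} {a b s L : ℝ} (h : HasFinitePart f a b s L) :
    finitePart f a b s = L := by
  have hex : ∃ L, HasFinitePart f a b s L := ⟨L, h⟩
  rw [finitePart, dif_pos hex]
  exact hex.choose_spec.unique h

/-! ### The continuum energy -/

/-- The dipole–dipole kernel of a curve whose dipoles are given by its derivative. -/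
noncomputable def kernel (r : ℝ → E3) (s η : ℝ) : ℝ :=
  3 * inner ℝ (r s - r η) (deriv r η) * inner ℝ (r s - r η) (deriv r s) / ‖r s - r η‖ ^ 5
    - inner ℝ (deriv r η) (deriv r s) / ‖r s - r η‖ ^ 3

/-- Finite part of `∫ η in [0, 1], kernel r s η`. -/
noncomputable def nonlocalDensity (r : ℝ → E3) (s : ℝ) : ℝ :=
  finitePart (kernel r s) 0 1 s

/-- The real number `ζ(3)`. -/
noncomputable def zetaThree : ℝ := (riemannZeta 3).re

/-- Coefficient of `n⁻¹` in the continuum energy of the piece `x ≤ s ≤ y` of the curve: bending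
energy minus one half of the integrated finite part of the kernel. -/
noncomputable def continuumEnergy (r : ℝ → E3) (x y : ℝ) : ℝ :=
  zetaThree / 4 * (∫ s in x..y, ‖iteratedDeriv 2 r s‖ ^ 2)
    - ∫ s in x..y, nonlocalDensity r s / 2

/-- The finite-part integrals and the outer integral in `continuumEnergy r x y` exist. -/
def ContinuumEnergyExists (r : ℝ → E3) (x y : ℝ) : Prop :=
  (∀ s ∈ Set.Ioo x y, ∃ L, HasFinitePart (kernel r s) 0 1 s L) ∧
  IntervalIntegrable (nonlocalDensity r) MeasureTheory.volume x y

/-! ### Families of chains and rings -/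

/-- `r n` and `m n` describe, for all large `n`, a chain of `n + 1` touching spherical magnets: the
`i`-th one (`0 ≤ i ≤ n`) has centre `r n (i / n)` and unit dipole moment `m n (i / n)`. The curve is
smooth with derivatives bounded as `n → ∞`, does not come close to itself, and the dipoles point
along the tangent in the direction of increasing parameter up to `O(n⁻² log n)`. -/
structure IsChain (r m : ℕ → ℝ → E3) : Prop where
  smooth : ∀ᶠ n in atTop, ContDiff ℝ ∞ (r n)
  bounded : ∀ k : ℕ, 1 ≤ k → ∃ C : ℝ, ∀ᶠ n in atTop, ∀ s ∈ Set.Icc (0 : ℝ) 1,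
    ‖iteratedDeriv k (r n) s‖ ≤ C
  spacing : ∀ᶠ n : ℕ in atTop, ∀ i < n,
    ‖r n (((i : ℝ) + 1) / n) - r n ((i : ℝ) / n)‖ = 1 / n
  separated : ∃ c > 0, ∀ᶠ n in atTop, ∀ s ∈ Set.Icc (0 : ℝ) 1, ∀ η ∈ Set.Icc (0 : ℝ) 1,
    c * |s - η| ≤ ‖r n s - r n η‖
  unit : ∀ᶠ n : ℕ in atTop, ∀ i ≤ n, ‖m n ((i : ℝ) / n)‖ = 1
  tangent : ∃ C : ℝ, ∀ᶠ n : ℕ in atTop, ∀ i ≤ n,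
    ‖m n ((i : ℝ) / n) - ‖deriv (r n) ((i : ℝ) / n)‖⁻¹ • deriv (r n) ((i : ℝ) / n)‖
      ≤ C * (Real.log n / (n : ℝ) ^ 2)

/-- The same for a closed ring of `n` touching magnets (`0 ≤ i ≤ n - 1`) on a curve of period `1`.
Parameters that differ by at most half a period are compared in `separated`. -/
structure IsRing (r m : ℕ → ℝ → E3) : Prop where
  smooth : ∀ᶠ n in atTop, ContDiff ℝ ∞ (r n)
  periodic : ∀ᶠ n in atTop, Function.Periodic (r n) 1
  bounded : ∀ k : ℕ, 1 ≤ k → ∃ C : ℝ, ∀ᶠ n in atTop, ∀ s ∈ Set.Icc (0 : ℝ) 1,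
    ‖iteratedDeriv k (r n) s‖ ≤ C
  spacing : ∀ᶠ n : ℕ in atTop, ∀ i < n,
    ‖r n (((i : ℝ) + 1) / n) - r n ((i : ℝ) / n)‖ = 1 / n
  separated : ∃ c > 0, ∀ᶠ n in atTop, ∀ s η : ℝ, |s - η| ≤ 1 / 2 →
    c * |s - η| ≤ ‖r n s - r n η‖
  unit : ∀ᶠ n : ℕ in atTop, ∀ i < n, ‖m n ((i : ℝ) / n)‖ = 1
  tangent : ∃ C : ℝ, ∀ᶠ n : ℕ in atTop, ∀ i < n,
    ‖m n ((i : ℝ) / n) - ‖deriv (r n) ((i : ℝ) / n)‖⁻¹ • deriv (r n) ((i : ℝ) / n)‖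
      ≤ C * (Real.log n / (n : ℝ) ^ 2)

end MagnetChain

set_option linter.unusedSectionVars false

/-! Put h = 1/n and split each moment into the unit tangent of the curve plus a correction.

For unit tangents the interaction of magnets i and i + k is, up to speeds, |k|⁻³ times a rescaled
kernel G(s, x) at s = ih, x = kh. Here r(s + x) - r(s) is divided by x, so that G is regular at x =
0. At unit speed r'·r'' = 0 and r'·r''' = -‖r''‖², and the expansion of G is 2 + x³ H: the linear
term vanishes and the curvature contributions to x² cancel (`CurveFamily.jet_kernel`). Summing
G/|k|³ over the lattice gives the leading coefficient times ζ(3) on each side plus h² times the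
finite part of the kernel integral: the tail -1/(2q²) of the sum for ζ(3) is exactly the boundary
term of the finite part of ∫ x⁻³, and what remains is a Riemann sum of H (`abs_latticeSum_sub_le`).

The bending energy comes from the touching condition, not from G. A chord is shorter than its arc,
so chords of length h force ‖r'‖² = 1 + (h²/12)‖r''‖² + O(h³) (`speed_estimates`). After
normalization of both tangents the leading coefficient is 2‖r'‖⁻³ = 2(1 - (h²/8)‖r''‖²) + O(h³), and
multiplication by 2ζ(3) and by -1/2 yields -2ζ(3) + (ζ(3)/4) h²‖r''‖² per magnet. The same estimates
show that the deviation from unit speed changes the coefficients of x and x² in G by O(h²) only,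
which is harmless.

The corrections have size O(h² log n) but contribute only O(h²) altogether. Being differences of
unit vectors they are orthogonal to the tangent up to second order; the leading field of the curve
on itself is tangential; the next term of the field is odd in k and cancels except near the ends
(`CurveBounds.abs_sum_correction_tangent_le`). Terms with two corrections are quadratic.

Summation over i replaces sums by integrals. Magnet i of a chain has row error O(h³ + i⁻³ + (n -
i)⁻³). The finite part grows like the inverse square of the distance to the ends and varies like its
inverse cube, so its Riemann sum errs in the same way, and all errors add up to O(a⁻² + (n - b)⁻²).
On a ring, periodicity centres each row with about half a period on either side, and everything is
O(h²). Constants must not depend on n; the classes `UnifLip`, `UnifSq` and `Jet` carry this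
uniformity, and `CurveBounds` extracts one constant from it. -/

namespace MagnetChain

/-! ### Calculus of uniformly Lipschitz families, O(h²) families and second-order expansions. -/

section UniformClasses

variable {ι X E F G : Type*} [PseudoMetricSpace X]
  [NormedAddCommGroup E] [NormedSpace ℝ E] [NormedAddCommGroup F] [NormedSpace ℝ F]
  [NormedAddCommGroup G] [NormedSpace ℝ G]

/-- The family `f` is bounded and Lipschitz on `S`, uniformly in the index. -/
def UnifLip (S : Set X) (f : ι → X → F) : Prop :=
  ∃ C : ℝ, 0 ≤ C ∧ (∀ i, ∀ p ∈ S, ‖f i p‖ ≤ C) ∧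
    ∀ i, ∀ p ∈ S, ∀ q ∈ S, ‖f i p - f i q‖ ≤ C * dist p q

theorem UnifLip.of_bounds {S : Set X} {f : ι → X → F} {C C' : ℝ}
    (hb : ∀ i, ∀ p ∈ S, ‖f i p‖ ≤ C)
    (hl : ∀ i, ∀ p ∈ S, ∀ q ∈ S, ‖f i p - f i q‖ ≤ C' * dist p q) : UnifLip S f :=
  ⟨max (max C C') 0, le_max_right _ _,
    fun i p hp => (hb i p hp).trans ((le_max_left _ _).trans (le_max_left _ _)),
    fun i p hp q hq => (hl i p hp q hq).trans <|
      mul_le_mul_of_nonneg_right ((le_max_right _ _).trans (le_max_left _ _)) dist_nonneg⟩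

theorem UnifLip.congr {S : Set X} {f g : ι → X → F} (hf : UnifLip S f)
    (h : ∀ i, ∀ p ∈ S, g i p = f i p) : UnifLip S g := by
  obtain ⟨C, h0, hb, hl⟩ := hf
  refine ⟨C, h0, fun i p hp => ?_, fun i p hp q hq => ?_⟩
  · rw [h i p hp]; exact hb i p hp
  · rw [h i p hp, h i q hq]; exact hl i p hp q hq

theorem UnifLip.const {S : Set X} (c : F) : UnifLip S (fun (_ : ι) (_ : X) => c) :=
  UnifLip.of_bounds (C := ‖c‖) (C' := 0) (fun _ _ _ => le_rfl) fun _ _ _ _ _ => by simp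

theorem UnifLip.add {S : Set X} {f g : ι → X → F} (hf : UnifLip S f) (hg : UnifLip S g) :
    UnifLip S (fun i p => f i p + g i p) := by
  obtain ⟨C, -, hb, hl⟩ := hf
  obtain ⟨C', -, hb', hl'⟩ := hg
  refine UnifLip.of_bounds (C := C + C') (C' := C + C') (fun i p hp => ?_) fun i p hp q hq => ?_
  · exact (norm_add_le _ _).trans (add_le_add (hb i p hp) (hb' i p hp))
  · rw [add_sub_add_comm, add_mul]
    exact (norm_add_le _ _).trans (add_le_add (hl i p hp q hq) (hl' i p hp q hq))

theorem UnifLip.bilin (L : E →L[ℝ] F →L[ℝ] G) {S : Set X} {f : ι → X → E} {g : ι → X → F}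
    (hf : UnifLip S f) (hg : UnifLip S g) : UnifLip S (fun i p => L (f i p) (g i p)) := by
  obtain ⟨C, h0, hb, hl⟩ := hf
  obtain ⟨C', h0', hb', hl'⟩ := hg
  refine UnifLip.of_bounds (C := ‖L‖ * C * C') (C' := ‖L‖ * C * C' + ‖L‖ * C * C')
    (fun i p hp => ?_) fun i p hp q hq => ?_
  · refine (L.le_opNorm₂ _ _).trans ?_
    gcongr
    exacts [hb i p hp, hb' i p hp]
  · have e : L (f i p) (g i p) - L (f i q) (g i q)
        = L (f i p - f i q) (g i p) + L (f i q) (g i p - g i q) := by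
      simp only [map_sub, sub_apply]; abel
    rw [e]
    have h1 : ‖L (f i p - f i q) (g i p)‖ ≤ ‖L‖ * (C * dist p q) * C' := by
      refine (L.le_opNorm₂ _ _).trans ?_
      gcongr
      exacts [hl i p hp q hq, hb' i p hp]
    have h2 : ‖L (f i q) (g i p - g i q)‖ ≤ ‖L‖ * C * (C' * dist p q) := by
      refine (L.le_opNorm₂ _ _).trans ?_
      gcongr
      exacts [hb i q hq, hl' i p hp q hq]
    refine (norm_add_le _ _).trans ((add_le_add h1 h2).trans (le_of_eq ?_))
    ring

theorem UnifLip.smul {S : Set X} {f : ι → X → ℝ} {g : ι → X → F}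
    (hf : UnifLip S f) (hg : UnifLip S g) : UnifLip S (fun i p => f i p • g i p) := by
  simpa using UnifLip.bilin (ContinuousLinearMap.lsmul ℝ ℝ) hf hg

theorem UnifLip.mul {S : Set X} {f g : ι → X → ℝ}
    (hf : UnifLip S f) (hg : UnifLip S g) : UnifLip S (fun i p => f i p * g i p) :=
  hf.smul hg

theorem UnifLip.const_smul {S : Set X} {g : ι → X → F} (c : ℝ) (hg : UnifLip S g) :
    UnifLip S (fun i p => c • g i p) := (UnifLip.const c).smul hg

theorem UnifLip.const_mul {S : Set X} {g : ι → X → ℝ} (c : ℝ) (hg : UnifLip S g) :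
    UnifLip S (fun i p => c * g i p) := (UnifLip.const c).mul hg

theorem UnifLip.neg {S : Set X} {g : ι → X → F} (hg : UnifLip S g) :
    UnifLip S (fun i p => - g i p) := (hg.const_smul (-1)).congr fun i p _ => by simp

theorem UnifLip.sub {S : Set X} {f g : ι → X → F} (hf : UnifLip S f) (hg : UnifLip S g) :
    UnifLip S (fun i p => f i p - g i p) :=
  (hf.add hg.neg).congr fun _ _ _ => sub_eq_add_neg _ _

theorem UnifLip.pow {S : Set X} {f : ι → X → ℝ} (hf : UnifLip S f) (k : ℕ) :
    UnifLip S (fun i p => f i p ^ k) := by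
  induction k with
  | zero => simpa using UnifLip.const (1 : ℝ)
  | succ k ih => simpa only [pow_succ] using ih.mul hf

theorem UnifLip.inner {S : Set X} {f g : ι → X → E3}
    (hf : UnifLip S f) (hg : UnifLip S g) : UnifLip S (fun i p => inner ℝ (f i p) (g i p)) :=
  UnifLip.bilin (innerSL ℝ) hf hg

theorem UnifLip.inv {S : Set X} {f : ι → X → ℝ} (hf : UnifLip S f) {c : ℝ} (hc : 0 < c)
    (h : ∀ i, ∀ p ∈ S, c ≤ f i p) : UnifLip S (fun i p => (f i p)⁻¹) := by
  obtain ⟨C, h0, hb, hl⟩ := hf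
  refine UnifLip.of_bounds (C := c⁻¹) (C' := c⁻¹ * C * c⁻¹) (fun i p hp => ?_)
    fun i p hp q hq => ?_
  · have := hc.trans_le (h i p hp)
    rw [norm_inv, Real.norm_of_nonneg this.le]
    exact inv_anti₀ hc (h i p hp)
  · have h1 := hc.trans_le (h i p hp)
    have h2 := hc.trans_le (h i q hq)
    have e : (f i p)⁻¹ - (f i q)⁻¹ = (f i p)⁻¹ * (f i q - f i p) * (f i q)⁻¹ := by
      field_simp
    rw [e, norm_mul, norm_mul, norm_inv, norm_inv, Real.norm_of_nonneg h1.le,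
      Real.norm_of_nonneg h2.le]
    have h3 := hl i q hq p hp
    rw [dist_comm] at h3
    have h4 := inv_anti₀ hc (h i p hp)
    have h5 := inv_anti₀ hc (h i q hq)
    calc (f i p)⁻¹ * ‖f i q - f i p‖ * (f i q)⁻¹
        ≤ c⁻¹ * (C * dist p q) * c⁻¹ := by gcongr
      _ = c⁻¹ * C * c⁻¹ * dist p q := by ring

theorem UnifLip.sqrt {S : Set X} {f : ι → X → ℝ} (hf : UnifLip S f) {c : ℝ} (hc : 0 < c)
    (h : ∀ i, ∀ p ∈ S, c ≤ f i p) : UnifLip S (fun i p => √(f i p)) := by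
  obtain ⟨C, h0, hb, hl⟩ := hf
  refine UnifLip.of_bounds (C := √C) (C' := C * (√c)⁻¹) (fun i p hp => ?_)
    fun i p hp q hq => ?_
  · rw [Real.norm_of_nonneg (Real.sqrt_nonneg _)]
    exact Real.sqrt_le_sqrt ((le_abs_self _).trans (hb i p hp))
  · have h1 := hc.trans_le (h i p hp)
    have h2 := hc.trans_le (h i q hq)
    have hs := Real.sqrt_pos.mpr hc
    have e : (√(f i p) - √(f i q)) * (√(f i p) + √(f i q)) = f i p - f i q := by
      nlinarith [Real.mul_self_sqrt h1.le, Real.mul_self_sqrt h2.le]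
    have h3 : √c ≤ √(f i p) + √(f i q) :=
      (Real.sqrt_le_sqrt (h i p hp)).trans (le_add_of_nonneg_right (Real.sqrt_nonneg _))
    have h4 : ‖√(f i p) - √(f i q)‖ * √c ≤ C * dist p q := by
      refine le_trans ?_ (hl i p hp q hq)
      rw [← e, norm_mul]
      gcongr
      exact h3.trans (le_abs_self _)
    calc ‖√(f i p) - √(f i q)‖ = ‖√(f i p) - √(f i q)‖ * √c * (√c)⁻¹ := by field_simp
      _ ≤ C * dist p q * (√c)⁻¹ := by gcongr
      _ = _ := by ring

theorem UnifLip.comp_fst {J : Set ℝ} {Ω : Set (ℝ × ℝ)} (hΩ : ∀ p ∈ Ω, p.1 ∈ J)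
    {f : ι → ℝ → F} (hf : UnifLip J f) : UnifLip Ω (fun i p => f i p.1) := by
  obtain ⟨C, h0, hb, hl⟩ := hf
  refine ⟨C, h0, fun i p hp => hb i _ (hΩ p hp), fun i p hp q hq => ?_⟩
  refine (hl i _ (hΩ p hp) _ (hΩ q hq)).trans ?_
  gcongr
  exact le_max_left _ _

theorem unifLip_snd {Ω : Set (ℝ × ℝ)} (hΩ : ∀ p ∈ Ω, |p.2| ≤ 1) :
    UnifLip Ω (fun (_ : ι) (p : ℝ × ℝ) => p.2) :=
  UnifLip.of_bounds (C := 1) (C' := 1) (fun _ p hp => hΩ p hp) fun _ p _ q _ => by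
    rw [one_mul]; exact le_max_right _ _

/-- Uniformly of order `h²`. -/
def UnifSq (J : Set X) (h : ι → ℝ) (f : ι → X → F) : Prop :=
  ∃ C : ℝ, 0 ≤ C ∧ ∀ i, ∀ s ∈ J, ‖f i s‖ ≤ C * h i ^ 2

theorem UnifSq.of_bound {J : Set X} {h : ι → ℝ} {f : ι → X → F} {C : ℝ}
    (hf : ∀ i, ∀ s ∈ J, ‖f i s‖ ≤ C * h i ^ 2) : UnifSq J h f :=
  ⟨max C 0, le_max_right _ _, fun i s hs => (hf i s hs).trans <|
    mul_le_mul_of_nonneg_right (le_max_left _ _) (sq_nonneg _)⟩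

theorem UnifSq.congr {J : Set X} {h : ι → ℝ} {f g : ι → X → F} (hf : UnifSq J h f)
    (e : ∀ i, ∀ s ∈ J, g i s = f i s) : UnifSq J h g := by
  obtain ⟨C, h0, hC⟩ := hf
  exact ⟨C, h0, fun i s hs => by rw [e i s hs]; exact hC i s hs⟩

theorem UnifSq.add {J : Set X} {h : ι → ℝ} {f g : ι → X → F} (hf : UnifSq J h f)
    (hg : UnifSq J h g) : UnifSq J h (fun i s => f i s + g i s) := by
  obtain ⟨C, -, hC⟩ := hf
  obtain ⟨C', -, hC'⟩ := hg
  refine UnifSq.of_bound (C := C + C') fun i s hs => (norm_add_le _ _).trans ?_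
  rw [add_mul]
  exact add_le_add (hC i s hs) (hC' i s hs)

theorem UnifSq.mul_unifLip {J : Set X} {h : ι → ℝ} {f g : ι → X → ℝ} (hf : UnifSq J h f)
    (hg : UnifLip J g) : UnifSq J h (fun i s => f i s * g i s) := by
  obtain ⟨C, h0, hC⟩ := hf
  obtain ⟨C', h0', hC', -⟩ := hg
  refine UnifSq.of_bound (C := C * C') fun i s hs => ?_
  rw [norm_mul]
  calc ‖f i s‖ * ‖g i s‖ ≤ (C * h i ^ 2) * C' := by
        gcongr
        exacts [hC i s hs, hC' i s hs]
    _ = _ := by ring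

theorem UnifSq.const_mul {J : Set X} {h : ι → ℝ} {f : ι → X → ℝ} (c : ℝ) (hf : UnifSq J h f) :
    UnifSq J h (fun i s => c * f i s) :=
  (hf.mul_unifLip (UnifLip.const c)).congr fun _ _ _ => mul_comm _ _

theorem UnifSq.neg {J : Set X} {h : ι → ℝ} {f : ι → X → ℝ} (hf : UnifSq J h f) :
    UnifSq J h (fun i s => - f i s) :=
  (hf.const_mul (-1)).congr fun _ _ _ => (neg_one_mul _).symm

/-- `f (s, x) = a s + x b s + x² c s + O(x³)` on `Ω`, all the coefficients and the remainder
divided by `x³` being uniformly bounded and Lipschitz. -/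
structure Jet (J : Set ℝ) (Ω : Set (ℝ × ℝ)) (f : ι → ℝ × ℝ → F) (a b c : ι → ℝ → F) :
    Prop where
  lip_zero : UnifLip J a
  lip_one : UnifLip J b
  lip_two : UnifLip J c
  rem : ∃ H : ι → ℝ × ℝ → F, UnifLip Ω H ∧ ∀ i, ∀ p ∈ Ω,
    f i p = a i p.1 + p.2 • b i p.1 + p.2 ^ 2 • c i p.1 + p.2 ^ 3 • H i p

/-- Domains of functions of a parameter `s` and an increment `x`. -/
structure IsIncrDomain (J : Set ℝ) (Ω : Set (ℝ × ℝ)) : Prop where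
  convex : Convex ℝ J
  fst_mem : ∀ p ∈ Ω, p.1 ∈ J
  add_mem : ∀ p ∈ Ω, p.1 + p.2 ∈ J
  abs_le : ∀ p ∈ Ω, |p.2| ≤ 1

variable {J : Set ℝ} {Ω : Set (ℝ × ℝ)}

theorem IsIncrDomain.lift (hΩ : IsIncrDomain J Ω) {f : ι → ℝ → F} (hf : UnifLip J f) :
    UnifLip Ω (fun i p => f i p.1) := hf.comp_fst hΩ.fst_mem

theorem Jet.unifLip (hΩ : IsIncrDomain J Ω) {f : ι → ℝ × ℝ → F} {a b c : ι → ℝ → F}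
    (hf : Jet J Ω f a b c) : UnifLip Ω f := by
  obtain ⟨ha, hb, hc, H, hH, e⟩ := hf
  have hx := unifLip_snd (ι := ι) hΩ.abs_le
  exact ((((ha.comp_fst hΩ.fst_mem).add (hx.smul (hb.comp_fst hΩ.fst_mem))).add
    ((hx.pow 2).smul (hc.comp_fst hΩ.fst_mem))).add ((hx.pow 3).smul hH)).congr e

theorem Jet.congr {f g : ι → ℝ × ℝ → F} {a b c a' b' c' : ι → ℝ → F} (hf : Jet J Ω f a b c)
    (hΩ : IsIncrDomain J Ω) (hg : ∀ i, ∀ p ∈ Ω, g i p = f i p)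
    (ha : ∀ i, ∀ s ∈ J, a' i s = a i s) (hb : ∀ i, ∀ s ∈ J, b' i s = b i s)
    (hc : ∀ i, ∀ s ∈ J, c' i s = c i s) : Jet J Ω g a' b' c' := by
  obtain ⟨h0, h1, h2, H, hH, e⟩ := hf
  refine ⟨h0.congr ha, h1.congr hb, h2.congr hc, H, hH, fun i p hp => ?_⟩
  have := hΩ.fst_mem p hp
  rw [hg i p hp, e i p hp, ha i _ this, hb i _ this, hc i _ this]

theorem Jet.add {f g : ι → ℝ × ℝ → F} {a b c a' b' c' : ι → ℝ → F} (hf : Jet J Ω f a b c)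
    (hg : Jet J Ω g a' b' c') :
    Jet J Ω (fun i p => f i p + g i p) (fun i s => a i s + a' i s) (fun i s => b i s + b' i s)
      (fun i s => c i s + c' i s) := by
  obtain ⟨h0, h1, h2, H, hH, e⟩ := hf
  obtain ⟨h0', h1', h2', H', hH', e'⟩ := hg
  refine ⟨h0.add h0', h1.add h1', h2.add h2', _, hH.add hH', fun i p hp => ?_⟩
  rw [e i p hp, e' i p hp]
  simp only [smul_add]
  abel

theorem Jet.bilin (hΩ : IsIncrDomain J Ω) (L : E →L[ℝ] F →L[ℝ] G) {f : ι → ℝ × ℝ → E}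
    {g : ι → ℝ × ℝ → F} {a b c : ι → ℝ → E} {a' b' c' : ι → ℝ → F} (hf : Jet J Ω f a b c)
    (hg : Jet J Ω g a' b' c') :
    Jet J Ω (fun i p => L (f i p) (g i p)) (fun i s => L (a i s) (a' i s))
      (fun i s => L (a i s) (b' i s) + L (b i s) (a' i s))
      (fun i s => L (a i s) (c' i s) + L (b i s) (b' i s) + L (c i s) (a' i s)) := by
  have hgl := hg.unifLip hΩ
  obtain ⟨h0, h1, h2, H, hH, e⟩ := hf
  obtain ⟨h0', h1', h2', H', hH', e'⟩ := hg
  have hx := unifLip_snd (ι := ι) hΩ.abs_le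
  refine ⟨h0.bilin L h0', (h0.bilin L h1').add (h1.bilin L h0'),
    ((h0.bilin L h2').add (h1.bilin L h1')).add (h2.bilin L h0'),
    -- Each coefficient of `f` is paired with the part of `g` that pushes the total order to three;
    -- the remainder `H` of `f` is paired with the whole of `g`.
    fun i p => L (a i p.1) (H' i p) + L (b i p.1) (c' i p.1 + p.2 • H' i p)
      + L (c i p.1) (b' i p.1 + p.2 • (c' i p.1 + p.2 • H' i p)) + L (H i p) (g i p),
    ?_, fun i p hp => ?_⟩
  · have hr := (hΩ.lift h2').add (hx.smul hH')
    exact ((((hΩ.lift h0).bilin L hH').add ((hΩ.lift h1).bilin L hr)).add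
      ((hΩ.lift h2).bilin L ((hΩ.lift h1').add (hx.smul hr)))).add (hH.bilin L hgl)
  · beta_reduce
    rw [e' i p hp, e i p hp]
    simp only [map_add, map_smul, add_apply, smul_apply,
      smul_add, smul_smul]
    module

theorem Jet.smul (hΩ : IsIncrDomain J Ω) {f : ι → ℝ × ℝ → ℝ}
    {g : ι → ℝ × ℝ → F} {a b c : ι → ℝ → ℝ} {a' b' c' : ι → ℝ → F} (hf : Jet J Ω f a b c)
    (hg : Jet J Ω g a' b' c') :
    Jet J Ω (fun i p => f i p • g i p) (fun i s => a i s • a' i s)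
      (fun i s => a i s • b' i s + b i s • a' i s)
      (fun i s => a i s • c' i s + b i s • b' i s + c i s • a' i s) := by
  simpa using Jet.bilin hΩ (ContinuousLinearMap.lsmul ℝ ℝ) hf hg

theorem Jet.inner (hΩ : IsIncrDomain J Ω) {f g : ι → ℝ × ℝ → E3}
    {a b c a' b' c' : ι → ℝ → E3} (hf : Jet J Ω f a b c) (hg : Jet J Ω g a' b' c') :
    Jet J Ω (fun i p => inner ℝ (f i p) (g i p)) (fun i s => inner ℝ (a i s) (a' i s))
      (fun i s => inner ℝ (a i s) (b' i s) + inner ℝ (b i s) (a' i s))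
      (fun i s => inner ℝ (a i s) (c' i s) + inner ℝ (b i s) (b' i s)
        + inner ℝ (c i s) (a' i s)) :=
  Jet.bilin hΩ (innerSL ℝ) hf hg

theorem Jet.const_smul (k : ℝ) {f : ι → ℝ × ℝ → F} {a b c : ι → ℝ → F}
    (hf : Jet J Ω f a b c) : Jet J Ω (fun i p => k • f i p) (fun i s => k • a i s)
      (fun i s => k • b i s) (fun i s => k • c i s) := by
  obtain ⟨h0, h1, h2, H, hH, e⟩ := hf
  refine ⟨h0.const_smul k, h1.const_smul k, h2.const_smul k, _, hH.const_smul k,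
    fun i p hp => ?_⟩
  rw [e i p hp]
  module

/-- Inverse square root of a positive function with a second-order expansion. -/
theorem Jet.inv_sqrt (hΩ : IsIncrDomain J Ω) {f : ι → ℝ × ℝ → ℝ} {a b c : ι → ℝ → ℝ}
    (hf : Jet J Ω f a b c) {m : ℝ} (hm : 0 < m) (hfm : ∀ i, ∀ p ∈ Ω, m ≤ f i p)
    (ham : ∀ i, ∀ s ∈ J, m ≤ a i s) :
    ∃ a' b' c' : ι → ℝ → ℝ, Jet J Ω (fun i p => (√(f i p))⁻¹) a' b' c' ∧
      (∀ i s, a' i s = (√(a i s))⁻¹) ∧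
      (∀ i s, b' i s = -(1 / 2) * (a' i s * (b i s * (a i s)⁻¹))) ∧
      (∀ i s, c' i s = -(1 / 2) * ((a' i s * c i s + 2 * (b' i s * b i s)) * (a i s)⁻¹
        + b' i s * b' i s * √(a i s))) := by
  have hx := unifLip_snd (ι := ι) hΩ.abs_le
  have hfl := hf.unifLip hΩ
  obtain ⟨h0, h1, h2, -⟩ := id hf
  -- The coefficients solve q² f = 1 order by order for q = a' + b' x + c' x².
  set a' : ι → ℝ → ℝ := fun i s => (√(a i s))⁻¹ with ha'
  set b' : ι → ℝ → ℝ := fun i s => -(1 / 2) * (a' i s * (b i s * (a i s)⁻¹)) with hb'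
  set c' : ι → ℝ → ℝ := fun i s => -(1 / 2) * ((a' i s * c i s + 2 * (b' i s * b i s))
    * (a i s)⁻¹ + b' i s * b' i s * √(a i s)) with hc'
  have hsm := Real.sqrt_pos.mpr hm
  have la' : UnifLip J a' := (h0.sqrt hm ham).inv hsm fun i s hs => Real.sqrt_le_sqrt (ham i s hs)
  have lia := h0.inv hm ham
  have lb' : UnifLip J b' := (la'.mul (h1.mul lia)).const_mul _
  have lc' : UnifLip J c' :=
    ((((la'.mul h2).add ((lb'.mul h1).const_mul 2)).mul lia).add
      ((lb'.mul lb').mul (h0.sqrt hm ham))).const_mul _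
  refine ⟨a', b', c', ?_, fun _ _ => rfl, fun _ _ => rfl, fun _ _ => rfl⟩
  obtain ⟨A, hA0, hA, -⟩ := h0
  obtain ⟨B, hB0, hB, -⟩ := id lb'
  obtain ⟨B', hB0', hB', -⟩ := id lc'
  obtain ⟨M, hM0, hM, -⟩ := hfl
  set k : ℝ := (√(A + 1))⁻¹ with hk
  have hk0 : 0 < k := by positivity
  set D : ℝ := B + B' with hD
  have hD0 : 0 ≤ D := by positivity
  -- An extra term N x⁴ does not affect the second-order expansion but makes the approximant
  -- nonnegative: D|x| ≤ k + N x⁴, trivially if D|x| ≤ k, and otherwise because (D|x|/k)³ ≥ 1.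
  set N : ℝ := D * (D / k) ^ 3 with hN
  have hak : ∀ i, ∀ s ∈ J, k ≤ a' i s := fun i s hs => by
    have h3 := hm.trans_le (ham i s hs)
    refine inv_anti₀ (Real.sqrt_pos.mpr h3) (Real.sqrt_le_sqrt ?_)
    have := (le_abs_self _).trans (hA i s hs)
    linarith
  set q : ι → ℝ × ℝ → ℝ := fun i p => a' i p.1 + p.2 • b' i p.1 + p.2 ^ 2 • c' i p.1
    + p.2 ^ 3 • (N * p.2) with hq
  have jq : Jet J Ω q a' b' c' := ⟨la', lb', lc',
    _, hx.const_mul N, fun _ _ _ => rfl⟩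
  have hqpos : ∀ i, ∀ p ∈ Ω, 0 ≤ q i p := by
    intro i p hp
    have hs := hΩ.fst_mem p hp
    have h3 := hak i _ hs
    have h4 := abs_le.mp (hΩ.abs_le p hp)
    have h5 : |p.2 * b' i p.1 + p.2 ^ 2 * c' i p.1| ≤ D * |p.2| := by
      refine (abs_add_le _ _).trans ?_
      rw [abs_mul p.2, abs_mul (p.2 ^ 2), abs_pow, hD]
      have h6 := hB i _ hs
      have h7 := hB' i _ hs
      rw [Real.norm_eq_abs] at h6 h7
      have h8 := hΩ.abs_le p hp
      have h9 : |p.2| ^ 2 ≤ |p.2| := by nlinarith [abs_nonneg p.2]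
      calc |p.2| * |b' i p.1| + |p.2| ^ 2 * |c' i p.1| ≤ |p.2| * B + |p.2| * B' := by gcongr
        _ = _ := by ring
    have h6 : D * |p.2| ≤ k + N * p.2 ^ 4 := by
      rcases le_or_gt (D * |p.2|) k with h7 | h7
      · have : 0 ≤ N * p.2 ^ 4 := by positivity
        linarith
      · have h8 : 1 ≤ D / k * |p.2| := by
          rw [div_mul_eq_mul_div, le_div_iff₀ hk0]; linarith
        have h9 : N * p.2 ^ 4 = D * |p.2| * (D / k * |p.2|) ^ 3 := by
          rw [hN, ← abs_of_nonneg (show 0 ≤ p.2 ^ 4 by positivity), abs_pow]; ring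
        rw [h9]
        have : 1 ≤ (D / k * |p.2|) ^ 3 := one_le_pow₀ h8
        nlinarith [mul_nonneg hD0 (abs_nonneg p.2)]
    have h7 := (abs_le.mp h5).1
    simp only [hq, smul_eq_mul]
    nlinarith
  -- The algebra of expansions gives q² f = 1 + x³ H with `H` uniformly Lipschitz, once the three
  -- lower coefficients are evaluated.
  have jqq := (jq.smul hΩ jq).smul hΩ hf
  obtain ⟨-, -, -, H, hH, e⟩ := jqq
  have lb := (hf.unifLip hΩ).sqrt hm hfm
  have lbi := lb.inv hsm fun i p hp => Real.sqrt_le_sqrt (hfm i p hp)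
  set K : ℝ := m * (√(M + 1))⁻¹ with hK
  have hK0 : 0 < K := by positivity
  have hden : ∀ i, ∀ p ∈ Ω, K ≤ f i p * ((√(f i p))⁻¹ + q i p) := by
    intro i p hp
    have h3 := hm.trans_le (hfm i p hp)
    have h4 : (√(M + 1))⁻¹ ≤ (√(f i p))⁻¹ := by
      refine inv_anti₀ (Real.sqrt_pos.mpr h3) (Real.sqrt_le_sqrt ?_)
      have := (le_abs_self _).trans (hM i p hp)
      linarith
    have := hqpos i p hp
    refine mul_le_mul (hfm i p hp) (by linarith) (by positivity) h3.le
  have hmain := ((hf.unifLip hΩ).mul (lbi.add (jq.unifLip hΩ))).inv hK0 hden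
  refine ⟨la', jq.lip_one, jq.lip_two, fun i p => N * p.2
    - H i p * (f i p * ((√(f i p))⁻¹ + q i p))⁻¹, (hx.const_mul N).sub (hH.mul hmain),
    fun i p hp => ?_⟩
  have hs := hΩ.fst_mem p hp
  have ha0 := hm.trans_le (ham i _ hs)
  have hf0 := hm.trans_le (hfm i p hp)
  have e1 := e i p hp
  have hsa := Real.sqrt_pos.mpr ha0
  have hsf := Real.sqrt_pos.mpr hf0
  have hsa2 := Real.sq_sqrt ha0.le
  have hsf2 := Real.sq_sqrt hf0.le
  simp only [smul_eq_mul] at e1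
  have z0 : a' i p.1 * a' i p.1 * a i p.1 = 1 := by
    simp only [ha']; rw [← pow_two, inv_pow, hsa2, inv_mul_cancel₀ ha0.ne']
  have zb : b' i p.1 * a i p.1 = -(1 / 2) * (a' i p.1 * b i p.1) := by
    simp only [hb']; field_simp
  have z1 : a' i p.1 * a' i p.1 * b i p.1
      + (a' i p.1 * b' i p.1 + b' i p.1 * a' i p.1) * a i p.1 = 0 := by
    linear_combination (2 * a' i p.1) * zb
  have zc : 2 * a' i p.1 * c' i p.1 * a i p.1 = - (a' i p.1 * a' i p.1 * c i p.1
      + 2 * a' i p.1 * b' i p.1 * b i p.1) - b' i p.1 * b' i p.1 * a i p.1 := by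
    have : a' i p.1 * √(a i p.1) = 1 := inv_mul_cancel₀ hsa.ne'
    have h5 : (a i p.1)⁻¹ * a i p.1 = 1 := inv_mul_cancel₀ ha0.ne'
    simp only [hc']
    linear_combination (-a' i p.1 * (a' i p.1 * c i p.1 + 2 * (b' i p.1 * b i p.1))) * h5
      - b' i p.1 * b' i p.1 * a i p.1 * this
  have z2 : a' i p.1 * a' i p.1 * c i p.1
      + (a' i p.1 * b' i p.1 + b' i p.1 * a' i p.1) * b i p.1
      + (a' i p.1 * c' i p.1 + b' i p.1 * b' i p.1 + c' i p.1 * a' i p.1) * a i p.1 = 0 := by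
    linear_combination zc
  rw [z0, z1, z2] at e1
  have hqe : q i p = a' i p.1 + p.2 * b' i p.1 + p.2 ^ 2 * c' i p.1 + p.2 ^ 3 * (N * p.2) := rfl
  have hpos : 0 < f i p * ((√(f i p))⁻¹ + q i p) := hK0.trans_le (hden i p hp)
  -- The difference of squares f⁻¹ - q² = (f^(-1/2) - q)(f^(-1/2) + q) is divided by its second
  -- factor, which is bounded below since q ≥ 0.
  have key : (√(f i p))⁻¹ - q i p
      = - (p.2 ^ 3 * H i p) * (f i p * ((√(f i p))⁻¹ + q i p))⁻¹ := by
    rw [eq_mul_inv_iff_mul_eq₀ hpos.ne']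
    have h5 : (√(f i p))⁻¹ * (√(f i p))⁻¹ * f i p = 1 := by
      rw [← pow_two, inv_pow, hsf2, inv_mul_cancel₀ hf0.ne']
    linear_combination h5 - e1
  simp only [smul_eq_mul]
  linear_combination key + hqe

end UniformClasses

/-! ### Expansions of the form 1 + cκx² modulo O(h²). -/

section UnitJets

variable {ι : Type*} {J : Set ℝ} {Ω : Set (ℝ × ℝ)} {h : ι → ℝ} {κ : ι → ℝ → ℝ}

/-- `f (s, x) = a₀(s) + c κ(s) x² + O(x³)` up to a uniform error `O(h²)` in the coefficients, where
`a₀ = 1 + O(h²)`. -/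
def UnitJet (J : Set ℝ) (Ω : Set (ℝ × ℝ)) (h : ι → ℝ) (κ : ι → ℝ → ℝ) (f : ι → ℝ × ℝ → ℝ)
    (a₀ : ι → ℝ → ℝ) (c : ℝ) : Prop :=
  ∃ a₁ a₂ : ι → ℝ → ℝ, Jet J Ω f a₀ a₁ a₂ ∧ UnifSq J h (fun i s => a₀ i s - 1) ∧
    UnifSq J h a₁ ∧ UnifSq J h (fun i s => a₂ i s - c * κ i s)

/-- Without linear terms, the coefficients of κx² add under multiplication; every other product
contains a factor O(h²). -/
theorem UnitJet.mul (hΩ : IsIncrDomain J Ω) (hκ : UnifLip J κ) {f g : ι → ℝ × ℝ → ℝ} {c d : ℝ}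
    {a₀ b₀ : ι → ℝ → ℝ} (hf : UnitJet J Ω h κ f a₀ c) (hg : UnitJet J Ω h κ g b₀ d) :
    UnitJet J Ω h κ (fun i p => f i p * g i p) (fun i s => a₀ i s * b₀ i s) (c + d) := by
  obtain ⟨a₁, a₂, ja, sa0, sa1, sa2⟩ := hf
  obtain ⟨b₁, b₂, jb, sb0, sb1, sb2⟩ := hg
  refine ⟨_, _, ja.smul hΩ jb, ?_, ?_, ?_⟩
  · exact ((sa0.mul_unifLip jb.lip_zero).add sb0).congr fun i s _ => by ring
  · exact ((sb1.mul_unifLip ja.lip_zero).add (sa1.mul_unifLip jb.lip_zero)).congr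
      fun i s _ => by simp only [smul_eq_mul]; ring
  · exact (((((sb2.mul_unifLip ja.lip_zero).add (sa0.mul_unifLip (hκ.const_mul d))).add
      (sa1.mul_unifLip jb.lip_one)).add (sa2.mul_unifLip jb.lip_zero)).add
      (sb0.mul_unifLip (hκ.const_mul c))).congr fun i s _ => by simp only [smul_eq_mul]; ring

theorem UnitJet.pow (hΩ : IsIncrDomain J Ω) (hκ : UnifLip J κ) {f : ι → ℝ × ℝ → ℝ} {c : ℝ}
    {a₀ : ι → ℝ → ℝ} (hf : UnitJet J Ω h κ f a₀ c) (k : ℕ) :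
    UnitJet J Ω h κ (fun i p => f i p ^ (k + 1)) (fun i s => a₀ i s ^ (k + 1)) ((k + 1) * c) := by
  induction k with
  | zero => simpa using hf
  | succ k ih =>
    have := ih.mul hΩ hκ hf
    simp only [← pow_succ] at this
    convert this using 1
    push_cast; ring

/-- The model is (1 + cκx²)^(-1/2) = 1 - (c/2)κx² + …; what has to be checked is that O(h²) errors
in the data remain O(h²). -/
theorem UnitJet.inv_sqrt (hΩ : IsIncrDomain J Ω) (hκ : UnifLip J κ) {f : ι → ℝ × ℝ → ℝ}
    {a₀ a₁ a₂ : ι → ℝ → ℝ} {c : ℝ} (ja : Jet J Ω f a₀ a₁ a₂)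
    (sa0 : UnifSq J h (fun i s => a₀ i s - 1)) (sa1 : UnifSq J h a₁)
    (sa2 : UnifSq J h (fun i s => a₂ i s - c * κ i s)) {m : ℝ} (hm : 0 < m)
    (hfm : ∀ i, ∀ p ∈ Ω, m ≤ f i p) (ham : ∀ i, ∀ s ∈ J, m ≤ a₀ i s) :
    ∃ b₁ b₂ : ι → ℝ → ℝ, Jet J Ω (fun i p => (√(f i p))⁻¹) (fun i s => (√(a₀ i s))⁻¹) b₁ b₂ ∧
      UnifSq J h (fun i s => (√(a₀ i s))⁻¹ - 1) ∧ UnifSq J h b₁ ∧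
      UnifSq J h (fun i s => b₂ i s - (-(c / 2)) * κ i s) := by
  obtain ⟨b₀, b₁, b₂, jb, e0, e1, e2⟩ := ja.inv_sqrt hΩ hm hfm ham
  obtain rfl : b₀ = fun i s => (√(a₀ i s))⁻¹ := by ext i s; exact e0 i s
  have hsm := Real.sqrt_pos.mpr hm
  have ls := ja.lip_zero.sqrt hm ham
  have li := ja.lip_zero.inv hm ham
  have l0 := jb.lip_zero
  have l2 := ((UnifLip.const (ι := ι) (S := J) (1 : ℝ)).add ls).inv one_pos
    fun i s _ => le_add_of_nonneg_right (Real.sqrt_nonneg _)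
  have s0 : UnifSq J h (fun i s => (√(a₀ i s))⁻¹ - 1) := by
    refine ((sa0.mul_unifLip (l0.mul l2)).neg).congr fun i s hs => ?_
    have h1 := hm.trans_le (ham i s hs)
    have h2 := Real.sqrt_pos.mpr h1
    have h3 := Real.sq_sqrt h1.le
    have h4 : a₀ i s - 1 = (√(a₀ i s) - 1) * (1 + √(a₀ i s)) := by linear_combination -h3
    rw [h4]
    field_simp
    ring
  have s1 : UnifSq J h b₁ := ((sa1.mul_unifLip (l0.mul li)).const_mul (-(1 / 2))).congr
    fun i s _ => by rw [e1]; ring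
  refine ⟨b₁, b₂, jb, s0, s1, ?_⟩
  have t1 := sa2.mul_unifLip (l0.mul li)
  have t2 := s0.mul_unifLip ((((l0.pow 2).add l0).add (UnifLip.const 1)).mul (hκ.const_mul c))
  have t3 := sa1.mul_unifLip (jb.lip_one.mul li)
  have t4 := s1.mul_unifLip (jb.lip_one.mul ls)
  refine ((((t1.add t2).add (t3.const_mul 2)).add t4).const_mul (-(1 / 2))).congr
    fun i s hs => ?_
  have h1 := hm.trans_le (ham i s hs)
  have h5 : (a₀ i s)⁻¹ = (√(a₀ i s))⁻¹ ^ 2 := by rw [inv_pow, Real.sq_sqrt h1.le]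
  rw [e2, h5]
  ring

end UnitJets

/-! ### Taylor expansion with integral remainder. -/

section Taylor

variable {ι : Type*} {J : Set ℝ} {Ω : Set (ℝ × ℝ)}

/-- Weighted average of `g` over the segment from `s` to `s + x`, where `p = (s, x)`. -/
noncomputable def segAvg (N : ℕ) (g : ℝ → E3) (p : ℝ × ℝ) : E3 :=
  ∫ θ in (0 : ℝ)..1, (1 - θ) ^ N • g (p.1 + θ * p.2)

theorem IsIncrDomain.segment_mem (hΩ : IsIncrDomain J Ω) {p : ℝ × ℝ} (hp : p ∈ Ω) {θ : ℝ}
    (h0 : 0 ≤ θ) (h1 : θ ≤ 1) : p.1 + θ * p.2 ∈ J := by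
  have := hΩ.convex (hΩ.fst_mem p hp) (hΩ.add_mem p hp) (sub_nonneg.mpr h1) h0 (by ring)
  convert this using 1
  simp only [smul_eq_mul]; ring

/-- Taylor remainders written as weighted averages of a derivative stay Lipschitz jointly in s and
x, also at x = 0, and so qualify as remainders of a `Jet`. -/
theorem UnifLip.segAvg (hΩ : IsIncrDomain J Ω) {g : ι → ℝ → E3} (hc : ∀ i, Continuous (g i))
    (hg : UnifLip J g) (N : ℕ) : UnifLip Ω (fun i => segAvg N (g i)) := by
  obtain ⟨C, h0, hb, hl⟩ := hg
  have hw : ∀ θ ∈ Set.uIoc (0 : ℝ) 1, |(1 - θ) ^ N| ≤ 1 := by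
    intro θ hθ
    rw [Set.uIoc_of_le zero_le_one] at hθ
    rw [abs_pow]
    refine pow_le_one₀ (abs_nonneg _) (abs_le.mpr ⟨?_, ?_⟩) <;> linarith [hθ.1, hθ.2]
  have hi : ∀ i (p : ℝ × ℝ), IntervalIntegrable (fun θ : ℝ => (1 - θ) ^ N • g i (p.1 + θ * p.2))
      MeasureTheory.volume 0 1 := fun i p => by
    have := hc i
    exact Continuous.intervalIntegrable (by fun_prop) _ _
  refine UnifLip.of_bounds (C := C) (C' := 2 * C) (fun i p hp => ?_) fun i p hp q hq => ?_
  · have := intervalIntegral.norm_integral_le_of_norm_le_const (a := (0 : ℝ)) (b := 1) (C := C)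
      (f := fun θ : ℝ => (1 - θ) ^ N • g i (p.1 + θ * p.2)) fun θ hθ => by
        have h1 := hw θ hθ
        rw [Set.uIoc_of_le zero_le_one] at hθ
        have h2 := hb i _ (hΩ.segment_mem hp hθ.1.le hθ.2)
        rw [norm_smul, Real.norm_eq_abs]
        nlinarith [norm_nonneg (g i (p.1 + θ * p.2))]
    simpa [MagnetChain.segAvg] using this
  · rw [MagnetChain.segAvg, MagnetChain.segAvg, ← intervalIntegral.integral_sub (hi i p) (hi i q)]
    have := intervalIntegral.norm_integral_le_of_norm_le_const (a := (0 : ℝ)) (b := 1)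
      (C := 2 * C * dist p q)
      (f := fun θ : ℝ => (1 - θ) ^ N • g i (p.1 + θ * p.2) - (1 - θ) ^ N • g i (q.1 + θ * q.2))
      fun θ hθ => by
        have h1 := hw θ hθ
        rw [Set.uIoc_of_le zero_le_one] at hθ
        have h2 := hl i _ (hΩ.segment_mem hp hθ.1.le hθ.2) _ (hΩ.segment_mem hq hθ.1.le hθ.2)
        rw [← smul_sub, norm_smul, Real.norm_eq_abs]
        have h3 : dist (p.1 + θ * p.2) (q.1 + θ * q.2) ≤ 2 * dist p q := by
          rw [Real.dist_eq]
          have e : p.1 + θ * p.2 - (q.1 + θ * q.2) = (p.1 - q.1) + θ * (p.2 - q.2) := by ring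
          have h4 : |p.1 - q.1| ≤ dist p q := le_max_left _ _
          have h5 : |p.2 - q.2| ≤ dist p q := le_max_right _ _
          rw [e]
          refine (abs_add_le _ _).trans ?_
          rw [abs_mul, abs_of_pos hθ.1]
          nlinarith [abs_nonneg (p.2 - q.2), hθ.2]
        have h4 : C * dist (p.1 + θ * p.2) (q.1 + θ * q.2) ≤ C * (2 * dist p q) := by gcongr
        nlinarith [norm_nonneg (g i (p.1 + θ * p.2) - g i (q.1 + θ * q.2))]
    simpa using this

theorem smul_segAvg_zero {g g' : ℝ → E3} (hd : ∀ s, HasDerivAt g (g' s) s) (hc : Continuous g')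
    (p : ℝ × ℝ) : p.2 • segAvg 0 g' p = g (p.1 + p.2) - g p.1 := by
  rw [segAvg, ← intervalIntegral.integral_smul]
  have := intervalIntegral.integral_eq_sub_of_hasDerivAt (a := (0 : ℝ)) (b := 1)
    (f := fun θ : ℝ => g (p.1 + θ * p.2)) (f' := fun θ : ℝ => p.2 • g' (p.1 + θ * p.2))
    (fun θ _ => by
      have h1 : HasDerivAt (fun θ : ℝ => p.1 + θ * p.2) (1 * p.2) θ :=
        ((hasDerivAt_id θ).mul_const p.2).const_add _
      simpa [Function.comp_def] using (hd (p.1 + θ * p.2)).scomp θ h1)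
    (Continuous.intervalIntegrable (by fun_prop) _ _)
  simpa using this

/-- Integration by parts in θ. Each application extracts one more Taylor coefficient. -/
theorem segAvg_eq {g g' : ℝ → E3} (hd : ∀ s, HasDerivAt g (g' s) s) (hc : Continuous g')
    (N : ℕ) (p : ℝ × ℝ) :
    segAvg N g p = (1 / (N + 1 : ℝ)) • (g p.1 + p.2 • segAvg (N + 1) g' p) := by
  have hcg : Continuous g := continuous_iff_continuousAt.mpr fun s => (hd s).continuousAt
  have hN : (N + 1 : ℝ) ≠ 0 := by positivity
  have := intervalIntegral.integral_eq_sub_of_hasDerivAt (a := (0 : ℝ)) (b := 1)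
    (f := fun θ : ℝ => -(1 - θ) ^ (N + 1) • g (p.1 + θ * p.2))
    (f' := fun θ : ℝ => (N + 1 : ℝ) • ((1 - θ) ^ N • g (p.1 + θ * p.2))
      - p.2 • ((1 - θ) ^ (N + 1) • g' (p.1 + θ * p.2)))
    (fun θ _ => by
      have h1 : HasDerivAt (fun θ : ℝ => p.1 + θ * p.2) (1 * p.2) θ :=
        ((hasDerivAt_id θ).mul_const p.2).const_add _
      have h2 : HasDerivAt (fun θ : ℝ => -(1 - θ) ^ (N + 1)) ((N + 1 : ℝ) * (1 - θ) ^ N) θ := by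
        have := ((((hasDerivAt_id' θ).const_sub 1).fun_pow (N + 1)).fun_neg)
        refine this.congr_deriv ?_
        push_cast
        ring
      have h3 := h2.fun_smul ((hd (p.1 + θ * p.2)).scomp θ h1)
      simp only [Function.comp_def] at h3
      convert h3 using 1
      module)
    (Continuous.intervalIntegrable (by fun_prop) _ _)
  rw [intervalIntegral.integral_sub (Continuous.intervalIntegrable (by fun_prop) _ _)
    (Continuous.intervalIntegrable (by fun_prop) _ _), intervalIntegral.integral_smul,
    intervalIntegral.integral_smul] at this
  have e : (N + 1 : ℝ) • segAvg N g p - p.2 • segAvg (N + 1) g' p = g p.1 := by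
    simpa [segAvg] using this
  rw [← e, sub_add_cancel, smul_smul, one_div, inv_mul_cancel₀ hN, one_smul]

end Taylor

/-! ### Expansions of chord, field and kernel along a curve. -/

section CurveFamily

variable {ι : Type*} {J : Set ℝ} {Ω : Set (ℝ × ℝ)} {h : ι → ℝ}

/-- A family of curves, `d k i` being the `k`-th derivative of the `i`-th one, with uniformly
bounded derivatives, without self-contact, and parametrized by arc length up to `O(h²)`. -/
structure CurveFamily (J : Set ℝ) (Ω : Set (ℝ × ℝ)) (h : ι → ℝ) (d : ℕ → ι → ℝ → E3) :
    Prop where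
  dom : IsIncrDomain J Ω
  deriv : ∀ k i s, HasDerivAt (d k i) (d (k + 1) i s) s
  bdd : ∀ k, 1 ≤ k → k ≤ 6 → ∃ C, ∀ i, ∀ s ∈ J, ‖d k i s‖ ≤ C
  sep : ∃ c > 0, ∀ i, ∀ p ∈ Ω, c * |p.2| ≤ ‖d 0 i (p.1 + p.2) - d 0 i p.1‖
  speed_ge : ∀ i, ∀ s ∈ J, 1 / 2 ≤ ‖d 1 i s‖ ^ 2
  speed : UnifSq J h (fun i s => ‖d 1 i s‖ ^ 2 - 1)
  inner_one_two : UnifSq J h (fun i s => inner ℝ (d 1 i s) (d 2 i s))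
  inner_one_three : UnifSq J h (fun i s => inner ℝ (d 1 i s) (d 3 i s) + ‖d 2 i s‖ ^ 2)

variable {d : ℕ → ι → ℝ → E3}

theorem CurveFamily.continuous (hd : CurveFamily J Ω h d) (k : ℕ) (i : ι) :
    Continuous (d k i) := continuous_iff_continuousAt.mpr fun s => (hd.deriv k i s).continuousAt

theorem CurveFamily.unifLip (hd : CurveFamily J Ω h d) {k : ℕ} (h1 : 1 ≤ k) (h5 : k ≤ 5) :
    UnifLip J (d k) := by
  obtain ⟨C, hC⟩ := hd.bdd k h1 (by omega)
  obtain ⟨C', hC'⟩ := hd.bdd (k + 1) (by omega) (by omega)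
  refine UnifLip.of_bounds hC (C' := C') fun i p hp q hq => ?_
  rw [dist_eq_norm]
  exact hd.dom.convex.norm_image_sub_le_of_norm_hasDerivWithin_le
    (fun s _ => (hd.deriv k i s).hasDerivWithinAt) (hC' i) hq hp

/-- The difference quotient of the curve. -/
noncomputable def chord (d : ℕ → ι → ℝ → E3) (i : ι) (p : ℝ × ℝ) : E3 := segAvg 0 (d 1 i) p

theorem CurveFamily.smul_chord (hd : CurveFamily J Ω h d) (i : ι) (p : ℝ × ℝ) :
    p.2 • chord d i p = d 0 i (p.1 + p.2) - d 0 i p.1 :=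
  smul_segAvg_zero (hd.deriv 0 i) (hd.continuous 1 i) p

theorem CurveFamily.jet_chord (hd : CurveFamily J Ω h d) :
    Jet J Ω (chord d) (d 1) (fun i s => (1 / 2 : ℝ) • d 2 i s)
      (fun i s => (1 / 6 : ℝ) • d 3 i s) := by
  refine ⟨hd.unifLip le_rfl (by norm_num), (hd.unifLip (by norm_num) (by norm_num)).const_smul _,
    (hd.unifLip (by norm_num) (by norm_num)).const_smul _, _,
    ((hd.unifLip (k := 4) (by norm_num) (by norm_num)).segAvg hd.dom (hd.continuous 4)
      3).const_smul (1 / 6), fun i p hp => ?_⟩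
  rw [chord, segAvg_eq (hd.deriv 1 i) (hd.continuous 2 i),
    segAvg_eq (hd.deriv 2 i) (hd.continuous 3 i), segAvg_eq (hd.deriv 3 i) (hd.continuous 4 i)]
  norm_num
  module

theorem CurveFamily.jet_tangent (hd : CurveFamily J Ω h d) :
    Jet J Ω (fun i p => d 1 i (p.1 + p.2)) (d 1) (d 2) (fun i s => (1 / 2 : ℝ) • d 3 i s) := by
  refine ⟨hd.unifLip le_rfl (by norm_num), hd.unifLip (by norm_num) (by norm_num),
    (hd.unifLip (by norm_num) (by norm_num)).const_smul _, _,
    ((hd.unifLip (k := 4) (by norm_num) (by norm_num)).segAvg hd.dom (hd.continuous 4)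
      2).const_smul (1 / 2), fun i p hp => ?_⟩
  rw [← sub_add_cancel (d 1 i (p.1 + p.2)) (d 1 i p.1),
    ← smul_segAvg_zero (hd.deriv 1 i) (hd.continuous 2 i),
    segAvg_eq (hd.deriv 2 i) (hd.continuous 3 i), segAvg_eq (hd.deriv 3 i) (hd.continuous 4 i)]
  norm_num
  module

theorem jet_fst {F : Type*} [NormedAddCommGroup F] [NormedSpace ℝ F]
    {f : ι → ℝ → F} (hf : UnifLip J f) :
    Jet J Ω (fun i p => f i p.1) f (fun _ _ => 0) (fun _ _ => 0) :=
  ⟨hf, UnifLip.const 0, UnifLip.const 0, fun _ _ => 0, UnifLip.const 0, fun i p _ => by simp⟩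

/-- Field at a point of the curve of a dipole pointing along the curve, both rescaled: `D` is the
difference quotient of the curve and `T` its derivative at the dipole. -/
noncomputable def scaledField (D T : E3) : E3 :=
  (3 * (inner ℝ D T * (‖D‖⁻¹) ^ 5)) • D - (‖D‖⁻¹) ^ 3 • T

/-- For x ≠ 0 this is the absence of self-contact divided by |x|; at x = 0 the chord is the tangent,
and the lower bound on the speed takes over. -/
theorem CurveFamily.chord_ge (hd : CurveFamily J Ω h d) :
    ∃ m > 0, m ≤ 1 / 2 ∧ ∀ i, ∀ p ∈ Ω, m ≤ ‖chord d i p‖ ^ 2 := by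
  obtain ⟨c, hc, hs⟩ := hd.sep
  refine ⟨min (1 / 2) (c ^ 2), by positivity, min_le_left _ _, fun i p hp => ?_⟩
  rcases eq_or_ne p.2 0 with h0 | h0
  · have : chord d i p = d 1 i p.1 := by simp [chord, segAvg, h0]
    rw [this]
    exact (min_le_left _ _).trans (hd.speed_ge i _ (hd.dom.fst_mem p hp))
  · refine (min_le_right _ _).trans ?_
    have h1 := hs i p hp
    rw [← hd.smul_chord, norm_smul, Real.norm_eq_abs, mul_comm] at h1
    have h2 := le_of_mul_le_mul_left h1 (abs_pos.mpr h0)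
    gcongr

/-- Expansion of the inverse chord length. -/
theorem CurveFamily.jet_inv_chord (hd : CurveFamily J Ω h d) :
    ∃ b₁ b₂ : ι → ℝ → ℝ, Jet J Ω (fun i p => ‖chord d i p‖⁻¹) (fun i s => ‖d 1 i s‖⁻¹) b₁ b₂ ∧
      UnifSq J h (fun i s => ‖d 1 i s‖⁻¹ - 1) ∧ UnifSq J h b₁ ∧
      UnifSq J h (fun i s => b₂ i s - (1 / 24) * ‖d 2 i s‖ ^ 2) := by
  obtain ⟨m, hm, hm2, hc⟩ := hd.chord_ge
  have l2 := hd.unifLip (k := 2) (by norm_num) (by norm_num)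
  have hκ : UnifLip J (fun i s => ‖d 2 i s‖ ^ 2) :=
    (l2.inner l2).congr fun i s _ => (real_inner_self_eq_norm_sq _).symm
  have j1 := hd.jet_chord.inner hd.dom hd.jet_chord
  -- The x² coefficient of the squared chord is ‖r''‖²/4 + r'·r'''/3, that is, (1/4 - 1/3)‖r''‖² =
  -- -‖r''‖²/12 modulo O(h²).
  obtain ⟨b₁, b₂, jb, s0, s1, s2⟩ := UnitJet.inv_sqrt (h := h) (c := -(1 / 12)) hd.dom hκ j1
    (hd.speed.congr fun i s _ => by rw [real_inner_self_eq_norm_sq])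
    (hd.inner_one_two.congr fun i s _ => by
      rw [inner_smul_left, inner_smul_right, real_inner_comm (d 1 i s)]; simp; ring)
    ((hd.inner_one_three.const_mul (1 / 3)).congr fun i s _ => by
      simp only [inner_smul_left, inner_smul_right, real_inner_comm (d 1 i s),
        real_inner_self_eq_norm_sq]
      simp; ring)
    hm (fun i p hp => by rw [real_inner_self_eq_norm_sq]; exact hc i p hp)
    (fun i s hs => by
      rw [real_inner_self_eq_norm_sq]; exact hm2.trans (hd.speed_ge i s hs))
  simp only [real_inner_self_eq_norm_sq, Real.sqrt_sq (norm_nonneg _)] at jb s0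
  exact ⟨b₁, b₂, jb, s0, s1, s2.congr fun i s _ => by ring⟩

/-- Expansion of the rescaled field of the curve along itself. -/
theorem CurveFamily.jet_field (hd : CurveFamily J Ω h d) :
    ∃ v₁ v₂ : ι → ℝ → E3, Jet J Ω (fun i p => scaledField (chord d i p) (d 1 i (p.1 + p.2)))
      (fun i s => (2 * ‖d 1 i s‖⁻¹ ^ 3) • d 1 i s) v₁ v₂ := by
  obtain ⟨b₁, b₂, jb, -⟩ := hd.jet_inv_chord
  have j2 := jb.smul hd.dom jb
  have j3 := j2.smul hd.dom jb
  have j5 := j3.smul hd.dom j2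
  have jP := hd.jet_chord.inner hd.dom hd.jet_tangent
  have jA := (((jP.smul hd.dom j5).const_smul 3).smul hd.dom hd.jet_chord).add
    ((j3.smul hd.dom hd.jet_tangent).const_smul (-1))
  refine ⟨_, _, jA.congr hd.dom (fun i p hp => ?_) (fun i s hs => ?_) (fun _ _ _ => rfl)
    fun _ _ _ => rfl⟩
  · simp only [scaledField, smul_eq_mul]
    module
  · have h1 : ‖d 1 i s‖ ≠ 0 := by
      intro h0
      have := hd.speed_ge i s hs
      norm_num [h0] at this
    simp only [smul_eq_mul, real_inner_self_eq_norm_sq]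
    rw [smul_smul, ← add_smul]
    congr 1
    field_simp
    ring

/-- Expansion of the rescaled kernel: the two coefficients after the leading one are `O(h²)`. -/
theorem CurveFamily.jet_kernel (hd : CurveFamily J Ω h d) :
    ∃ g₁ g₂ : ι → ℝ → ℝ, Jet J Ω (fun i p =>
      inner ℝ (scaledField (chord d i p) (d 1 i (p.1 + p.2))) (d 1 i p.1))
      (fun i s => 2 * ‖d 1 i s‖⁻¹) g₁ g₂ ∧ UnifSq J h g₁ ∧ UnifSq J h g₂ := by
  obtain ⟨b₁, b₂, jb, sb0, sb1, sb2⟩ := hd.jet_inv_chord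
  have l2 := hd.unifLip (k := 2) (by norm_num) (by norm_num)
  have hκ : UnifLip J (fun i s => ‖d 2 i s‖ ^ 2) :=
    (l2.inner l2).congr fun i s _ => (real_inner_self_eq_norm_sq _).symm
  have ub : UnitJet J Ω h (fun i s => ‖d 2 i s‖ ^ 2) (fun i p => ‖chord d i p‖⁻¹)
      (fun i s => ‖d 1 i s‖⁻¹) (1 / 24) :=
    ⟨_, _, jb, sb0, sb1, sb2⟩
  have jd1 := jet_fst (Ω := Ω) (hd.unifLip (k := 1) le_rfl (by norm_num))
  have uP : UnitJet J Ω h (fun i s => ‖d 2 i s‖ ^ 2)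
      (fun i p => inner ℝ (chord d i p) (d 1 i (p.1 + p.2)))
      (fun i s => inner ℝ (d 1 i s) (d 1 i s)) (-(1 / 6)) := by
    refine ⟨_, _, hd.jet_chord.inner hd.dom hd.jet_tangent, ?_, ?_, ?_⟩
    · exact hd.speed.congr fun i s _ => by simp only [real_inner_self_eq_norm_sq]
    · exact (hd.inner_one_two.const_mul (3 / 2)).congr fun i s _ => by
        rw [inner_smul_left, real_inner_comm (d 1 i s)]; simp; ring
    · exact (hd.inner_one_three.const_mul (2 / 3)).congr fun i s _ => by
        simp only [inner_smul_left, inner_smul_right, real_inner_comm (d 1 i s),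
          real_inner_self_eq_norm_sq]
        simp; ring
  have uQ : UnitJet J Ω h (fun i s => ‖d 2 i s‖ ^ 2)
      (fun i p => inner ℝ (chord d i p) (d 1 i p.1))
      (fun i s => inner ℝ (d 1 i s) (d 1 i s)) (-(1 / 6)) := by
    refine ⟨_, _, hd.jet_chord.inner hd.dom jd1, ?_, ?_, ?_⟩
    · exact hd.speed.congr fun i s _ => by simp only [real_inner_self_eq_norm_sq]
    · exact (hd.inner_one_two.const_mul (1 / 2)).congr fun i s _ => by
        rw [inner_smul_left, real_inner_comm (d 1 i s)]; simp
    · exact (hd.inner_one_three.const_mul (1 / 6)).congr fun i s _ => by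
        simp only [inner_zero_right, real_inner_comm (d 1 i s), inner_smul_right]
        ring
  have uR : UnitJet J Ω h (fun i s => ‖d 2 i s‖ ^ 2)
      (fun i p => inner ℝ (d 1 i (p.1 + p.2)) (d 1 i p.1))
      (fun i s => inner ℝ (d 1 i s) (d 1 i s)) (-(1 / 2)) := by
    refine ⟨_, _, hd.jet_tangent.inner hd.dom jd1, ?_, ?_, ?_⟩
    · exact hd.speed.congr fun i s _ => by simp only [real_inner_self_eq_norm_sq]
    · exact hd.inner_one_two.congr fun i s _ => by
        rw [real_inner_comm (d 1 i s)]; simp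
    · exact (hd.inner_one_three.const_mul (1 / 2)).congr fun i s _ => by
        simp only [inner_zero_right, real_inner_comm (d 1 i s), inner_smul_right]
        ring
  -- With D the chord, T the tangent at s + x and T₀ the tangent at s, the kernel is 3
  -- (D·T)(D·T₀)‖D‖⁻⁵ - (T·T₀)‖D‖⁻³.
  obtain ⟨a₁, a₂, ja, sa0, sa1, sa2⟩ :=
    (uP.mul hd.dom hκ uQ).mul hd.dom hκ (ub.pow hd.dom hκ 4)
  obtain ⟨c₁, c₂, jc, sc0, sc1, sc2⟩ := uR.mul hd.dom hκ (ub.pow hd.dom hκ 2)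
  refine ⟨_, _, ((ja.const_smul 3).add (jc.const_smul (-1))).congr hd.dom
    (fun i p hp => ?_) (fun i s hs => ?_) (fun _ _ _ => rfl) (fun _ _ _ => rfl), ?_, ?_⟩
  · simp only [scaledField, smul_eq_mul, inner_sub_left, inner_smul_left]
    simp
    ring
  · have h1 : ‖d 1 i s‖ ≠ 0 := by
      intro h0
      have := hd.speed_ge i s hs
      norm_num [h0] at this
    have h2 := mul_inv_cancel₀ h1
    simp only [smul_eq_mul, real_inner_self_eq_norm_sq]
    generalize ‖d 1 i s‖⁻¹ = u at h2 ⊢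
    generalize ‖d 1 i s‖ = v at h2 ⊢
    linear_combination (u * (v * u + 1) - 3 * u * (v ^ 3 * u ^ 3 + v ^ 2 * u ^ 2 + v * u + 1)) * h2
  · exact (sa1.const_mul 3).add (sc1.const_mul (-1))
  -- The decisive cancellation: 3(-1/6 - 1/6 + 5/24) - (-1/2 + 3/24) = 0, so that no multiple of
  -- ‖r''‖² survives.
  · refine ((sa2.const_mul 3).add (sc2.const_mul (-1))).congr fun i s _ => ?_
    simp only [smul_eq_mul]
    push_cast
    ring

end CurveFamily

/-! ### Touching spheres force almost unit speed. -/

section Spacing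

theorem norm_segAvg_le {g : ℝ → E3} {p : ℝ × ℝ} {M : ℝ}
    (hg : ∀ θ : ℝ, 0 ≤ θ → θ ≤ 1 → ‖g (p.1 + θ * p.2)‖ ≤ M) (N : ℕ) : ‖segAvg N g p‖ ≤ M := by
  have := intervalIntegral.norm_integral_le_of_norm_le_const (a := (0 : ℝ)) (b := 1) (C := M)
    (f := fun θ : ℝ => (1 - θ) ^ N • g (p.1 + θ * p.2)) fun θ hθ => by
      rw [Set.uIoc_of_le zero_le_one] at hθ
      have h2 := hg θ hθ.1.le hθ.2
      have h1 : |(1 - θ) ^ N| ≤ 1 := by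
        rw [abs_pow]
        refine pow_le_one₀ (abs_nonneg _) (abs_le.mpr ⟨?_, ?_⟩) <;> linarith [hθ.1, hθ.2]
      rw [norm_smul, Real.norm_eq_abs]
      nlinarith [norm_nonneg (g (p.1 + θ * p.2)), abs_nonneg ((1 - θ) ^ N)]
  simpa [segAvg] using this

theorem abs_le_of_abs_deriv_le {f f' : ℝ → ℝ} (hf : ∀ s, HasDerivAt f (f' s) s) {a b K ξ s : ℝ}
    (hK : ∀ t ∈ Set.Icc a b, |f' t| ≤ K) (hξ : ξ ∈ Set.Icc a b) (hs : s ∈ Set.Icc a b) :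
    |f s| ≤ |f ξ| + K * (b - a) := by
  have h1 := (convex_Icc a b).norm_image_sub_le_of_norm_hasDerivWithin_le
    (fun t _ => (hf t).hasDerivWithinAt) hK hξ hs
  rw [Real.norm_eq_abs, Real.norm_eq_abs] at h1
  have h2 : |s - ξ| ≤ b - a := abs_le.mpr ⟨by linarith [hs.1, hξ.2], by linarith [hs.2, hξ.1]⟩
  have h3 : 0 ≤ K := (abs_nonneg _).trans (hK s hs)
  have h4 := abs_sub_abs_le_abs_sub (f s) (f ξ)
  nlinarith [mul_le_mul_of_nonneg_left h2 h3]

theorem abs_le_of_exists_zero {f f' : ℝ → ℝ} (hf : ∀ s, HasDerivAt f (f' s) s) {a b K : ℝ}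
    (hK : ∀ t ∈ Set.Icc a b, |f' t| ≤ K) (h0 : ∃ ξ ∈ Set.Icc a b, f ξ = 0) :
    ∀ s ∈ Set.Icc a b, |f s| ≤ K * (b - a) := by
  obtain ⟨ξ, hξ, e⟩ := h0
  intro s hs
  simpa [e] using abs_le_of_abs_deriv_le hf hK hξ hs

theorem exists_zero_deriv {f f' : ℝ → ℝ} (hf : ∀ s, HasDerivAt f (f' s) s) {a b : ℝ} (hab : a < b)
    (ha : f a = 0) (hb : f b = 0) : ∃ c ∈ Set.Ioo a b, f' c = 0 :=
  exists_hasDerivAt_eq_zero hab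
    (continuous_iff_continuousAt.mpr fun s => (hf s).continuousAt).continuousOn (by rw [ha, hb])
    fun s _ => hf s

/-- A function with four consecutive zeros at distance `h` is small with its derivatives. -/
theorem small_of_four_zeros {g₀ g₁ g₂ g₃ g₄ : ℝ → ℝ} (hg₀ : ∀ s, HasDerivAt g₀ (g₁ s) s)
    (hg₁ : ∀ s, HasDerivAt g₁ (g₂ s) s) (hg₂ : ∀ s, HasDerivAt g₂ (g₃ s) s)
    (hg₃ : ∀ s, HasDerivAt g₃ (g₄ s) s) {a h K : ℝ} (hh : 0 < h) (hK : ∀ t ∈ Set.Icc a (a + 3 * h), |g₄ t| ≤ K)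
    (h0 : g₀ a = 0) (h1 : g₀ (a + h) = 0) (h2 : g₀ (a + 2 * h) = 0)
    (h3 : g₀ (a + 3 * h) = 0) : ∀ s ∈ Set.Icc a (a + 3 * h),
      |g₀ s| ≤ 81 * K * h ^ 4 ∧ |g₁ s| ≤ 27 * K * h ^ 3 ∧ |g₂ s| ≤ 9 * K * h ^ 2 ∧
        |g₃ s| ≤ 3 * K * h := by
  -- Rolle's theorem yields three zeros of g₁, two of g₂ and one of g₃. Integrating back from these
  -- zeros costs one factor 3h, the length of the window, per order.
  obtain ⟨x₁, hx₁, e₁⟩ := exists_zero_deriv hg₀ (by linarith) h0 h1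
  obtain ⟨x₂, hx₂, e₂⟩ := exists_zero_deriv hg₀ (by linarith) h1 h2
  obtain ⟨x₃, hx₃, e₃⟩ := exists_zero_deriv hg₀ (by linarith) h2 h3
  obtain ⟨y₁, hy₁, u₁⟩ := exists_zero_deriv hg₁ (hx₁.2.trans hx₂.1) e₁ e₂
  obtain ⟨y₂, hy₂, u₂⟩ := exists_zero_deriv hg₁ (hx₂.2.trans hx₃.1) e₂ e₃
  obtain ⟨z, hz, v⟩ := exists_zero_deriv hg₂ (hy₁.2.trans hy₂.1) u₁ u₂
  have a3 := abs_le_of_exists_zero hg₃ hK ⟨z, ⟨by linarith [hz.1, hy₁.1, hx₁.1],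
    by linarith [hz.2, hy₂.2, hx₃.2]⟩, v⟩
  have a2 := abs_le_of_exists_zero hg₂ a3 ⟨y₁, ⟨by linarith [hy₁.1, hx₁.1],
    by linarith [hy₁.2, hx₂.2]⟩, u₁⟩
  have a1 := abs_le_of_exists_zero hg₁ a2 ⟨x₁, ⟨by linarith [hx₁.1],
    by linarith [hx₁.2]⟩, e₁⟩
  have a0 := abs_le_of_exists_zero hg₀ a1 ⟨a, ⟨le_rfl, by linarith⟩, h0⟩
  intro s hs
  refine ⟨(a0 s hs).trans (le_of_eq (by ring)), (a1 s hs).trans (le_of_eq (by ring)),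
    (a2 s hs).trans (le_of_eq (by ring)), (a3 s hs).trans (le_of_eq (by ring))⟩

theorem abs_inner_sub_inner_le {x x₀ y y₀ : E3} {a b m n : ℝ} (hx : ‖x - x₀‖ ≤ a)
    (hy : ‖y - y₀‖ ≤ b) (hx₀ : ‖x₀‖ ≤ m) (hyn : ‖y‖ ≤ n) :
    |inner ℝ x y - inner ℝ x₀ y₀| ≤ a * n + m * b := by
  have e : (inner ℝ x y : ℝ) - inner ℝ x₀ y₀ = inner ℝ (x - x₀) y + inner ℝ x₀ (y - y₀) := by
    rw [inner_sub_left, inner_sub_right]; ring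
  rw [e]
  refine (abs_add_le _ _).trans (add_le_add ?_ ?_)
  · exact (abs_real_inner_le_norm _ _).trans
      (mul_le_mul hx hyn (norm_nonneg _) ((norm_nonneg _).trans hx))
  · exact (abs_real_inner_le_norm _ _).trans
      (mul_le_mul hx₀ hy (norm_nonneg _) ((norm_nonneg _).trans hx₀))

theorem abs_inner_le {x y : E3} {m n : ℝ} (hx : ‖x‖ ≤ m) (hy : ‖y‖ ≤ n) :
    |inner ℝ x y| ≤ m * n :=
  (abs_real_inner_le_norm _ _).trans (mul_le_mul hx hy (norm_nonneg _) ((norm_nonneg _).trans hx))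

/-- The integer window of four consecutive grid points around a point. -/
theorem exists_window {A B : ℤ} (hAB : A + 4 ≤ B) {h s : ℝ} (hh : 0 < h)
    (h1 : (A : ℝ) * h ≤ s) (h2 : s ≤ ((B : ℝ) - 1) * h) :
    ∃ j : ℤ, A ≤ j ∧ j + 4 ≤ B ∧ s ∈ Set.Icc ((j : ℝ) * h) (j * h + 3 * h) := by
  have f1 := Int.floor_le (s / h)
  have f2 := Int.lt_floor_add_one (s / h)
  rw [le_div_iff₀ hh] at f1
  rw [div_lt_iff₀ hh] at f2
  have f3 : A ≤ ⌊s / h⌋ := Int.le_floor.mpr (by rwa [le_div_iff₀ hh])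
  rcases le_total ⌊s / h⌋ (B - 4) with hc | hc
  · exact ⟨⌊s / h⌋, f3, by omega, f1, by nlinarith⟩
  · refine ⟨B - 4, by omega, by omega, ?_, ?_⟩
    · have : ((B - 4 : ℤ) : ℝ) ≤ (⌊s / h⌋ : ℝ) := by exact_mod_cast hc
      push_cast at this ⊢
      nlinarith
    · push_cast
      linarith

variable {d : ℕ → ℝ → E3} {M h : ℝ}

/-- Difference quotients with a fixed step. -/
theorem exists_diffQuot (hd : ∀ k s, HasDerivAt (d k) (d (k + 1) s) s) (hh : 0 < h) :
    ∃ D : ℕ → ℝ → E3, (∀ k t, HasDerivAt (D k) (D (k + 1) t) t) ∧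
      (∀ k t, D k t = h⁻¹ • (d k (t + h) - d k t)) ∧
      ∀ k t, D k t = segAvg 0 (d (k + 1)) (t, h) := by
  refine ⟨fun k t => h⁻¹ • (d k (t + h) - d k t), fun k t => ?_, fun _ _ => rfl, fun k t => ?_⟩
  · have h1 : HasDerivAt (fun t => d k (t + h)) (d (k + 1) (t + h)) t :=
      (hd k (t + h)).comp_add_const t h
    exact (h1.fun_sub (hd k t)).fun_const_smul h⁻¹
  · have := smul_segAvg_zero (hd k)
      (continuous_iff_continuousAt.mpr fun s => (hd (k + 1) s).continuousAt) (t, h)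
    simp only
    rw [← this, smul_smul, inv_mul_cancel₀ hh.ne', one_smul]

/-- The squared length of the difference quotient minus 1 vanishes at four consecutive grid points.
Its fourth derivative is at most (6 + 8 + 2) M². -/
theorem small_of_four_unit {D : ℕ → ℝ → E3} (hD : ∀ k t, HasDerivAt (D k) (D (k + 1) t) t)
    {a : ℝ} (hh : 0 < h) (hM : ∀ t ∈ Set.Icc a (a + 3 * h), ∀ k ≤ 5, ‖D k t‖ ≤ M)
    (h0 : ‖D 0 a‖ = 1) (h1 : ‖D 0 (a + h)‖ = 1) (h2 : ‖D 0 (a + 2 * h)‖ = 1)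
    (h3 : ‖D 0 (a + 3 * h)‖ = 1) : ∀ t ∈ Set.Icc a (a + 3 * h),
      |inner ℝ (D 0 t) (D 0 t) - 1| ≤ 81 * (16 * M ^ 2) * h ^ 4 ∧
      |2 * inner ℝ (D 0 t) (D 1 t)| ≤ 27 * (16 * M ^ 2) * h ^ 3 ∧
      |2 * inner ℝ (D 1 t) (D 1 t) + 2 * inner ℝ (D 0 t) (D 2 t)| ≤ 9 * (16 * M ^ 2) * h ^ 2 ∧
      |6 * inner ℝ (D 1 t) (D 2 t) + 2 * inner ℝ (D 0 t) (D 3 t)| ≤ 3 * (16 * M ^ 2) * h := by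
  refine small_of_four_zeros (g₀ := fun t => inner ℝ (D 0 t) (D 0 t) - 1)
    (g₁ := fun t => 2 * inner ℝ (D 0 t) (D 1 t))
    (g₂ := fun t => 2 * inner ℝ (D 1 t) (D 1 t) + 2 * inner ℝ (D 0 t) (D 2 t))
    (g₃ := fun t => 6 * inner ℝ (D 1 t) (D 2 t) + 2 * inner ℝ (D 0 t) (D 3 t))
    (g₄ := fun t => 6 * inner ℝ (D 2 t) (D 2 t) + 8 * inner ℝ (D 1 t) (D 3 t)
      + 2 * inner ℝ (D 0 t) (D 4 t)) (fun t => ?_) (fun t => ?_) (fun t => ?_) (fun t => ?_) hh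
    (fun t ht => ?_) ?_ ?_ ?_ ?_
  · refine (((hD 0 t).inner ℝ (hD 0 t)).sub_const 1).congr_deriv ?_
    rw [real_inner_comm (D 0 t)]; ring
  · refine (((hD 0 t).inner ℝ (hD 1 t)).const_mul 2).congr_deriv ?_
    ring
  · refine ((((hD 1 t).inner ℝ (hD 1 t)).const_mul 2).fun_add
      (((hD 0 t).inner ℝ (hD 2 t)).const_mul 2)).congr_deriv ?_
    rw [real_inner_comm (D 1 t) (D 2 t)]; ring
  · refine ((((hD 1 t).inner ℝ (hD 2 t)).const_mul 6).fun_add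
      (((hD 0 t).inner ℝ (hD 3 t)).const_mul 2)).congr_deriv ?_
    ring
  · have hD' := hM t ht
    have i1 := abs_le.mp (abs_inner_le (hD' 2 (by norm_num)) (hD' 2 (by norm_num)))
    have i2 := abs_le.mp (abs_inner_le (hD' 1 (by norm_num)) (hD' 3 (by norm_num)))
    have i3 := abs_le.mp (abs_inner_le (hD' 0 (by norm_num)) (hD' 4 (by norm_num)))
    exact abs_le.mpr ⟨by linarith [i1.1, i2.1, i3.1], by linarith [i1.2, i2.2, i3.2]⟩
  all_goals rw [real_inner_self_eq_norm_sq]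
  · rw [h0]; norm_num
  · rw [h1]; norm_num
  · rw [h2]; norm_num
  · rw [h3]; norm_num

/-- Equally spaced points on a smooth curve force almost unit speed; estimates away from the last
grid cell. -/
theorem speed_estimates_interior (hd : ∀ k s, HasDerivAt (d k) (d (k + 1) s) s) {A B : ℤ}
    (hAB : A + 5 ≤ B) (hh : 0 < h) (hh1 : h ≤ 1)
    (hM : ∀ k, 1 ≤ k → k ≤ 6 → ∀ s ∈ Set.Icc (A * h) (B * h), ‖d k s‖ ≤ M)
    (hsp : ∀ j : ℤ, A ≤ j → j < B → ‖d 0 ((j + 1) * h) - d 0 (j * h)‖ = h)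
    {s : ℝ} (hs : s ∈ Set.Icc (A * h) ((B - 1) * h)) :
    |3 * inner ℝ (d 2 s) (d 3 s) + inner ℝ (d 1 s) (d 4 s)| ≤ 656 * M ^ 2 * h ∧
    |inner ℝ (d 2 s) (d 2 s) + inner ℝ (d 1 s) (d 3 s)| ≤ 1000 * M ^ 2 * h ^ 2 ∧
    |(inner ℝ (d 1 s) (d 2 s) : ℝ)| ≤ 1200 * M ^ 2 * h ^ 2 ∧
    |inner ℝ (d 1 s) (d 1 s) - 1 - h ^ 2 / 12 * inner ℝ (d 2 s) (d 2 s)|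
      ≤ 3000 * M ^ 2 * h ^ 3 := by
  have hc : ∀ k, Continuous (d k) := fun k =>
    continuous_iff_continuousAt.mpr fun s => (hd k s).continuousAt
  have hseg : ∀ t ∈ Set.Icc (A * h) ((B - 1) * h), ∀ k, 1 ≤ k → k ≤ 6 → ∀ θ : ℝ, 0 ≤ θ → θ ≤ 1 →
      ‖d k (((t, h) : ℝ × ℝ).1 + θ * ((t, h) : ℝ × ℝ).2)‖ ≤ M := fun t ht k k1 k6 θ h0 h1 => by
    refine hM k k1 k6 _ ⟨?_, ?_⟩
    · have := ht.1; simp only; nlinarith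
    · have := ht.2; simp only; nlinarith
  obtain ⟨D, hDd, hDq, hDs⟩ := exists_diffQuot hd hh
  have hDM : ∀ t ∈ Set.Icc (A * h) ((B - 1) * h), ∀ k ≤ 5, ‖D k t‖ ≤ M := fun t ht k hk => by
    rw [hDs]
    exact norm_segAvg_le (hseg t ht (k + 1) (by omega) (by omega)) 0
  have hzero : ∀ j : ℤ, A ≤ j → j < B → ‖D 0 (j * h)‖ = 1 := fun j h1 h2 => by
    have := hsp j h1 h2
    rw [hDq, norm_smul, norm_inv, Real.norm_eq_abs, abs_of_pos hh,
      show (j : ℝ) * h + h = (j + 1) * h by ring, this, inv_mul_cancel₀ hh.ne']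
  -- The chord starting at grid point j + 3 ends at j + 4, whence j + 4 ≤ B; therefore the last cell
  -- is out of reach here.
  obtain ⟨j, hj1, hj2, hj⟩ := exists_window (by omega) hh hs.1 hs.2
  have hsub : ∀ t ∈ Set.Icc ((j : ℝ) * h) (j * h + 3 * h), t ∈ Set.Icc (A * h) ((B - 1) * h) := by
    intro t ht
    have h1 : (A : ℝ) ≤ j := by exact_mod_cast hj1
    have h2 : (j : ℝ) + 4 ≤ B := by exact_mod_cast hj2
    exact ⟨by nlinarith [ht.1], by nlinarith [ht.2]⟩
  have hM0 : 0 ≤ M := (norm_nonneg _).trans (hDM s hs 0 (by norm_num))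
  obtain ⟨b0, b1, b2, b3⟩ := small_of_four_unit hDd hh (fun t ht => hDM t (hsub t ht))
    (hzero j hj1 (by omega))
    (by have := hzero (j + 1) (by omega) (by omega); push_cast at this; rw [← this]; ring_nf)
    (by have := hzero (j + 2) (by omega) (by omega); push_cast at this; rw [← this]; ring_nf)
    (by have := hzero (j + 3) (by omega) (by omega); push_cast at this; rw [← this]; ring_nf)
    s hj
  have hN := hDM s hs
  have hdM : ∀ k, 1 ≤ k → k ≤ 6 → ‖d k s‖ ≤ M := fun k k1 k6 => by
    simpa using hseg s hs k k1 k6 0 le_rfl zero_le_one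
  have T1 : ∀ k ≤ 4, ‖D k s - d (k + 1) s‖ ≤ M * h := fun k hk => by
    have e : D k s - d (k + 1) s = h • segAvg 1 (d (k + 2)) (s, h) := by
      rw [hDs, segAvg_eq (hd (k + 1)) (hc (k + 2))]; norm_num
    rw [e, norm_smul, Real.norm_eq_abs, abs_of_pos hh, mul_comm]
    gcongr
    exact norm_segAvg_le (hseg s hs _ (by omega) (by omega)) 1
  have T2 : ∀ k ≤ 3, ‖D k s - (d (k + 1) s + (h / 2) • d (k + 2) s)‖ ≤ M * h ^ 2 := fun k hk => by
    have e : D k s - (d (k + 1) s + (h / 2) • d (k + 2) s)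
        = (h ^ 2 / 2) • segAvg 2 (d (k + 3)) (s, h) := by
      rw [hDs, segAvg_eq (hd (k + 1)) (hc (k + 2)), segAvg_eq (hd (k + 2)) (hc (k + 3))]
      norm_num
      module
    have h1 := norm_segAvg_le (hseg s hs (k + 3) (by omega) (by omega)) 2
    rw [e, norm_smul, Real.norm_eq_abs, abs_of_pos (by positivity)]
    nlinarith [sq_nonneg h, mul_nonneg hM0 (sq_nonneg h)]
  have T3 : ‖D 0 s - (d 1 s + (h / 2) • d 2 s + (h ^ 2 / 6) • d 3 s)‖ ≤ M * h ^ 3 := by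
    have e : D 0 s - (d 1 s + (h / 2) • d 2 s + (h ^ 2 / 6) • d 3 s)
        = (h ^ 3 / 6) • segAvg 3 (d 4) (s, h) := by
      rw [hDs, segAvg_eq (hd 1) (hc 2), segAvg_eq (hd 2) (hc 3), segAvg_eq (hd 3) (hc 4)]
      norm_num
      module
    have h1 := norm_segAvg_le (hseg s hs 4 (by omega) (by omega)) 3
    rw [e, norm_smul, Real.norm_eq_abs, abs_of_pos (by positivity)]
    nlinarith [pow_pos hh 3, mul_nonneg hM0 (pow_pos hh 3).le]
  have hN2 : ∀ k, 1 ≤ k → k ≤ 4 → ‖d k s + (h / 2) • d (k + 1) s‖ ≤ 2 * M := fun k k1 k4 => by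
    refine (norm_add_le _ _).trans ?_
    rw [norm_smul, Real.norm_eq_abs, abs_of_pos (by positivity)]
    have := hdM k k1 (by omega)
    have := hdM (k + 1) (by omega) (by omega)
    nlinarith [norm_nonneg (d (k + 1) s)]
  have hN3 : ‖d 1 s + (h / 2) • d 2 s + (h ^ 2 / 6) • d 3 s‖ ≤ 3 * M := by
    refine (norm_add_le _ _).trans ?_
    rw [norm_smul, Real.norm_eq_abs, abs_of_pos (by positivity)]
    have := hN2 1 le_rfl (by norm_num)
    have := hdM 3 (by norm_num) (by norm_num)
    nlinarith [norm_nonneg (d 3 s), pow_le_one₀ hh.le hh1 (n := 2)]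
  have hhM : 0 ≤ M ^ 2 * h := by positivity
  have hhM2 : 0 ≤ M ^ 2 * h ^ 2 := by positivity
  have hhM3 : 0 ≤ M ^ 2 * h ^ 3 := by positivity
  have h32 : M ^ 2 * h ^ 3 ≤ M ^ 2 * h ^ 2 := by
    have : h ^ 3 ≤ h ^ 2 := by nlinarith [sq_nonneg h]
    gcongr
  have h43 : M ^ 2 * h ^ 4 ≤ M ^ 2 * h ^ 3 := by
    have : h ^ 4 ≤ h ^ 3 := by nlinarith [pow_pos hh 3]
    gcongr
  have n22 := abs_le.mp (abs_inner_le (hdM 2 (by norm_num) (by norm_num))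
    (hdM 2 (by norm_num) (by norm_num)))
  have n23 := abs_le.mp (abs_inner_le (hdM 2 (by norm_num) (by norm_num))
    (hdM 3 (by norm_num) (by norm_num)))
  have n24 := abs_le.mp (abs_inner_le (hdM 2 (by norm_num) (by norm_num))
    (hdM 4 (by norm_num) (by norm_num)))
  have n33 := abs_le.mp (abs_inner_le (hdM 3 (by norm_num) (by norm_num))
    (hdM 3 (by norm_num) (by norm_num)))
  -- The estimates descend from the highest derivative: passing from difference quotients back to
  -- derivatives at s produces lower-order terms that the preceding estimate controls.
  have E1 : |3 * inner ℝ (d 2 s) (d 3 s) + inner ℝ (d 1 s) (d 4 s)| ≤ 656 * M ^ 2 * h := by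
    have i1 := abs_le.mp (abs_inner_sub_inner_le (T1 1 (by norm_num)) (T1 2 (by norm_num))
      (hdM 2 (by norm_num) (by norm_num)) (hN 2 (by norm_num)))
    have i2 := abs_le.mp (abs_inner_sub_inner_le (T1 0 (by norm_num)) (T1 3 (by norm_num))
      (hdM 1 (by norm_num) (by norm_num)) (hN 3 (by norm_num)))
    have i3 := abs_le.mp b3
    norm_num at i1 i2
    exact abs_le.mpr ⟨by linarith [i1.1, i2.1, i3.1, i1.2, i2.2, i3.2],
      by linarith [i1.1, i2.1, i3.1, i1.2, i2.2, i3.2]⟩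
  -- The error of order h made by the difference quotients is a multiple of h times the expression
  -- in `E1`, hence O(h²).
  have E2 : |inner ℝ (d 2 s) (d 2 s) + inner ℝ (d 1 s) (d 3 s)| ≤ 1000 * M ^ 2 * h ^ 2 := by
    have i1 := abs_le.mp (abs_inner_sub_inner_le (T2 1 (by norm_num)) (T2 1 (by norm_num))
      (hN2 2 (by norm_num) (by norm_num)) (hN 1 (by norm_num)))
    have i2 := abs_le.mp (abs_inner_sub_inner_le (T2 0 (by norm_num)) (T2 2 (by norm_num))
      (hN2 1 (by norm_num) (by norm_num)) (hN 2 (by norm_num)))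
    have i3 := abs_le.mp b2
    simp only [inner_add_left, inner_add_right, real_inner_smul_left, real_inner_smul_right,
      Nat.reduceAdd, real_inner_comm (d 2 s) (d 3 s)] at i1 i2
    have i4 := abs_le.mp E1
    have i5 := mul_le_mul_of_nonneg_left i4.1 hh.le
    have i6 := mul_le_mul_of_nonneg_left i4.2 hh.le
    have j1 := mul_le_mul_of_nonneg_left n33.1 (sq_nonneg h)
    have j2 := mul_le_mul_of_nonneg_left n33.2 (sq_nonneg h)
    have j3 := mul_le_mul_of_nonneg_left n24.1 (sq_nonneg h)
    have j4 := mul_le_mul_of_nonneg_left n24.2 (sq_nonneg h)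
    exact abs_le.mpr ⟨by linarith [i1.1, i2.1, i3.1, i1.2, i2.2, i3.2],
      by linarith [i1.1, i2.1, i3.1, i1.2, i2.2, i3.2]⟩
  have E3 : |(inner ℝ (d 1 s) (d 2 s) : ℝ)| ≤ 1200 * M ^ 2 * h ^ 2 := by
    have i2 := abs_le.mp (abs_inner_sub_inner_le (T2 0 (by norm_num)) (T2 1 (by norm_num))
      (hN2 1 (by norm_num) (by norm_num)) (hN 1 (by norm_num)))
    have i3 := abs_le.mp b1
    simp only [inner_add_left, inner_add_right, real_inner_smul_left, real_inner_smul_right,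
      Nat.reduceAdd] at i2
    have i4 := abs_le.mp E2
    have i5 := mul_le_mul_of_nonneg_left i4.1 hh.le
    have i6 := mul_le_mul_of_nonneg_left i4.2 hh.le
    have j1 := mul_le_mul_of_nonneg_left n23.1 (sq_nonneg h)
    have j2 := mul_le_mul_of_nonneg_left n23.2 (sq_nonneg h)
    exact abs_le.mpr ⟨by linarith [i2.1, i3.1, i2.2, i3.2], by linarith [i2.1, i3.1, i2.2, i3.2]⟩
  refine ⟨E1, E2, E3, ?_⟩
  -- At order h² the squared difference quotient contains ‖r''‖²/4 + r'·r'''/3, and `E2` turns this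
  -- into -‖r''‖²/12: the source of the constant 1/12.
  have i2 := abs_le.mp (abs_inner_sub_inner_le T3 T3 hN3 (hN 0 (by norm_num)))
  have i3 := abs_le.mp b0
  simp only [inner_add_left, inner_add_right, real_inner_smul_left, real_inner_smul_right,
    real_inner_comm (d 1 s) (d 2 s), real_inner_comm (d 1 s) (d 3 s),
    real_inner_comm (d 2 s) (d 3 s)] at i2
  have i4 := abs_le.mp E2
  have i5 := mul_le_mul_of_nonneg_left i4.1 (sq_nonneg h)
  have i6 := mul_le_mul_of_nonneg_left i4.2 (sq_nonneg h)
  have i7 := abs_le.mp E3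
  have i8 := mul_le_mul_of_nonneg_left i7.1 hh.le
  have i9 := mul_le_mul_of_nonneg_left i7.2 hh.le
  have j1 := mul_le_mul_of_nonneg_left n23.1 (pow_pos hh 3).le
  have j2 := mul_le_mul_of_nonneg_left n23.2 (pow_pos hh 3).le
  have j3 := mul_le_mul_of_nonneg_left n33.1 (pow_pos hh 4).le
  have j4 := mul_le_mul_of_nonneg_left n33.2 (pow_pos hh 4).le
  exact abs_le.mpr ⟨by linarith [i2.1, i3.1, i2.2, i3.2], by linarith [i2.1, i3.1, i2.2, i3.2]⟩

/-- Equally spaced points on a smooth curve force almost unit speed. -/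
theorem speed_estimates (hd : ∀ k s, HasDerivAt (d k) (d (k + 1) s) s) {A B : ℤ}
    (hAB : A + 5 ≤ B) (hh : 0 < h) (hh1 : h ≤ 1)
    (hM : ∀ k, 1 ≤ k → k ≤ 6 → ∀ s ∈ Set.Icc (A * h) (B * h), ‖d k s‖ ≤ M)
    (hsp : ∀ j : ℤ, A ≤ j → j < B → ‖d 0 ((j + 1) * h) - d 0 (j * h)‖ = h)
    {s : ℝ} (hs : s ∈ Set.Icc (A * h) (B * h)) :
    |inner ℝ (d 2 s) (d 2 s) + inner ℝ (d 1 s) (d 3 s)| ≤ 10000 * M ^ 2 * h ^ 2 ∧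
    |(inner ℝ (d 1 s) (d 2 s) : ℝ)| ≤ 10000 * M ^ 2 * h ^ 2 ∧
    |inner ℝ (d 1 s) (d 1 s) - 1 - h ^ 2 / 12 * inner ℝ (d 2 s) (d 2 s)|
      ≤ 10000 * M ^ 2 * h ^ 3 := by
  have h0 : 0 ≤ M ^ 2 * h ^ 2 := by positivity
  have h1 : 0 ≤ M ^ 2 * h ^ 3 := by positivity
  rcases le_total s ((B - 1) * h) with hsB | hsB
  · obtain ⟨-, e2, e3, e4⟩ := speed_estimates_interior hd hAB hh hh1 hM hsp ⟨hs.1, hsB⟩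
    exact ⟨e2.trans (by linarith), e3.trans (by linarith), e4.trans (by linarith)⟩
  have hAB' : (A : ℝ) + 5 ≤ B := by exact_mod_cast hAB
  have hm0 : ((B : ℝ) - 1) * h ∈ Set.Icc (((B : ℝ) - 1) * h) (B * h) :=
    ⟨le_rfl, by nlinarith⟩
  have hsub : ∀ t ∈ Set.Icc (((B : ℝ) - 1) * h) (B * h), t ∈ Set.Icc (A * h) (B * h) :=
    fun t ht => ⟨by nlinarith [ht.1], ht.2⟩
  -- On the last cell each quantity is continued from its left end by the mean value theorem; the
  -- derivative of each is controlled by the preceding one.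
  obtain ⟨e1, e2, e3, e4⟩ := speed_estimates_interior hd hAB hh hh1 hM hsp
    (s := ((B : ℝ) - 1) * h) ⟨by nlinarith, le_rfl⟩
  have len : (B : ℝ) * h - (B - 1) * h = h := by ring
  have f1 : ∀ t ∈ Set.Icc (((B : ℝ) - 1) * h) (B * h),
      |3 * inner ℝ (d 2 t) (d 3 t) + inner ℝ (d 1 t) (d 4 t)| ≤ 700 * M ^ 2 * h := fun t ht => by
    refine (abs_le_of_abs_deriv_le (f := fun t => 3 * inner ℝ (d 2 t) (d 3 t)
      + inner ℝ (d 1 t) (d 4 t)) (f' := fun t => 3 * inner ℝ (d 3 t) (d 3 t)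
      + 4 * inner ℝ (d 2 t) (d 4 t) + inner ℝ (d 1 t) (d 5 t)) (K := 8 * M ^ 2)
      (fun t => ?_) (fun t ht => ?_) hm0 ht).trans ?_
    · refine ((((hd 2 t).inner ℝ (hd 3 t)).const_mul 3).fun_add ((hd 1 t).inner ℝ (hd 4 t))).congr_deriv
        ?_
      ring
    · have hd' := fun k k1 k6 => hM k k1 k6 t (hsub t ht)
      have i1 := abs_le.mp (abs_inner_le (hd' 3 (by norm_num) (by norm_num))
        (hd' 3 (by norm_num) (by norm_num)))
      have i2 := abs_le.mp (abs_inner_le (hd' 2 (by norm_num) (by norm_num))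
        (hd' 4 (by norm_num) (by norm_num)))
      have i3 := abs_le.mp (abs_inner_le (hd' 1 (by norm_num) (by norm_num))
        (hd' 5 (by norm_num) (by norm_num)))
      exact abs_le.mpr ⟨by linarith [i1.1, i2.1, i3.1], by linarith [i1.2, i2.2, i3.2]⟩
    · rw [len]
      have : 0 ≤ M ^ 2 * h := by positivity
      linarith
  have f2 : ∀ t ∈ Set.Icc (((B : ℝ) - 1) * h) (B * h),
      |inner ℝ (d 2 t) (d 2 t) + inner ℝ (d 1 t) (d 3 t)| ≤ 1700 * M ^ 2 * h ^ 2 := fun t ht => by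
    refine (abs_le_of_abs_deriv_le (f := fun t => inner ℝ (d 2 t) (d 2 t)
      + inner ℝ (d 1 t) (d 3 t)) (f' := fun t => 3 * inner ℝ (d 2 t) (d 3 t)
      + inner ℝ (d 1 t) (d 4 t)) (fun t => ?_) f1 hm0 ht).trans ?_
    · refine (((hd 2 t).inner ℝ (hd 2 t)).fun_add ((hd 1 t).inner ℝ (hd 3 t))).congr_deriv ?_
      rw [real_inner_comm (d 2 t) (d 3 t)]; ring
    · rw [len]; linarith
  have f3 : ∀ t ∈ Set.Icc (((B : ℝ) - 1) * h) (B * h),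
      |(inner ℝ (d 1 t) (d 2 t) : ℝ)| ≤ 2900 * M ^ 2 * h ^ 2 := fun t ht => by
    refine (abs_le_of_abs_deriv_le (f := fun t => inner ℝ (d 1 t) (d 2 t))
      (f' := fun t => inner ℝ (d 2 t) (d 2 t)
      + inner ℝ (d 1 t) (d 3 t)) (fun t => ?_) f2 hm0 ht).trans ?_
    · refine ((hd 1 t).inner ℝ (hd 2 t)).congr_deriv ?_
      ring
    · have h32 : M ^ 2 * h ^ 3 ≤ M ^ 2 * h ^ 2 := by
        have : h ^ 3 ≤ h ^ 2 := by nlinarith [sq_nonneg h]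
        gcongr
      rw [len]; linarith
  have f4 : |inner ℝ (d 1 s) (d 1 s) - 1 - h ^ 2 / 12 * inner ℝ (d 2 s) (d 2 s)|
      ≤ 10000 * M ^ 2 * h ^ 3 := by
    refine (abs_le_of_abs_deriv_le (f := fun t => inner ℝ (d 1 t) (d 1 t) - 1
      - h ^ 2 / 12 * inner ℝ (d 2 t) (d 2 t)) (f' := fun t => 2 * inner ℝ (d 1 t) (d 2 t)
      - h ^ 2 / 6 * inner ℝ (d 2 t) (d 3 t)) (K := 6000 * M ^ 2 * h ^ 2)
      (fun t => ?_) (fun t ht => ?_) hm0 ⟨hsB, hs.2⟩).trans ?_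
    · refine ((((hd 1 t).inner ℝ (hd 1 t)).sub_const 1).fun_sub
        (((hd 2 t).inner ℝ (hd 2 t)).const_mul (h ^ 2 / 12))).congr_deriv ?_
      rw [real_inner_comm (d 2 t) (d 3 t), real_inner_comm (d 1 t) (d 2 t)]; ring
    · have hd' := fun k k1 k6 => hM k k1 k6 t (hsub t ht)
      have i1 := abs_le.mp (abs_inner_le (hd' 2 (by norm_num) (by norm_num))
        (hd' 3 (by norm_num) (by norm_num)))
      have i2 := abs_le.mp (f3 t ht)
      have i3 := mul_le_mul_of_nonneg_left i1.1 (sq_nonneg h)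
      have i4 := mul_le_mul_of_nonneg_left i1.2 (sq_nonneg h)
      exact abs_le.mpr ⟨by linarith [i2.1], by linarith [i2.2]⟩
    · rw [len]; linarith
  exact ⟨(f2 s ⟨hsB, hs.2⟩).trans (by linarith), (f3 s ⟨hsB, hs.2⟩).trans (by linarith), f4⟩

end Spacing

/-! ### Lattice sums, ζ(3) and one-sided finite parts. -/

section LatticeSums

theorem hasSum_zetaThree : HasSum (fun k : ℕ => 1 / ((k : ℝ) + 1) ^ 3) zetaThree := by
  have h1 : Summable (fun k : ℕ => 1 / (k : ℝ) ^ 3) :=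
    Real.summable_one_div_nat_pow.mpr (by norm_num)
  have h2 : zetaThree = ∑' k : ℕ, 1 / (k : ℝ) ^ 3 := by
    have := zeta_nat_eq_tsum_of_gt_one (k := 3) (by norm_num)
    rw [zetaThree]
    push_cast at this
    rw [this, ← Complex.ofReal_re (∑' k : ℕ, 1 / (k : ℝ) ^ 3), Complex.ofReal_tsum]
    push_cast
    rfl
  -- The term k = 0 is 1/0 = 0, so shifting the index loses nothing.
  have h3 := (hasSum_nat_add_iff' (f := fun k : ℕ => 1 / (k : ℝ) ^ 3) 1).mpr h1.hasSum
  rw [h2]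
  simpa using h3

/-- A squeeze: with q = n + 1, the partial sum plus 1/(2q²) decreases to ζ(3), and it increases to
ζ(3) once 1/q³ is subtracted. -/
theorem abs_sum_inv_cube_sub_zeta_le {q : ℕ} (hq : 1 ≤ q) :
    |∑ k ∈ Finset.range q, 1 / ((k : ℝ) + 1) ^ 3 - (zetaThree - 1 / (2 * (q : ℝ) ^ 2))|
      ≤ 1 / (q : ℝ) ^ 3 := by
  set S : ℕ → ℝ := fun q => ∑ k ∈ Finset.range q, 1 / ((k : ℝ) + 1) ^ 3 with hS
  have hlim : Tendsto S atTop (𝓝 zetaThree) := hasSum_zetaThree.tendsto_sum_nat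
  have hinv : Tendsto (fun n : ℕ => 1 / ((n : ℝ) + 1)) atTop (𝓝 0) :=
    tendsto_one_div_add_atTop_nhds_zero_nat
  have hlim1 : Tendsto (fun n : ℕ => S (n + 1)) atTop (𝓝 zetaThree) :=
    hlim.comp (tendsto_add_atTop_nat 1)
  set u : ℕ → ℝ := fun n => S (n + 1) + 1 / 2 * (1 / ((n : ℝ) + 1)) ^ 2 with hu
  set v : ℕ → ℝ := fun n => u n - (1 / ((n : ℝ) + 1)) ^ 3 with hv
  have lu : Tendsto u atTop (𝓝 zetaThree) := by
    simpa only [ne_eq, OfNat.ofNat_ne_zero, not_false_eq_true, zero_pow, mul_zero, add_zero] using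
      hlim1.add ((hinv.pow 2).const_mul (1 / 2))
  have lv : Tendsto v atTop (𝓝 zetaThree) := by
    simpa only [ne_eq, OfNat.ofNat_ne_zero, not_false_eq_true, zero_pow, sub_zero] using
      lu.sub (hinv.pow 3)
  have hstep : ∀ n : ℕ, S (n + 1 + 1) = S (n + 1) + 1 / ((n : ℝ) + 2) ^ 3 := fun n => by
    simp only [hS]
    rw [Finset.sum_range_succ]
    push_cast
    ring
  have au : Antitone u := antitone_nat_of_succ_le fun n => by
    simp only [hu]
    rw [hstep]
    push_cast
    have h1 : (0 : ℝ) < n + 1 := by positivity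
    have h2 : (0 : ℝ) < n + 2 := by positivity
    rw [show (n : ℝ) + 1 + 1 = n + 2 by ring]
    have : 1 / ((n : ℝ) + 2) ^ 3 + 1 / 2 * (1 / ((n : ℝ) + 2)) ^ 2
        - 1 / 2 * (1 / ((n : ℝ) + 1)) ^ 2
        = -(3 * n + 4) / (2 * (n + 1) ^ 2 * (n + 2) ^ 3) := by
      field_simp
      ring
    have h3 : -(3 * (n : ℝ) + 4) / (2 * (n + 1) ^ 2 * (n + 2) ^ 3) ≤ 0 :=
      div_nonpos_of_nonpos_of_nonneg (by linarith) (by positivity)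
    linarith
  have mv : Monotone v := monotone_nat_of_le_succ fun n => by
    simp only [hv, hu]
    rw [hstep]
    push_cast
    have h0 : (0 : ℝ) ≤ n := by positivity
    have h1 : (0 : ℝ) < n + 1 := by positivity
    have h2 : (0 : ℝ) < n + 2 := by positivity
    rw [show (n : ℝ) + 1 + 1 = n + 2 by ring]
    have : 1 / ((n : ℝ) + 2) ^ 3 + 1 / 2 * (1 / ((n : ℝ) + 2)) ^ 2 - (1 / ((n : ℝ) + 2)) ^ 3
        - (1 / 2 * (1 / ((n : ℝ) + 1)) ^ 2 - (1 / ((n : ℝ) + 1)) ^ 3)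
        = (3 * n ^ 2 + 11 * n + 10) / (2 * (n + 1) ^ 3 * (n + 2) ^ 3) := by
      field_simp
      ring
    have h3 : 0 ≤ (3 * (n : ℝ) ^ 2 + 11 * n + 10) / (2 * (n + 1) ^ 3 * (n + 2) ^ 3) := by
      positivity
    linarith
  obtain ⟨n, rfl⟩ : ∃ n, q = n + 1 := ⟨q - 1, by omega⟩
  have b1 := au.le_of_tendsto lu n
  have b2 := mv.ge_of_tendsto lv n
  simp only [hv, hu] at b1 b2
  have e1 : 1 / (2 * ((n + 1 : ℕ) : ℝ) ^ 2) = 1 / 2 * (1 / ((n : ℝ) + 1)) ^ 2 := by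
    push_cast; field_simp
  have e2 : 1 / ((n + 1 : ℕ) : ℝ) ^ 3 = (1 / ((n : ℝ) + 1)) ^ 3 := by
    push_cast; field_simp
  rw [e1, e2]
  exact abs_le.mpr ⟨by
    have : 0 ≤ (1 / ((n : ℝ) + 1)) ^ 3 := by positivity
    linarith, by linarith⟩

theorem sum_inv_sq_le (q : ℕ) : ∑ k ∈ Finset.range q, 1 / ((k : ℝ) + 1) ^ 2 ≤ 2 := by
  have key : ∀ n : ℕ, ∑ k ∈ Finset.range (n + 1), 1 / ((k : ℝ) + 1) ^ 2 ≤ 2 - 1 / ((n : ℝ) + 1) := by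
    intro n
    induction n with
    | zero => norm_num
    | succ n ih =>
      rw [Finset.sum_range_succ]
      push_cast
      have h2 : 1 / ((n : ℝ) + 1) - 1 / ((n : ℝ) + 1 + 1) - 1 / ((n : ℝ) + 1 + 1) ^ 2
          = 1 / ((n + 1) * (n + 1 + 1) ^ 2) := by
        field_simp
        ring
      have h3 : 0 ≤ 1 / (((n : ℝ) + 1) * (n + 1 + 1) ^ 2) := by positivity
      linarith
  calc ∑ k ∈ Finset.range q, 1 / ((k : ℝ) + 1) ^ 2
      ≤ ∑ k ∈ Finset.range (q + 1), 1 / ((k : ℝ) + 1) ^ 2 := by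
        rw [Finset.sum_range_succ]; exact le_add_of_nonneg_right (by positivity)
    _ ≤ 2 := (key q).trans (sub_le_self _ (by positivity))

/-- The logarithmic bound is not needed where this is used: the sum is multiplied by h² g₂ = O(h⁴),
and q ≤ 1/h. -/
theorem sum_inv_le (q : ℕ) : ∑ k ∈ Finset.range q, 1 / ((k : ℝ) + 1) ≤ q := by
  calc ∑ k ∈ Finset.range q, 1 / ((k : ℝ) + 1) ≤ ∑ k ∈ Finset.range q, (1 : ℝ) :=
        Finset.sum_le_sum fun k _ => by
          rw [div_le_one (by positivity)]
          linarith [(Nat.cast_nonneg k : (0 : ℝ) ≤ k)]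
    _ = q := by simp

/-- Right-endpoint Riemann sums of a Lipschitz function. -/
theorem abs_riemannSum_sub_integral_le {f : ℝ → ℝ} {a h : ℝ} (hh : 0 < h) (q : ℕ)
    (hc : ∀ k < q, ContinuousOn f (Set.Icc (a + k * h) (a + (k + 1) * h)))
    {e : ℕ → ℝ} {t : ℕ → ℝ}
    (hf : ∀ k < q, ∀ x ∈ Set.Icc (a + k * h) (a + (k + 1) * h), |t k - f x| ≤ e k) :
    |h * ∑ k ∈ Finset.range q, t k - ∫ x in a..(a + q * h), f x|
      ≤ h * ∑ k ∈ Finset.range q, e k := by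
  have hle : ∀ k : ℕ, a + k * h ≤ a + (k + 1) * h := fun k => by nlinarith
  have hint : ∀ k < q, IntervalIntegrable f MeasureTheory.volume (a + (k : ℕ) * h)
      (a + ((k + 1 : ℕ) : ℝ) * h) := fun k hk => by
    push_cast
    exact (hc k hk).intervalIntegrable_of_Icc (hle k)
  have hs := intervalIntegral.sum_integral_adjacent_intervals
    (a := fun k : ℕ => a + (k : ℝ) * h) (n := q) (f := f) (μ := MeasureTheory.volume) hint
  simp only [Nat.cast_zero, zero_mul, add_zero] at hs
  rw [← hs, Finset.mul_sum, ← Finset.sum_sub_distrib, Finset.mul_sum]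
  refine (Finset.abs_sum_le_sum_abs _ _).trans (Finset.sum_le_sum fun k hk => ?_)
  have hk' := Finset.mem_range.mp hk
  push_cast
  have e1 : h * t k = ∫ x in (a + k * h)..(a + (k + 1) * h), t k := by
    rw [intervalIntegral.integral_const, smul_eq_mul]; ring
  have hi := hint k hk'
  push_cast at hi
  rw [e1, ← intervalIntegral.integral_sub (by simp) hi]
  have := intervalIntegral.norm_integral_le_of_norm_le_const (a := a + k * h)
    (b := a + (k + 1) * h) (C := e k) (f := fun x => t k - f x) fun x hx => by
      rw [Set.uIoc_of_le (hle k)] at hx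
      exact hf k hk' x ⟨hx.1.le, hx.2⟩
  refine this.trans (le_of_eq ?_)
  rw [show a + (k + 1) * h - (a + k * h) = h by ring, abs_of_pos hh, mul_comm]

/-- Finite part of `∫ x in 0..Y, (g₀ / x ^ 3 + g₁ / x ^ 2 + g₂ / x + H x)`. -/
noncomputable def halfFinitePart (g₀ g₁ g₂ : ℝ) (H : ℝ → ℝ) (Y : ℝ) : ℝ :=
  -(g₀ / (2 * Y ^ 2)) - g₁ / Y + g₂ * Real.log Y + ∫ x in (0 : ℝ)..Y, H x

theorem abs_log_le_inv {Y : ℝ} (h0 : 0 < Y) (h1 : Y ≤ 1) : |Real.log Y| ≤ 1 / Y := by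
  rw [abs_of_nonpos (Real.log_nonpos h0.le h1), ← Real.log_inv, one_div]
  exact (Real.log_le_sub_one_of_pos (inv_pos.mpr h0)).trans (by linarith)

/-- One-sided lattice sum of an expansion and the finite part of its integral. -/
theorem abs_latticeSum_sub_le {C h g₀ g₁ g₂ : ℝ} {H : ℝ → ℝ} {q : ℕ} (hq : 1 ≤ q) (hh : 0 < h)
    (hqh : q * h ≤ 1) (b0 : |g₀| ≤ C) (b1 : |g₁| ≤ C * h ^ 2) (b2 : |g₂| ≤ C * h ^ 2)
    (hl : ∀ x ∈ Set.Icc 0 (q * h), ∀ y ∈ Set.Icc 0 (q * h), |H x - H y| ≤ C * |x - y|) :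
    |∑ k ∈ Finset.range q, (g₀ + ((k + 1) * h) * g₁ + ((k + 1) * h) ^ 2 * g₂
        + ((k + 1) * h) ^ 3 * H ((k + 1) * h)) / ((k : ℝ) + 1) ^ 3
      - (g₀ * zetaThree + h ^ 2 * halfFinitePart g₀ g₁ g₂ H (q * h))|
      ≤ C * (6 * h ^ 3 + 1 / (q : ℝ) ^ 3) := by
  have hq0 : (0 : ℝ) < q := by exact_mod_cast hq
  have hC : 0 ≤ C := (abs_nonneg _).trans b0
  have hcont : ContinuousOn H (Set.Icc 0 (q * h)) := by
    have : LipschitzOnWith (Real.toNNReal C) H (Set.Icc 0 (q * h)) :=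
      LipschitzOnWith.of_dist_le_mul fun x hx y hy => by
        rw [Real.dist_eq, Real.dist_eq, Real.coe_toNNReal _ hC]; exact hl x hx y hy
    exact this.continuousOn
  have hsub : ∀ k < q, ∀ x ∈ Set.Icc (0 + (k : ℝ) * h) (0 + (k + 1) * h),
      x ∈ Set.Icc 0 (q * h) := fun k hk x hx => by
    have : (k : ℝ) + 1 ≤ q := by exact_mod_cast hk
    have h0 : (0 : ℝ) ≤ k := by positivity
    exact ⟨by nlinarith [hx.1], by nlinarith [hx.2]⟩
  have R := abs_riemannSum_sub_integral_le (f := H) (a := 0) hh q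
    (fun k hk => hcont.mono fun x hx => hsub k hk x hx)
    (t := fun k => H ((k + 1) * h)) (e := fun _ => C * h) fun k hk x hx => by
      refine (hl _ (hsub k hk _ ⟨by nlinarith, by rw [zero_add]⟩) x (hsub k hk x hx)).trans ?_
      refine mul_le_mul_of_nonneg_left (abs_le.mpr ⟨by linarith [hx.2], ?_⟩) hC
      have := hx.1
      linarith
  rw [Finset.sum_const, Finset.card_range, zero_add, nsmul_eq_mul] at R
  have A := abs_sum_inv_cube_sub_zeta_le hq
  have S2 := sum_inv_sq_le q
  have S1 := sum_inv_le q
  have L := abs_log_le_inv (mul_pos hq0 hh) hqh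
  set s3 := ∑ k ∈ Finset.range q, 1 / ((k : ℝ) + 1) ^ 3 with hs3
  set s2 := ∑ k ∈ Finset.range q, 1 / ((k : ℝ) + 1) ^ 2 with hs2
  set s1 := ∑ k ∈ Finset.range q, 1 / ((k : ℝ) + 1) with hs1
  set sH := ∑ k ∈ Finset.range q, H (((k : ℝ) + 1) * h) with hsH
  have e : ∑ k ∈ Finset.range q, (g₀ + ((k + 1) * h) * g₁ + ((k + 1) * h) ^ 2 * g₂
        + ((k + 1) * h) ^ 3 * H ((k + 1) * h)) / ((k : ℝ) + 1) ^ 3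
      = g₀ * s3 + h * g₁ * s2 + h ^ 2 * g₂ * s1 + h ^ 3 * sH := by
    simp only [hs3, hs2, hs1, hsH, Finset.mul_sum, ← Finset.sum_add_distrib]
    refine Finset.sum_congr rfl fun k _ => ?_
    have : (k : ℝ) + 1 ≠ 0 := by positivity
    field_simp
  have hs2' : 0 ≤ s2 := Finset.sum_nonneg fun k _ => by positivity
  have hs1' : 0 ≤ s1 := Finset.sum_nonneg fun k _ => by positivity
  rw [e, halfFinitePart]
  -- For Y = qh the boundary term -g₀/(2Y²), multiplied by h², is -g₀/(2q²): the tail of the sum for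
  -- ζ(3).
  have e2 : g₀ * s3 + h * g₁ * s2 + h ^ 2 * g₂ * s1 + h ^ 3 * sH
      - (g₀ * zetaThree + h ^ 2 * (-(g₀ / (2 * (q * h) ^ 2)) - g₁ / (q * h)
        + g₂ * Real.log (q * h) + ∫ x in (0 : ℝ)..(q * h), H x))
      = g₀ * (s3 - (zetaThree - 1 / (2 * (q : ℝ) ^ 2))) + h * g₁ * (s2 + 1 / q)
        + h ^ 2 * g₂ * (s1 - Real.log (q * h))
        + h ^ 2 * (h * sH - ∫ x in (0 : ℝ)..(q * h), H x) := by
    field_simp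
    ring
  rw [e2]
  have t1 : |g₀ * (s3 - (zetaThree - 1 / (2 * (q : ℝ) ^ 2)))| ≤ C * (1 / (q : ℝ) ^ 3) := by
    rw [abs_mul]; gcongr
  have hqi : 1 / (q : ℝ) ≤ 1 := by
    rw [div_le_one hq0]; exact_mod_cast hq
  have t2 : |h * g₁ * (s2 + 1 / q)| ≤ h * (C * h ^ 2) * (2 + 1) := by
    rw [abs_mul, abs_mul, abs_of_pos hh, abs_of_nonneg (show 0 ≤ s2 + 1 / (q : ℝ) by positivity)]
    gcongr
  have hq1 : (q : ℝ) ≤ 1 / h := by rw [le_div_iff₀ hh]; exact hqh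
  have hq2 : 1 / (q * h) ≤ 1 / h := by
    apply one_div_le_one_div_of_le hh
    have : (1 : ℝ) ≤ q := by exact_mod_cast hq
    nlinarith
  have t3 : |h ^ 2 * g₂ * (s1 - Real.log (q * h))| ≤ h ^ 2 * (C * h ^ 2) * (1 / h + 1 / h) := by
    rw [abs_mul, abs_mul, abs_of_pos (show 0 < h ^ 2 by positivity)]
    gcongr
    refine (abs_sub _ _).trans (add_le_add ?_ (L.trans hq2))
    rw [abs_of_nonneg hs1']
    exact S1.trans hq1
  have t4 : |h ^ 2 * (h * sH - ∫ x in (0 : ℝ)..(q * h), H x)| ≤ h ^ 2 * (C * h) := by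
    rw [abs_mul, abs_of_pos (show 0 < h ^ 2 by positivity)]
    gcongr
    refine R.trans ?_
    nlinarith [mul_nonneg hC hh.le]
  have e3 : h ^ 2 * (C * h ^ 2) * (1 / h + 1 / h) = 2 * (C * h ^ 3) := by field_simp; ring
  rw [e3] at t3
  refine (abs_add_le _ _).trans ((add_le_add ((abs_add_le _ _).trans (add_le_add
    ((abs_add_le _ _).trans (add_le_add t1 t2)) t3)) t4).trans (le_of_eq ?_))
  ring

theorem abs_halfFinitePart_le {C g₀ g₁ g₂ Y : ℝ} {H : ℝ → ℝ} (hY : 0 < Y) (hY1 : Y ≤ 1)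
    (b0 : |g₀| ≤ C) (b1 : |g₁| ≤ C) (b2 : |g₂| ≤ C) (hH : ∀ x ∈ Set.Icc 0 Y, |H x| ≤ C) :
    |halfFinitePart g₀ g₁ g₂ H Y| ≤ 4 * C / Y ^ 2 := by
  have hC : 0 ≤ C := (abs_nonneg _).trans b0
  have hYY : 1 / Y ≤ 1 / Y ^ 2 := one_div_le_one_div_of_le (by positivity) (by nlinarith)
  have hY2 : 1 ≤ 1 / Y ^ 2 := by
    rw [le_div_iff₀ (by positivity)]; nlinarith
  have t1 : |g₀ / (2 * Y ^ 2)| ≤ C * (1 / Y ^ 2) := by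
    rw [abs_div, abs_of_pos (show 0 < 2 * Y ^ 2 by positivity), div_eq_mul_one_div]
    have : 1 / (2 * Y ^ 2) ≤ 1 / Y ^ 2 :=
      one_div_le_one_div_of_le (by positivity) (by nlinarith [sq_nonneg Y])
    gcongr
  have t2 : |g₁ / Y| ≤ C * (1 / Y ^ 2) := by
    rw [abs_div, abs_of_pos hY, div_eq_mul_one_div]
    gcongr
  have t3 : |g₂ * Real.log Y| ≤ C * (1 / Y ^ 2) := by
    rw [abs_mul]
    exact mul_le_mul b2 ((abs_log_le_inv hY hY1).trans hYY) (abs_nonneg _) hC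
  have t4 : |∫ x in (0 : ℝ)..Y, H x| ≤ C * (1 / Y ^ 2) := by
    have := intervalIntegral.norm_integral_le_of_norm_le_const (a := 0) (b := Y) (C := C)
      (f := H) fun x hx => by
        rw [Set.uIoc_of_le hY.le] at hx
        exact hH x ⟨hx.1.le, hx.2⟩
    rw [Real.norm_eq_abs, sub_zero, abs_of_pos hY] at this
    refine this.trans ?_
    gcongr
    exact hY1.trans hY2
  rw [halfFinitePart]
  have e : 4 * C / Y ^ 2 = C * (1 / Y ^ 2) + C * (1 / Y ^ 2) + C * (1 / Y ^ 2)
      + C * (1 / Y ^ 2) := by ring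
  rw [e]
  refine (abs_add_le _ _).trans (add_le_add ((abs_add_le _ _).trans (add_le_add
    ((abs_sub _ _).trans (add_le_add ?_ t2)) t3)) t4)
  rwa [abs_neg]

/-- The most singular dependence on the endpoint is g₀/Y², whose variation is of order δ/Y³; all
other contributions are smaller since Y ≤ 1. -/
theorem abs_halfFinitePart_sub_le_of_le {C δ g₀ g₁ g₂ g₀' g₁' g₂' Y Y' : ℝ} {H H' : ℝ → ℝ}
    (hY : 0 < Y) (hYY : Y ≤ Y') (hY1 : Y' ≤ 1) (hδ : Y' - Y ≤ δ)
    (b0 : |g₀| ≤ C) (b1 : |g₁| ≤ C) (b2 : |g₂| ≤ C)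
    (d0 : |g₀ - g₀'| ≤ C * δ) (d1 : |g₁ - g₁'| ≤ C * δ) (d2 : |g₂ - g₂'| ≤ C * δ)
    (hH' : ∀ x ∈ Set.Icc 0 Y', |H' x| ≤ C)
    (dH : ∀ x ∈ Set.Icc 0 Y, |H x - H' x| ≤ C * δ)
    (hc : ContinuousOn H (Set.Icc 0 Y)) (hc' : ContinuousOn H' (Set.Icc 0 Y')) :
    |halfFinitePart g₀ g₁ g₂ H Y - halfFinitePart g₀' g₁' g₂' H' Y'| ≤ 10 * C * δ / Y ^ 3 := by
  have hC : 0 ≤ C := (abs_nonneg _).trans b0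
  have hY' : 0 < Y' := hY.trans_le hYY
  have hYle1 : Y ≤ 1 := hYY.trans hY1
  have hδ0 : 0 ≤ δ := (sub_nonneg.mpr hYY).trans hδ
  have hCδ : 0 ≤ C * δ := mul_nonneg hC hδ0
  have hY31 : 1 ≤ 1 / Y ^ 3 := by
    rw [le_div_iff₀ (by positivity), one_mul]; exact pow_le_one₀ hY.le hYle1
  have hY3p : 0 < 1 / Y ^ 3 := by positivity
  have hY'1 : 1 / Y' ≤ 1 / Y ^ 3 := by
    apply one_div_le_one_div_of_le (by positivity)
    exact (pow_le_of_le_one hY.le hYle1 (by norm_num)).trans hYY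
  have hY'2 : 1 / (2 * Y' ^ 2) ≤ 1 / Y ^ 3 := by
    apply one_div_le_one_div_of_le (by positivity)
    have : Y ^ 3 ≤ Y ^ 2 := by nlinarith [sq_nonneg Y]
    nlinarith [pow_le_pow_left₀ hY.le hYY 2, sq_nonneg Y]
  have hI : IntervalIntegrable H MeasureTheory.volume 0 Y := hc.intervalIntegrable_of_Icc hY.le
  have hI1 : IntervalIntegrable H' MeasureTheory.volume 0 Y :=
    (hc'.mono (Set.Icc_subset_Icc_right hYY)).intervalIntegrable_of_Icc hY.le
  have hI2 : IntervalIntegrable H' MeasureTheory.volume Y Y' :=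
    (hc'.mono (Set.Icc_subset_Icc_left hY.le)).intervalIntegrable_of_Icc hYY
  have t1 : |g₀' / (2 * Y' ^ 2) - g₀ / (2 * Y ^ 2)| ≤ 2 * (C * δ * (1 / Y ^ 3)) := by
    have e : g₀' / (2 * Y' ^ 2) - g₀ / (2 * Y ^ 2)
        = -((g₀ - g₀') * (1 / (2 * Y' ^ 2))) - g₀ * ((Y' - Y) * ((Y' + Y) / (2 * Y ^ 2 * Y' ^ 2))) := by
      field_simp
      ring
    rw [e, two_mul (C * δ * _)]
    refine (abs_sub _ _).trans (add_le_add ?_ ?_)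
    · rw [abs_neg, abs_mul, abs_of_pos (show 0 < 1 / (2 * Y' ^ 2) by positivity)]
      gcongr
    · rw [abs_mul, mul_assoc C]
      refine mul_le_mul b0 ?_ (abs_nonneg _) hC
      rw [abs_of_nonneg (mul_nonneg (sub_nonneg.mpr hYY) (by positivity))]
      refine mul_le_mul hδ ?_ (by positivity) hδ0
      rw [div_le_div_iff₀ (by positivity) (by positivity)]
      have h1 : (Y' + Y) * Y ≤ 2 * Y' ^ 2 := by nlinarith
      nlinarith [mul_le_mul_of_nonneg_right h1 (sq_nonneg Y)]
  have t2 : |g₁' / Y' - g₁ / Y| ≤ 2 * (C * δ * (1 / Y ^ 3)) := by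
    have e : g₁' / Y' - g₁ / Y = -((g₁ - g₁') * (1 / Y')) - g₁ * ((Y' - Y) * (1 / (Y * Y'))) := by
      field_simp
      ring
    rw [e, two_mul]
    refine (abs_sub _ _).trans (add_le_add ?_ ?_)
    · rw [abs_neg, abs_mul, abs_of_pos (show 0 < 1 / Y' by positivity)]
      gcongr
    · rw [abs_mul, mul_assoc C]
      refine mul_le_mul b1 ?_ (abs_nonneg _) hC
      rw [abs_of_nonneg (mul_nonneg (sub_nonneg.mpr hYY) (by positivity))]
      refine mul_le_mul hδ ?_ (by positivity) hδ0
      apply one_div_le_one_div_of_le (by positivity)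
      have : Y ^ 3 ≤ Y ^ 2 := by nlinarith [sq_nonneg Y]
      nlinarith
  have t3 : |g₂ * Real.log Y - g₂' * Real.log Y'| ≤ 2 * (C * δ * (1 / Y ^ 3)) := by
    have e : g₂ * Real.log Y - g₂' * Real.log Y'
        = (g₂ - g₂') * Real.log Y' - g₂ * (Real.log Y' - Real.log Y) := by ring
    rw [e, two_mul]
    refine (abs_sub _ _).trans (add_le_add ?_ ?_)
    · rw [abs_mul]
      exact mul_le_mul d2 ((abs_log_le_inv hY' hY1).trans hY'1) (abs_nonneg _) hCδ
    · rw [abs_mul, mul_assoc C]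
      refine mul_le_mul b2 ?_ (abs_nonneg _) hC
      rw [abs_of_nonneg (sub_nonneg.mpr (Real.log_le_log hY hYY)), ← Real.log_div hY'.ne' hY.ne']
      refine (Real.log_le_sub_one_of_pos (div_pos hY' hY)).trans ?_
      have : Y' / Y - 1 = (Y' - Y) * (1 / Y) := by field_simp
      rw [this]
      refine mul_le_mul hδ ?_ (by positivity) hδ0
      exact one_div_le_one_div_of_le (by positivity) (pow_le_of_le_one hY.le hYle1 (by norm_num))
  have t4 : |(∫ x in (0 : ℝ)..Y, H x) - ∫ x in (0 : ℝ)..Y', H' x| ≤ 2 * (C * δ * (1 / Y ^ 3)) := by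
    rw [← intervalIntegral.integral_add_adjacent_intervals hI1 hI2, ← sub_sub,
      ← intervalIntegral.integral_sub hI hI1, two_mul]
    refine (abs_sub _ _).trans (add_le_add ?_ ?_)
    · have := intervalIntegral.norm_integral_le_of_norm_le_const (a := 0) (b := Y) (C := C * δ)
        (f := fun x => H x - H' x) fun x hx => by
          rw [Set.uIoc_of_le hY.le] at hx
          exact dH x ⟨hx.1.le, hx.2⟩
      rw [Real.norm_eq_abs, sub_zero, abs_of_pos hY] at this
      refine this.trans (mul_le_mul_of_nonneg_left (hYle1.trans hY31) hCδ)
    · have := intervalIntegral.norm_integral_le_of_norm_le_const (a := Y) (b := Y') (C := C)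
        (f := H') fun x hx => by
          rw [Set.uIoc_of_le hYY] at hx
          exact hH' x ⟨hY.le.trans hx.1.le, hx.2⟩
      rw [Real.norm_eq_abs, abs_of_nonneg (sub_nonneg.mpr hYY)] at this
      refine this.trans ((mul_le_mul_of_nonneg_left hδ hC).trans ?_)
      exact le_mul_of_one_le_right hCδ hY31
  have e : halfFinitePart g₀ g₁ g₂ H Y - halfFinitePart g₀' g₁' g₂' H' Y'
      = (g₀' / (2 * Y' ^ 2) - g₀ / (2 * Y ^ 2)) + (g₁' / Y' - g₁ / Y)
        + (g₂ * Real.log Y - g₂' * Real.log Y')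
        + ((∫ x in (0 : ℝ)..Y, H x) - ∫ x in (0 : ℝ)..Y', H' x) := by
    simp only [halfFinitePart]; ring
  have e' : 10 * C * δ / Y ^ 3 = 10 * (C * δ * (1 / Y ^ 3)) := by ring
  rw [e, e']
  have hpos : 0 ≤ C * δ * (1 / Y ^ 3) := by positivity
  refine (abs_add_le _ _).trans ((add_le_add ((abs_add_le _ _).trans (add_le_add
    ((abs_add_le _ _).trans (add_le_add t1 t2)) t3)) t4).trans (by linarith))

/-- Finite parts depend on the expansion and on the endpoint in a Lipschitz way. -/
theorem abs_halfFinitePart_sub_le {C δ g₀ g₁ g₂ g₀' g₁' g₂' Y Y' : ℝ} {H H' : ℝ → ℝ}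
    (hY : 0 < Y) (hY' : 0 < Y') (hY1 : Y ≤ 1) (hY1' : Y' ≤ 1) (hδ : |Y - Y'| ≤ δ)
    (b0 : |g₀| ≤ C) (b1 : |g₁| ≤ C) (b2 : |g₂| ≤ C)
    (b0' : |g₀'| ≤ C) (b1' : |g₁'| ≤ C) (b2' : |g₂'| ≤ C)
    (d0 : |g₀ - g₀'| ≤ C * δ) (d1 : |g₁ - g₁'| ≤ C * δ) (d2 : |g₂ - g₂'| ≤ C * δ)
    (hH : ∀ x ∈ Set.Icc 0 Y, |H x| ≤ C) (hH' : ∀ x ∈ Set.Icc 0 Y', |H' x| ≤ C)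
    (dH : ∀ x, 0 ≤ x → x ≤ Y → x ≤ Y' → |H x - H' x| ≤ C * δ)
    (hc : ContinuousOn H (Set.Icc 0 Y)) (hc' : ContinuousOn H' (Set.Icc 0 Y')) :
    |halfFinitePart g₀ g₁ g₂ H Y - halfFinitePart g₀' g₁' g₂' H' Y'|
      ≤ 10 * C * δ / min Y Y' ^ 3 := by
  rcases le_total Y Y' with hle | hle
  · rw [min_eq_left hle]
    exact abs_halfFinitePart_sub_le_of_le hY hle hY1' (by linarith [(abs_le.mp hδ).1]) b0 b1 b2
      d0 d1 d2 hH' (fun x hx => dH x hx.1 hx.2 (hx.2.trans hle)) hc hc'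
  · rw [min_eq_right hle, abs_sub_comm]
    rw [abs_sub_comm] at d0 d1 d2
    exact abs_halfFinitePart_sub_le_of_le hY' hle hY1 (by linarith [(abs_le.mp hδ).2]) b0' b1' b2'
      d0 d1 d2 hH (fun x hx => by rw [abs_sub_comm]; exact dH x hx.1 (hx.2.trans hle) hx.2) hc' hc

theorem integral_singular_eq {g₀ g₁ g₂ Y ε : ℝ} {H : ℝ → ℝ} (hε : 0 < ε) (hεY : ε ≤ Y)
    (hc : ContinuousOn H (Set.Icc 0 Y)) :
    ∫ x in ε..Y, (g₀ / x ^ 3 + g₁ / x ^ 2 + g₂ / x + H x)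
      = halfFinitePart g₀ g₁ g₂ H Y + g₀ / (2 * ε ^ 2) + g₁ / ε - g₂ * Real.log ε
        - ∫ x in (0 : ℝ)..ε, H x := by
  have hY : 0 < Y := hε.trans_le hεY
  have hI0 : IntervalIntegrable H MeasureTheory.volume 0 ε :=
    (hc.mono (Set.Icc_subset_Icc_right hεY)).intervalIntegrable_of_Icc hε.le
  have hI : IntervalIntegrable H MeasureTheory.volume ε Y :=
    (hc.mono (Set.Icc_subset_Icc_left hε.le)).intervalIntegrable_of_Icc hεY
  have hne : ∀ x ∈ Set.uIcc ε Y, x ≠ 0 := fun x hx => by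
    rw [Set.uIcc_of_le hεY] at hx
    exact (hε.trans_le hx.1).ne'
  have hcs : ContinuousOn (fun x : ℝ => g₀ / x ^ 3 + g₁ / x ^ 2 + g₂ / x) (Set.uIcc ε Y) := by
    intro x hx
    have := hne x hx
    exact ContinuousAt.continuousWithinAt (by fun_prop (disch := positivity))
  have key : ∫ x in ε..Y, (g₀ / x ^ 3 + g₁ / x ^ 2 + g₂ / x)
      = (-(g₀ / (2 * Y ^ 2)) - g₁ / Y + g₂ * Real.log Y)
        - (-(g₀ / (2 * ε ^ 2)) - g₁ / ε + g₂ * Real.log ε) := by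
    refine intervalIntegral.integral_eq_sub_of_hasDerivAt
      (f := fun x => -(g₀ / (2 * x ^ 2)) - g₁ / x + g₂ * Real.log x) (fun x hx => ?_)
      hcs.intervalIntegrable
    have hx0 := hne x hx
    have h1 := ((hasDerivAt_pow 2 x).const_mul 2).fun_inv (by positivity)
    have h2 := (hasDerivAt_inv hx0)
    have h3 := Real.hasDerivAt_log hx0
    have h4 := (((h1.const_mul g₀).fun_neg).fun_sub (h2.const_mul g₁)).fun_add (h3.const_mul g₂)
    simp only [div_eq_mul_inv]
    refine h4.congr_deriv ?_
    field_simp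
    norm_num
    ring
  rw [intervalIntegral.integral_add hcs.intervalIntegrable hI, key, halfFinitePart,
    ← intervalIntegral.integral_add_adjacent_intervals hI0 hI]
  ring

end LatticeSums

/-! ### One constant for all estimates on a family of curves. -/

section CurveBounds

/-- Quantitative description, with a single constant, of the field and of the kernel of a curve. -/
structure CurveBounds (C h : ℝ) (J : Set ℝ) (Ω : Set (ℝ × ℝ)) (d : ℕ → ℝ → E3) (g₁ g₂ : ℝ → ℝ)
    (H : ℝ × ℝ → ℝ) (v₁ : ℝ → E3) (v₂ : ℝ × ℝ → E3) : Prop where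
  one_le : 1 ≤ C
  h_pos : 0 < h
  h_le : h ≤ 1
  dom : IsIncrDomain J Ω
  smul_chord : ∀ p : ℝ × ℝ, p.2 • segAvg 0 (d 1) p = d 0 (p.1 + p.2) - d 0 p.1
  chord_pos : ∀ p ∈ Ω, 0 < ‖segAvg 0 (d 1) p‖
  inv_chord_le : ∀ p ∈ Ω, ‖segAvg 0 (d 1) p‖⁻¹ ≤ C
  tangent_pos : ∀ s ∈ J, 0 < ‖d 1 s‖
  tangent_le : ∀ s ∈ J, ‖d 1 s‖ ≤ C
  inv_speed_le : ∀ s ∈ J, ‖d 1 s‖⁻¹ ≤ C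
  inv_speed_lip : ∀ s ∈ J, ∀ t ∈ J, |‖d 1 s‖⁻¹ - ‖d 1 t‖⁻¹| ≤ C * h ^ 2 * |s - t|
  inv_speed_sub : ∀ s ∈ J, |‖d 1 s‖⁻¹ - 1| ≤ C * h ^ 2
  inv_speed_cube : ∀ s ∈ J, |‖d 1 s‖⁻¹ ^ 3 - 1 + h ^ 2 / 8 * ‖d 2 s‖ ^ 2| ≤ C * h ^ 3
  curv_le : ∀ s ∈ J, ‖d 2 s‖ ^ 2 ≤ C
  curv_lip : ∀ s ∈ J, ∀ t ∈ J, |‖d 2 s‖ ^ 2 - ‖d 2 t‖ ^ 2| ≤ C * |s - t|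
  field_eq : ∀ p ∈ Ω, scaledField (segAvg 0 (d 1) p) (d 1 (p.1 + p.2))
    = (2 * ‖d 1 p.1‖⁻¹ ^ 3) • d 1 p.1 + p.2 • v₁ p.1 + p.2 ^ 2 • v₂ p
  field_one_le : ∀ s ∈ J, ‖v₁ s‖ ≤ C
  field_two_le : ∀ p ∈ Ω, ‖v₂ p‖ ≤ C
  kernel_eq : ∀ p ∈ Ω, inner ℝ (scaledField (segAvg 0 (d 1) p) (d 1 (p.1 + p.2))) (d 1 p.1)
    = 2 * ‖d 1 p.1‖⁻¹ + p.2 * g₁ p.1 + p.2 ^ 2 * g₂ p.1 + p.2 ^ 3 * H p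
  zero_le : ∀ s ∈ J, |2 * ‖d 1 s‖⁻¹| ≤ C
  zero_lip : ∀ s ∈ J, ∀ t ∈ J, |2 * ‖d 1 s‖⁻¹ - 2 * ‖d 1 t‖⁻¹| ≤ C * |s - t|
  one_sq_le : ∀ s ∈ J, |g₁ s| ≤ C * h ^ 2
  one_lip : ∀ s ∈ J, ∀ t ∈ J, |g₁ s - g₁ t| ≤ C * |s - t|
  two_sq_le : ∀ s ∈ J, |g₂ s| ≤ C * h ^ 2
  two_lip : ∀ s ∈ J, ∀ t ∈ J, |g₂ s - g₂ t| ≤ C * |s - t|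
  rem_le : ∀ p ∈ Ω, |H p| ≤ C
  rem_lip : ∀ p ∈ Ω, ∀ q ∈ Ω, |H p - H q| ≤ C * dist p q

variable {ι : Type*} {J : Set ℝ} {Ω : Set (ℝ × ℝ)} {h : ι → ℝ} {d : ℕ → ι → ℝ → E3}

/-- The derivative of ‖r'‖² is 2 r'·r'' = O(h²), so the speed is not merely close to 1 but nearly
constant. This allows the normalization at one magnet to be replaced by that at another. -/
theorem CurveFamily.inv_speed_lip (hd : CurveFamily J Ω h d) : ∃ C : ℝ, 0 ≤ C ∧ ∀ i, ∀ s ∈ J,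
    ∀ t ∈ J, |‖d 1 i s‖⁻¹ - ‖d 1 i t‖⁻¹| ≤ C * h i ^ 2 * |s - t| := by
  obtain ⟨B, hB0, hB⟩ := hd.inner_one_two
  refine ⟨8 * B, by positivity, fun i s hs t ht => ?_⟩
  have hα : ∀ s, HasDerivAt (fun s => ‖d 1 i s‖ ^ 2) (2 * inner ℝ (d 1 i s) (d 2 i s)) s :=
    fun s => (hd.deriv 1 i s).norm_sq
  have h1 := hd.dom.convex.norm_image_sub_le_of_norm_hasDerivWithin_le
    (f := fun s => ‖d 1 i s‖ ^ 2) (C := 2 * (B * h i ^ 2))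
    (fun s _ => (hα s).hasDerivWithinAt) (fun s hs => by
      rw [norm_mul]; simpa using hB i s hs) ht hs
  have p1 := hd.speed_ge i s hs
  have p2 := hd.speed_ge i t ht
  have q1 : 1 / 2 ≤ ‖d 1 i s‖ := by nlinarith [norm_nonneg (d 1 i s)]
  have q2 : 1 / 2 ≤ ‖d 1 i t‖ := by nlinarith [norm_nonneg (d 1 i t)]
  rw [Real.norm_eq_abs, Real.norm_eq_abs] at h1
  generalize ‖d 1 i s‖ = x at *
  generalize ‖d 1 i t‖ = y at *
  have hx : 0 < x := by linarith
  have hy : 0 < y := by linarith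
  have e : x⁻¹ - y⁻¹ = -((x ^ 2 - y ^ 2) * (1 / (x * y * (x + y)))) := by
    field_simp
    ring
  have hden : 1 / (x * y * (x + y)) ≤ 4 := by
    rw [div_le_iff₀ (by positivity)]
    have : 1 / 4 ≤ x * y := by nlinarith
    nlinarith
  rw [e, abs_neg, abs_mul, abs_of_pos (show 0 < 1 / (x * y * (x + y)) by positivity)]
  calc |x ^ 2 - y ^ 2| * (1 / (x * y * (x + y))) ≤ (2 * (B * h i ^ 2) * |s - t|) * 4 := by
        gcongr
    _ = _ := by ring

/-- (1 + h²‖r''‖²/12)^(-3/2) = 1 - h²‖r''‖²/8 + …; this produces the bending energy. -/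
theorem CurveFamily.inv_speed_cube (hd : CurveFamily J Ω h d) (hh : ∀ i, 0 < h i)
    (hh1 : ∀ i, h i ≤ 1)
    (hs : ∃ C : ℝ, ∀ i, ∀ s ∈ J, |‖d 1 i s‖ ^ 2 - 1 - h i ^ 2 / 12 * ‖d 2 i s‖ ^ 2| ≤ C * h i ^ 3) :
    ∃ C : ℝ, 0 ≤ C ∧ ∀ i, ∀ s ∈ J,
      |‖d 1 i s‖⁻¹ ^ 3 - 1 + h i ^ 2 / 8 * ‖d 2 i s‖ ^ 2| ≤ C * h i ^ 3 := by
  obtain ⟨-, -, -, ⟨B, hB0, hB⟩, -⟩ := hd.jet_inv_chord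
  obtain ⟨A, hA⟩ := hs
  obtain ⟨M, hM0, hM, -⟩ := hd.unifLip (k := 1) le_rfl (by norm_num)
  refine ⟨max (3 / 2 * A + B ^ 2 * (4 + 3 * M + 3 / 2 * M ^ 2)) 0, le_max_right _ _,
    fun i s hs => ?_⟩
  have hxM := hM i s hs
  have h1 := hA i s hs
  have h2 := hB i s hs
  have h3 := hd.speed_ge i s hs
  have q1 : 1 / 2 ≤ ‖d 1 i s‖ := by nlinarith [norm_nonneg (d 1 i s)]
  beta_reduce at h2
  rw [Real.norm_eq_abs] at h2
  have hpos : 0 < ‖d 1 i s‖ := by linarith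
  have hw : ‖d 1 i s‖⁻¹ ≤ 2 := by
    rw [inv_le_comm₀ hpos (by norm_num)]; linarith
  have hw0 : 0 < ‖d 1 i s‖⁻¹ := inv_pos.mpr hpos
  have hu : ‖d 1 i s‖⁻¹ * ‖d 1 i s‖ = 1 := inv_mul_cancel₀ hpos.ne'
  generalize ‖d 1 i s‖⁻¹ = w at *
  generalize ‖d 1 i s‖ = x at *
  -- With wx = 1, w³ - 1 equals -(3/2)(x² - 1) plus a multiple of (w - 1)², and the latter is O(h⁴).
  have e : w ^ 3 - 1 + h i ^ 2 / 8 * ‖d 2 i s‖ ^ 2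
      = -(3 / 2) * (x ^ 2 - 1 - h i ^ 2 / 12 * ‖d 2 i s‖ ^ 2)
        + (w - 1) ^ 2 * ((w + 2 + 3 * x + 3 / 2 * x ^ 2)) := by
    have z1 : w ^ 2 * x ^ 2 = 1 := by rw [← mul_pow, hu, one_pow]
    have z2 : w ^ 2 * x = w := by rw [pow_two, mul_assoc, hu, mul_one]
    have z3 : w * x ^ 2 = x := by rw [pow_two, ← mul_assoc, hu, one_mul]
    linear_combination -(3 / 2) * z1 - 3 * z2 + 3 * z3 + 6 * hu
  have h4 : (w - 1) ^ 2 ≤ B ^ 2 * h i ^ 3 := by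
    have h5 : (w - 1) ^ 2 ≤ (B * h i ^ 2) ^ 2 := sq_le_sq' (by linarith [(abs_le.mp h2).1])
      (abs_le.mp h2).2
    have h6 : h i ^ 4 ≤ h i ^ 3 := pow_le_pow_of_le_one (hh i).le (hh1 i) (by norm_num)
    nlinarith [sq_nonneg B]
  have h5 : w + 2 + 3 * x + 3 / 2 * x ^ 2 ≤ 4 + 3 * M + 3 / 2 * M ^ 2 := by nlinarith
  rw [e]
  refine (abs_add_le _ _).trans (le_trans (b := (3 / 2 * A + B ^ 2 * (4 + 3 * M + 3 / 2 * M ^ 2))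
    * h i ^ 3) ?_ (mul_le_mul_of_nonneg_right (le_max_left _ _) (pow_pos (hh i) 3).le))
  rw [abs_mul, abs_mul, abs_of_nonneg (sq_nonneg (w - 1)),
    abs_of_pos (show 0 < w + 2 + 3 * x + 3 / 2 * x ^ 2 by positivity)]
  have h6 : |(-(3 / 2) : ℝ)| = 3 / 2 := by norm_num
  rw [h6]
  calc 3 / 2 * |x ^ 2 - 1 - h i ^ 2 / 12 * ‖d 2 i s‖ ^ 2|
      + (w - 1) ^ 2 * (w + 2 + 3 * x + 3 / 2 * x ^ 2)
      ≤ 3 / 2 * (A * h i ^ 3) + B ^ 2 * h i ^ 3 * (4 + 3 * M + 3 / 2 * M ^ 2) := by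
        have : 0 ≤ B ^ 2 * h i ^ 3 := mul_nonneg (sq_nonneg B) (pow_pos (hh i) 3).le
        gcongr
    _ = _ := by ring

theorem CurveFamily.exists_curveBounds (hd : CurveFamily J Ω h d) (hh : ∀ i, 0 < h i)
    (hh1 : ∀ i, h i ≤ 1)
    (hs : ∃ C : ℝ, ∀ i, ∀ s ∈ J, |‖d 1 i s‖ ^ 2 - 1 - h i ^ 2 / 12 * ‖d 2 i s‖ ^ 2| ≤ C * h i ^ 3) :
    ∃ C : ℝ, ∀ i, ∃ g₁ g₂ H v₁ v₂, CurveBounds C (h i) J Ω (fun k => d k i) g₁ g₂ H v₁ v₂ := by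
  obtain ⟨b₁, b₂, jb, ⟨c5, n5, h5⟩, -, -⟩ := hd.jet_inv_chord
  obtain ⟨v₁, v₂', jv⟩ := hd.jet_field
  obtain ⟨g₁, g₂, jk, ⟨c11, n11, h11⟩, ⟨c13, n13, h13⟩⟩ := hd.jet_kernel
  have l2 := hd.unifLip (k := 2) (by norm_num) (by norm_num)
  have hκ : UnifLip J (fun i s => ‖d 2 i s‖ ^ 2) :=
    (l2.inner l2).congr fun i s _ => (real_inner_self_eq_norm_sq _).symm
  obtain ⟨m, hm, hm2, hch⟩ := hd.chord_ge
  obtain ⟨c1, n1, h1, -⟩ := jb.unifLip hd.dom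
  obtain ⟨c2, n2, h2, -⟩ := hd.unifLip (k := 1) le_rfl (by norm_num)
  obtain ⟨c3, n3, h3, -⟩ := jb.lip_zero
  obtain ⟨c4, n4, h4⟩ := hd.inv_speed_lip
  obtain ⟨c6, n6, h6⟩ := hd.inv_speed_cube hh hh1 hs
  obtain ⟨c7, n7, h7, h7'⟩ := hκ
  obtain ⟨c8, n8, h8, -⟩ := jv.lip_one
  obtain ⟨HV, lHV, eV⟩ := jv.rem
  obtain ⟨c9, n9, h9, -⟩ := (hd.dom.lift jv.lip_two).add
    ((unifLip_snd (ι := ι) hd.dom.abs_le).smul lHV)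
  obtain ⟨c10, n10, h10, h10'⟩ := jk.lip_zero
  obtain ⟨c12, n12, -, h12⟩ := jk.lip_one
  obtain ⟨c14, n14, -, h14⟩ := jk.lip_two
  obtain ⟨H, ⟨c15, n15, h15, h15'⟩, eK⟩ := jk.rem
  set C : ℝ := 1 + c1 + c2 + c3 + c4 + c5 + c6 + c7 + c8 + c9 + c10 + c11 + c12 + c13 + c14 + c15
    with hC
  refine ⟨C, fun i => ⟨g₁ i, g₂ i, H i, v₁ i, fun p => v₂' i p.1 + p.2 • HV i p, ?_⟩⟩
  have hi := hh i
  have m1 : c1 ≤ C := by linarith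
  have m2 : c2 ≤ C := by linarith
  have m3 : c3 ≤ C := by linarith
  have m4 : c4 ≤ C := by linarith
  have m5 : c5 ≤ C := by linarith
  have m6 : c6 ≤ C := by linarith
  have m7 : c7 ≤ C := by linarith
  have m8 : c8 ≤ C := by linarith
  have m9 : c9 ≤ C := by linarith
  have m10 : c10 ≤ C := by linarith
  have m11 : c11 ≤ C := by linarith
  have m12 : c12 ≤ C := by linarith
  have m13 : c13 ≤ C := by linarith
  have m14 : c14 ≤ C := by linarith
  have m15 : c15 ≤ C := by linarith
  simp only [Real.norm_eq_abs, abs_inv, abs_norm, abs_pow, Real.dist_eq] at *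
  refine
    { one_le := by linarith
      h_pos := hh i
      h_le := hh1 i
      dom := hd.dom
      smul_chord := fun p => hd.smul_chord i p
      chord_pos := fun p hp => ?_
      inv_chord_le := fun p hp => (h1 i p hp).trans m1
      tangent_pos := fun s hs => ?_
      tangent_le := fun s hs => (h2 i s hs).trans m2
      inv_speed_le := fun s hs => (h3 i s hs).trans m3
      inv_speed_lip := fun s hs t ht => (h4 i s hs t ht).trans (by gcongr)
      inv_speed_sub := fun s hs => (h5 i s hs).trans (by gcongr)
      inv_speed_cube := fun s hs => (h6 i s hs).trans (by gcongr)
      curv_le := fun s hs => (h7 i s hs).trans m7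
      curv_lip := fun s hs t ht => (h7' i s hs t ht).trans (by gcongr)
      field_eq := fun p hp => ?_
      field_one_le := fun s hs => (h8 i s hs).trans m8
      field_two_le := fun p hp => (h9 i p hp).trans m9
      kernel_eq := fun p hp => ?_
      zero_le := fun s hs => (h10 i s hs).trans m10
      zero_lip := fun s hs t ht => (h10' i s hs t ht).trans (by gcongr)
      one_sq_le := fun s hs => (h11 i s hs).trans (by gcongr)
      one_lip := fun s hs t ht => (h12 i s hs t ht).trans (by gcongr)
      two_sq_le := fun s hs => (h13 i s hs).trans (by gcongr)
      two_lip := fun s hs t ht => (h14 i s hs t ht).trans (by gcongr)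
      rem_le := fun p hp => (h15 i p hp).trans m15
      rem_lip := fun p hp q hq => (h15' i p hp q hq).trans (by gcongr) }
  · have := hm.trans_le (hch i p hp)
    rcases (norm_nonneg (chord d i p)).eq_or_lt with h0 | h0
    · rw [← h0] at this; norm_num at this
    · exact h0
  · have := hd.speed_ge i s hs
    rcases (norm_nonneg (d 1 i s)).eq_or_lt with h0 | h0
    · rw [← h0] at this; norm_num at this
    · exact h0
  · have := eV i p hp
    simp only [chord] at this
    rw [this]
    module
  · have := eK i p hp
    simp only [chord, smul_eq_mul] at this
    exact this

end CurveBounds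

/-! ### Sums over offsets and cancellation of odd terms. -/

section IntegerSums

theorem sum_Icc_neg_eq (F : ℤ → ℝ) (p q : ℕ) :
    ∑ k ∈ Finset.Icc (-(p : ℤ)) q, F k
      = F 0 + ∑ k ∈ Finset.range q, F (k + 1) + ∑ k ∈ Finset.range p, F (-(k + 1)) := by
  induction p with
  | zero =>
    induction q with
    | zero => simp
    | succ q ih =>
      have : Finset.Icc (-((0 : ℕ) : ℤ)) ((q + 1 : ℕ) : ℤ)
          = insert ((q : ℤ) + 1) (Finset.Icc (-((0 : ℕ) : ℤ)) (q : ℤ)) := by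
        ext k; simp only [Finset.mem_Icc, Finset.mem_insert]; omega
      rw [this, Finset.sum_insert (by simp), ih, Finset.sum_range_succ]
      ring
  | succ p ih =>
    have : Finset.Icc (-((p + 1 : ℕ) : ℤ)) (q : ℤ)
        = insert (-((p : ℤ) + 1)) (Finset.Icc (-(p : ℤ)) (q : ℤ)) := by
      ext k; simp only [Finset.mem_Icc, Finset.mem_insert]; omega
    rw [this, Finset.sum_insert (by simp), ih, Finset.sum_range_succ]
    ring

/-- Tails of `∑ 1 / k²`, extended to all integers. -/
theorem exists_tail : ∃ θ : ℤ → ℝ, (∀ l : ℤ, θ l - θ (l + 1) = l / |(l : ℝ)| ^ 3) ∧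
    ∀ l : ℤ, |θ l| ≤ 4 / (|(l : ℝ)| + 1) := by
  set S : ℕ → ℝ := fun q => ∑ k ∈ Finset.range q, 1 / ((k : ℝ) + 1) ^ 2 with hS
  have hsum : Summable (fun k : ℕ => 1 / ((k : ℝ) + 1) ^ 2) := by
    have := (summable_nat_add_iff 1).mpr (Real.summable_one_div_nat_pow.mpr one_lt_two)
    simpa using this
  set L : ℝ := ∑' k : ℕ, 1 / ((k : ℝ) + 1) ^ 2 with hL
  have hlim : Tendsto S atTop (𝓝 L) := hsum.hasSum.tendsto_sum_nat
  have hmono : ∀ q, S q ≤ L := fun q => hsum.sum_le_tsum _ fun k _ => by positivity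
  have hL2 : L ≤ 2 := le_of_tendsto' hlim sum_inv_sq_le
  have hup : ∀ q : ℕ, L - S q ≤ 2 / ((q : ℝ) + 1) := by
    have hanti : Antitone fun n : ℕ => S (n + 1) + 1 / ((n : ℝ) + 1) :=
      antitone_nat_of_succ_le fun n => by
        simp only [hS]
        rw [Finset.sum_range_succ _ (n + 1)]
        push_cast
        have h2 : 1 / ((n : ℝ) + 1) - 1 / ((n : ℝ) + 1 + 1) - 1 / ((n : ℝ) + 1 + 1) ^ 2
            = 1 / ((n + 1) * (n + 1 + 1) ^ 2) := by
          field_simp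
          ring
        have h3 : 0 ≤ 1 / (((n : ℝ) + 1) * (n + 1 + 1) ^ 2) := by positivity
        linarith
    have hl : Tendsto (fun n : ℕ => S (n + 1) + 1 / ((n : ℝ) + 1)) atTop (𝓝 L) := by
      simpa only [add_zero, Function.comp_def] using (hlim.comp (tendsto_add_atTop_nat 1)).add
        tendsto_one_div_add_atTop_nhds_zero_nat
    intro q
    rcases q with _ | n
    · simpa [hS] using hL2
    · have h1 := hanti.le_of_tendsto hl n
      have h2 : 1 / ((n : ℝ) + 1) ≤ 2 / ((n : ℝ) + 1 + 1) := by
        rw [div_le_div_iff₀ (by positivity) (by positivity)]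
        have : (0 : ℝ) ≤ n := by positivity
        linarith
      push_cast
      linarith
  -- θ is a discrete primitive of -l/|l|³: the tail of ∑ 1/k² over k ≥ l for positive l and over k >
  -- |l| otherwise. It takes the same value at 0 and 1, in accordance with 0/0 = 0.
  refine ⟨fun l => if 1 ≤ l then L - S (l - 1).toNat else L - S (-l).toNat, fun l => ?_,
    fun l => ?_⟩
  · rcases lt_trichotomy l 0 with hl | rfl | hl
    · obtain ⟨m, rfl⟩ : ∃ m : ℕ, l = -((m : ℤ) + 1) := ⟨(-l - 1).toNat, by omega⟩
      simp only
      rw [if_neg (by omega), if_neg (by omega),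
        show (-(-((m : ℤ) + 1))).toNat = m + 1 by omega,
        show (-(-((m : ℤ) + 1) + 1)).toNat = m by omega]
      simp only [hS]
      rw [Finset.sum_range_succ]
      push_cast
      have : |(-((m : ℝ) + 1))| = (m : ℝ) + 1 := by rw [abs_neg, abs_of_pos (by positivity)]
      rw [this]
      field_simp
      ring
    · simp
    · obtain ⟨m, rfl⟩ : ∃ m : ℕ, l = (m : ℤ) + 1 := ⟨(l - 1).toNat, by omega⟩
      simp only
      rw [if_pos (by omega), if_pos (by omega),
        show ((m : ℤ) + 1 - 1).toNat = m by omega,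
        show ((m : ℤ) + 1 + 1 - 1).toNat = m + 1 by omega]
      simp only [hS]
      rw [Finset.sum_range_succ]
      push_cast
      have : |((m : ℝ) + 1)| = (m : ℝ) + 1 := abs_of_pos (by positivity)
      rw [this]
      field_simp
      ring
  · have key : ∀ q : ℕ, |(l : ℝ)| + 1 ≤ 2 * (q + 1) → |L - S q| ≤ 4 / (|(l : ℝ)| + 1) := by
      intro q hq
      rw [abs_of_nonneg (sub_nonneg.mpr (hmono q))]
      refine (hup q).trans ?_
      rw [div_le_div_iff₀ (by positivity) (by positivity)]
      linarith
    simp only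
    split_ifs with hl
    · obtain ⟨m, rfl⟩ : ∃ m : ℕ, l = (m : ℤ) + 1 := ⟨(l - 1).toNat, by omega⟩
      apply key
      rw [show ((m : ℤ) + 1 - 1).toNat = m by omega]
      push_cast
      rw [abs_of_pos (by positivity)]
      have : (0 : ℝ) ≤ m := by positivity
      linarith
    · obtain ⟨m, rfl⟩ : ∃ m : ℕ, l = -(m : ℤ) := ⟨(-l).toNat, by omega⟩
      apply key
      rw [show (-(-(m : ℤ))).toNat = m by omega]
      push_cast
      rw [abs_neg, abs_of_nonneg (by positivity)]
      have : (0 : ℝ) ≤ m := by positivity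
      linarith

/-- The sum telescopes through θ, so only tails at the two ends survive; on a window around 0 the
inner terms cancel in pairs. -/
theorem abs_sum_sign_inv_sq_le (lo hi : ℤ) :
    |∑ k ∈ Finset.Icc lo hi, (k : ℝ) / |(k : ℝ)| ^ 3|
      ≤ 4 / (|(lo : ℝ)| + 1) + 8 / (|(hi : ℝ)| + 1) := by
  obtain ⟨θ, hθ, hb⟩ := exists_tail
  rcases lt_or_ge hi lo with hlt | hle
  · rw [Finset.Icc_eq_empty (by omega), Finset.sum_empty, abs_zero]
    positivity
  have hs : ∀ m : ℕ, ∑ k ∈ Finset.Icc lo (lo + m), (k : ℝ) / |(k : ℝ)| ^ 3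
      = θ lo - θ (lo + m + 1) := by
    intro m
    induction m with
    | zero => simp [hθ lo]
    | succ m ih =>
      have : Finset.Icc lo (lo + ((m + 1 : ℕ) : ℤ))
          = insert (lo + m + 1) (Finset.Icc lo (lo + (m : ℤ))) := by
        ext k; simp only [Finset.mem_Icc, Finset.mem_insert]; omega
      rw [this, Finset.sum_insert (by simp), ih, ← hθ (lo + m + 1)]
      push_cast
      ring_nf
  obtain ⟨m, rfl⟩ : ∃ m : ℕ, hi = lo + m := ⟨(hi - lo).toNat, by omega⟩
  rw [hs m]
  -- The upper tail is taken at hi + 1; expressing it through hi doubles the constant 4 to 8.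
  refine (abs_sub _ _).trans (add_le_add (hb _) ((hb _).trans ?_))
  push_cast
  rw [div_le_div_iff₀ (by positivity) (by positivity)]
  have h1 := abs_sub_abs_le_abs_sub ((lo : ℝ) + m) (-1)
  rw [abs_neg, abs_one, sub_neg_eq_add] at h1
  have h2 := abs_nonneg ((lo : ℝ) + m + 1)
  linarith

variable {n : ℕ} {lam : ℝ}

theorem sum_inv_abs_le (hlam : ∑ k ∈ Finset.range n, 1 / ((k : ℝ) + 1) ≤ lam) {lo hi : ℤ}
    (hlo : -(n : ℤ) ≤ lo) (hhi : hi ≤ n) :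
    ∑ k ∈ Finset.Icc lo hi, 1 / |(k : ℝ)| ≤ 2 * lam := by
  calc ∑ k ∈ Finset.Icc lo hi, 1 / |(k : ℝ)|
      ≤ ∑ k ∈ Finset.Icc (-(n : ℤ)) n, 1 / |(k : ℝ)| :=
        Finset.sum_le_sum_of_subset_of_nonneg (Finset.Icc_subset_Icc hlo hhi)
          fun _ _ _ => by positivity
    _ = 2 * ∑ k ∈ Finset.range n, 1 / ((k : ℝ) + 1) := by
        rw [sum_Icc_neg_eq]
        have h1 : ∀ k : ℕ, |((((k : ℤ) + 1 : ℤ)) : ℝ)| = (k : ℝ) + 1 := fun k => by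
          push_cast; exact abs_of_pos (by positivity)
        have h2 : ∀ k : ℕ, |(((-((k : ℤ) + 1) : ℤ)) : ℝ)| = (k : ℝ) + 1 := fun k => by
          push_cast; rw [abs_neg]; exact abs_of_pos (by positivity)
        simp only [h1, h2]
        simp; ring
    _ ≤ 2 * lam := by linarith

/-- The end effects of the individual rows, summed over the rows, are only logarithmic. -/
theorem sum_inv_dist_le (hlam : ∑ k ∈ Finset.range n, 1 / ((k : ℝ) + 1) ≤ lam) (h1 : 1 ≤ lam)
    {S : Finset ℕ} (hS : S ⊆ Finset.range (n + 1)) {c : ℤ} (c0 : 0 ≤ c) (cn : c ≤ n) :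
    ∑ i ∈ S, 1 / (|((c - i : ℤ) : ℝ)| + 1) ≤ 3 * lam := by
  calc ∑ i ∈ S, 1 / (|((c - i : ℤ) : ℝ)| + 1)
      = ∑ k ∈ S.image (fun i : ℕ => c - (i : ℤ)), 1 / (|(k : ℝ)| + 1) := by
        rw [Finset.sum_image]
        intro x _ y _ hxy
        simp only at hxy
        omega
    _ ≤ ∑ k ∈ Finset.Icc (-(n : ℤ)) n, 1 / (|(k : ℝ)| + 1) := by
        refine Finset.sum_le_sum_of_subset_of_nonneg (fun k hk => ?_) fun _ _ _ => by positivity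
        obtain ⟨i, hi, rfl⟩ := Finset.mem_image.mp hk
        have := Finset.mem_range.mp (hS hi)
        rw [Finset.mem_Icc]; omega
    _ = 1 + 2 * ∑ k ∈ Finset.range n, 1 / ((k : ℝ) + 1 + 1) := by
        rw [sum_Icc_neg_eq]
        have h1 : ∀ k : ℕ, |((((k : ℤ) + 1 : ℤ)) : ℝ)| = (k : ℝ) + 1 := fun k => by
          push_cast; exact abs_of_pos (by positivity)
        have h2 : ∀ k : ℕ, |(((-((k : ℤ) + 1) : ℤ)) : ℝ)| = (k : ℝ) + 1 := fun k => by
          push_cast; rw [abs_neg]; exact abs_of_pos (by positivity)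
        simp only [h1, h2]
        simp; ring
    _ ≤ 1 + 2 * ∑ k ∈ Finset.range n, 1 / ((k : ℝ) + 1) := by
        gcongr with k _
        linarith
    _ ≤ 3 * lam := by linarith

/-- Sums of terms that are odd up to a small error. -/
theorem abs_sum_almost_odd_le (hlam : ∑ k ∈ Finset.range n, 1 / ((k : ℝ) + 1) ≤ lam) {lo hi : ℤ}
    (hlo : -(n : ℤ) ≤ lo) (hhi : hi ≤ n) {f : ℤ → ℝ} {β B E : ℝ} (hβ : |β| ≤ B) (hE : 0 ≤ E)
    (hf : ∀ k ∈ Finset.Icc lo hi, |f k - β * ((k : ℝ) / |(k : ℝ)| ^ 3)| ≤ E * (1 / |(k : ℝ)|)) :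
    |∑ k ∈ Finset.Icc lo hi, f k|
      ≤ B * (4 / (|(lo : ℝ)| + 1) + 8 / (|(hi : ℝ)| + 1)) + 2 * E * lam := by
  have e : ∑ k ∈ Finset.Icc lo hi, f k
      = β * ∑ k ∈ Finset.Icc lo hi, (k : ℝ) / |(k : ℝ)| ^ 3
        + ∑ k ∈ Finset.Icc lo hi, (f k - β * ((k : ℝ) / |(k : ℝ)| ^ 3)) := by
    rw [Finset.sum_sub_distrib, ← Finset.mul_sum]; ring
  rw [e]
  refine (abs_add_le _ _).trans (add_le_add ?_ ?_)
  · rw [abs_mul]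
    exact mul_le_mul hβ (abs_sum_sign_inv_sq_le lo hi) (abs_nonneg _) ((abs_nonneg _).trans hβ)
  · refine (Finset.abs_sum_le_sum_abs _ _).trans ((Finset.sum_le_sum hf).trans ?_)
    rw [← Finset.mul_sum]
    have := sum_inv_abs_le hlam hlo hhi
    nlinarith

/-- Sums over an interval of indices in terms of the offsets from one of them. -/
theorem sum_Icc_nat_eq_offsets (F : ℤ → ℝ) (a b : ℕ) (i : ℤ) :
    ∑ j ∈ Finset.Icc a b, F j = ∑ k ∈ Finset.Icc ((a : ℤ) - i) ((b : ℤ) - i), F (i + k) := by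
  refine Finset.sum_nbij' (fun j : ℕ => (j : ℤ) - i) (fun k : ℤ => (i + k).toNat) ?_ ?_ ?_ ?_ ?_
  · intro j hj; rw [Finset.mem_Icc] at *; omega
  · intro j hj; rw [Finset.mem_Icc] at *; omega
  · intro j hj; simp
  · intro k hk; rw [Finset.mem_Icc] at hk; omega
  · intro j _; congr 1; ring

/-- Sums over a period can be taken over any interval of the same length. -/
theorem sum_range_eq_of_periodic {F : ℤ → ℝ} {n : ℕ} (hF : ∀ k, F (k + n) = F k) {p q : ℕ}
    (hpq : p + q + 1 = n) (i : ℤ) :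
    ∑ j ∈ Finset.range n, F j = ∑ k ∈ Finset.Icc (-(p : ℤ)) q, F (i + k) := by
  have hshift : ∀ c : ℤ, ∑ j ∈ Finset.range n, F (c + 1 + j) = ∑ j ∈ Finset.range n, F (c + j) := by
    intro c
    have h1 := Finset.sum_range_succ (fun j : ℕ => F (c + j)) n
    have h2 := Finset.sum_range_succ' (fun j : ℕ => F (c + j)) n
    simp only [hF] at h1
    have h3 : ∀ j : ℕ, F (c + 1 + j) = F (c + ((j + 1 : ℕ) : ℤ)) := fun j => by
      congr 1; push_cast; ring
    simp only [h3]
    rw [h1] at h2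
    simp only [Nat.cast_zero, add_zero] at h2
    linarith
  have hconst : ∀ c : ℤ, ∑ j ∈ Finset.range n, F (c + j) = ∑ j ∈ Finset.range n, F j := by
    intro c
    induction c using Int.induction_on with
    | zero => simp
    | succ c ih => rw [hshift, ih]
    | pred c ih =>
      have := hshift (-(c : ℤ) - 1)
      rw [sub_add_cancel] at this
      rw [← this, ih]
  rw [← hconst (i - p)]
  refine Finset.sum_nbij' (fun j : ℕ => (j : ℤ) - p) (fun k : ℤ => (k + p).toNat) ?_ ?_ ?_ ?_ ?_
  · intro j hj; rw [Finset.mem_range] at hj; rw [Finset.mem_Icc]; omega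
  · intro k hk; rw [Finset.mem_Icc] at hk; rw [Finset.mem_range]; omega
  · intro j _; simp
  · intro k hk; rw [Finset.mem_Icc] at hk; omega
  · intro j _; congr 1; ring

end IntegerSums

/-! ### The dipole interaction as a symmetric bilinear form. -/

section PairTerms

/-- Minus the interaction energy of the dipoles `i` and `j` of two families with common
positions. -/
noncomputable def pairTerm (h : ℝ) (P u v : ℤ → E3) (i j : ℤ) : ℝ :=
  h ^ 3 * inner ℝ (u i) (dipoleField (P j) (v j) (P i))

variable {h : ℝ} {P u v u' v' : ℤ → E3}

theorem inner_dipoleField (p m x y : E3) : inner ℝ y (dipoleField p m x)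
    = 1 / ‖x - p‖ ^ 5 * (3 * inner ℝ (x - p) m * inner ℝ (x - p) y
      - ‖x - p‖ ^ 2 * inner ℝ m y) := by
  rw [dipoleField, real_inner_comm, real_inner_smul_left, inner_sub_left, real_inner_smul_left,
    real_inner_smul_left]

theorem pairTerm_comm (i j : ℤ) : pairTerm h P u v i j = pairTerm h P v u j i := by
  rw [pairTerm, pairTerm, inner_dipoleField, inner_dipoleField, ← neg_sub (P i) (P j), norm_neg,
    inner_neg_left, inner_neg_left, real_inner_comm (u i) (v j)]
  ring

/-- At distance zero the prefactor is 1/0 = 0; sums over the other magnets may therefore run over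
all of them. -/
theorem pairTerm_self (i : ℤ) : pairTerm h P u v i i = 0 := by
  simp [pairTerm, inner_dipoleField]

theorem pairTerm_add_left (i j : ℤ) :
    pairTerm h P (fun k => u k + u' k) v i j = pairTerm h P u v i j + pairTerm h P u' v i j := by
  simp only [pairTerm, inner_add_left, mul_add]

theorem pairTerm_add_right (i j : ℤ) :
    pairTerm h P u (fun k => v k + v' k) i j = pairTerm h P u v i j + pairTerm h P u v' i j := by
  rw [pairTerm_comm, pairTerm_add_left, pairTerm_comm, pairTerm_comm (u := v') (v := u)]

theorem norm_scaledField_le (D T : E3) : ‖scaledField D T‖ ≤ 4 * ‖D‖⁻¹ ^ 3 * ‖T‖ := by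
  rcases eq_or_ne D 0 with rfl | hD
  · simp [scaledField]
  have hD' : 0 < ‖D‖ := norm_pos_iff.mpr hD
  rw [scaledField]
  refine (norm_sub_le _ _).trans ?_
  rw [norm_smul, norm_smul, norm_mul, norm_mul]
  simp only [Real.norm_eq_abs, abs_pow, abs_inv, abs_norm]
  have h1 := abs_real_inner_le_norm D T
  have h3 : |(3 : ℝ)| = 3 := by norm_num
  rw [h3]
  calc 3 * (|inner ℝ D T| * ‖D‖⁻¹ ^ 5) * ‖D‖ + ‖D‖⁻¹ ^ 3 * ‖T‖
      ≤ 3 * ((‖D‖ * ‖T‖) * ‖D‖⁻¹ ^ 5) * ‖D‖ + ‖D‖⁻¹ ^ 3 * ‖T‖ := by gcongr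
    _ = _ := by field_simp; ring

theorem scaledField_smul (D T : E3) (c : ℝ) : scaledField D (c • T) = c • scaledField D T := by
  simp only [scaledField, inner_smul_right]
  module

/-- The dipole field is homogeneous of degree -3 in the displacement and even in it, so only |x|
remains. -/
theorem inner_dipoleField_eq {x : ℝ} {D p q : E3} (hD : D ≠ 0) (hpq : x • D = p - q) (m y : E3) :
    inner ℝ y (dipoleField p m q) = 1 / |x| ^ 3 * inner ℝ y (scaledField D m) := by
  have e : q - p = -(x • D) := by rw [hpq, neg_sub]
  have hD' : ‖D‖ ≠ 0 := norm_ne_zero_iff.mpr hD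
  rw [inner_dipoleField, e, norm_neg, norm_smul, Real.norm_eq_abs, inner_neg_left, inner_neg_left,
    real_inner_smul_left, real_inner_smul_left, scaledField, inner_sub_right, inner_smul_right,
    inner_smul_right, real_inner_comm y m, real_inner_comm D y]
  rcases eq_or_ne x 0 with rfl | hx
  · simp
  have hx' : |x| ≠ 0 := abs_ne_zero.mpr hx
  have h2 : x * x = |x| ^ 2 := by rw [sq_abs]; ring
  have : 3 * -(x * inner ℝ D m) * -(x * inner ℝ D y) = 3 * (|x| ^ 2 * (inner ℝ D m * inner ℝ D y)) := by
    rw [← h2]; ring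
  rw [this]
  field_simp

end PairTerms

/-! ### Interaction of one magnet with its row. -/

section CurveEnergy

/-- Positions on the curve at the points of a lattice. -/
noncomputable def gridPos (h : ℝ) (d : ℕ → ℝ → E3) (k : ℤ) : E3 := d 0 (k * h)

/-- Unit tangents of the curve at the points of a lattice. -/
noncomputable def gridTangent (h : ℝ) (d : ℕ → ℝ → E3) (k : ℤ) : E3 :=
  ‖d 1 (k * h)‖⁻¹ • d 1 (k * h)

/-- Finite part of the integral of the kernel over `[s - X, s + Y]`, in terms of the expansion of
the kernel at `s`. -/
noncomputable def localFinitePart (d : ℕ → ℝ → E3) (g₁ g₂ : ℝ → ℝ) (H : ℝ × ℝ → ℝ)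
    (s X Y : ℝ) : ℝ :=
  halfFinitePart (2 * ‖d 1 s‖⁻¹) (g₁ s) (g₂ s) (fun x => H (s, x)) Y
    + halfFinitePart (2 * ‖d 1 s‖⁻¹) (-g₁ s) (g₂ s) (fun x => -H (s, -x)) X

variable {C h : ℝ} {J : Set ℝ} {Ω : Set (ℝ × ℝ)} {d : ℕ → ℝ → E3} {g₁ g₂ : ℝ → ℝ}
  {H : ℝ × ℝ → ℝ} {v₁ : ℝ → E3} {v₂ : ℝ × ℝ → E3}

/-- With x = kh the factor h³ in front of the field cancels. For k = 0 both sides vanish by 1/0 = 0.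
-/
theorem CurveBounds.pairTerm_eq (hB : CurveBounds C h J Ω d g₁ g₂ H v₁ v₂) {i k : ℤ}
    (hΩ : ((i * h, k * h) : ℝ × ℝ) ∈ Ω) (u v : ℤ → E3) :
    pairTerm h (gridPos h d) u v i (i + k) = 1 / |(k : ℝ)| ^ 3
      * inner ℝ (u i) (scaledField (segAvg 0 (d 1) (i * h, k * h)) (v (i + k))) := by
  have hD : segAvg 0 (d 1) (i * h, k * h) ≠ 0 := norm_pos_iff.mp (hB.chord_pos _ hΩ)
  have hpq := hB.smul_chord (i * h, k * h)
  have e : (i : ℝ) * h + k * h = ((i + k : ℤ) : ℝ) * h := by push_cast; ring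
  simp only [e] at hpq
  have h0 := hB.h_pos
  rw [pairTerm, gridPos, gridPos, inner_dipoleField_eq hD hpq, abs_mul, abs_of_pos h0, ← mul_assoc]
  congr 1
  rcases eq_or_ne (k : ℝ) 0 with hk | hk
  · simp [hk]
  · have := abs_ne_zero.mpr hk
    field_simp

theorem CurveBounds.abs_H_sub_le (hB : CurveBounds C h J Ω d g₁ g₂ H v₁ v₂) {s x y : ℝ}
    (hx : (s, x) ∈ Ω) (hy : (s, y) ∈ Ω) : |H (s, x) - H (s, y)| ≤ C * |x - y| := by
  have := hB.rem_lip _ hx _ hy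
  rwa [dist_prod_same_left, Real.dist_eq] at this

theorem CurveBounds.abs_kernel_le (hB : CurveBounds C h J Ω d g₁ g₂ H v₁ v₂) {p : ℝ × ℝ}
    (hp : p ∈ Ω) :
    |(inner ℝ (scaledField (segAvg 0 (d 1) p) (d 1 (p.1 + p.2))) (d 1 p.1) : ℝ)| ≤ 4 * C := by
  have hs := hB.dom.fst_mem p hp
  have hx := hB.dom.abs_le p hp
  have hC : 0 ≤ C := by linarith [hB.one_le]
  have hh : h ^ 2 ≤ 1 := pow_le_one₀ hB.h_pos.le hB.h_le
  have h1 : |g₁ p.1| ≤ C := (hB.one_sq_le _ hs).trans (by nlinarith)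
  have h2 : |g₂ p.1| ≤ C := (hB.two_sq_le _ hs).trans (by nlinarith)
  have b : ∀ (n : ℕ) (y : ℝ), |y| ≤ C → |p.2 ^ n * y| ≤ C := fun n y hy => by
    rw [abs_mul, abs_pow]
    exact (mul_le_mul (pow_le_one₀ (abs_nonneg _) hx) hy (abs_nonneg _) zero_le_one).trans_eq
      (one_mul C)
  rw [hB.kernel_eq p hp]
  have b0 := hB.zero_le _ hs
  have b1 := b 1 _ h1
  rw [pow_one] at b1
  have b2 := b 2 _ h2
  have b3 := b 3 _ (hB.rem_le p hp)
  refine (abs_add_le _ _).trans ?_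
  have := (abs_add_le (2 * ‖d 1 p.1‖⁻¹ + p.2 * g₁ p.1) (p.2 ^ 2 * g₂ p.1))
  have := (abs_add_le (2 * ‖d 1 p.1‖⁻¹) (p.2 * g₁ p.1))
  linarith

theorem CurveBounds.abs_half_localFinitePart_le (hB : CurveBounds C h J Ω d g₁ g₂ H v₁ v₂)
    {s X Y : ℝ} (hX : 0 < X) (hX1 : X ≤ 1) (hY : 0 < Y) (hY1 : Y ≤ 1)
    (hΩ : ∀ x ∈ Set.Icc (-X) Y, (s, x) ∈ Ω) :
    |localFinitePart d g₁ g₂ H s X Y| ≤ 4 * C / Y ^ 2 + 4 * C / X ^ 2 := by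
  have hs : s ∈ J := hB.dom.fst_mem _ (hΩ 0 ⟨by linarith, hY.le⟩)
  have hC : 0 ≤ C := by linarith [hB.one_le]
  have hh : h ^ 2 ≤ 1 := pow_le_one₀ hB.h_pos.le hB.h_le
  have h1 : |g₁ s| ≤ C := (hB.one_sq_le _ hs).trans (by nlinarith)
  have h2 : |g₂ s| ≤ C := (hB.two_sq_le _ hs).trans (by nlinarith)
  refine (abs_add_le _ _).trans (add_le_add ?_ ?_)
  · exact abs_halfFinitePart_le hY hY1 (hB.zero_le s hs) h1 h2 fun x hx =>
      hB.rem_le _ (hΩ x ⟨by linarith [hx.1], hx.2⟩)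
  · exact abs_halfFinitePart_le hX hX1 (hB.zero_le s hs) (by rwa [abs_neg]) h2 fun x hx => by
      rw [abs_neg]; exact hB.rem_le _ (hΩ (-x) ⟨by linarith [hx.2], by linarith [hx.1]⟩)

/-- Interaction of one dipole along the curve with all the others. -/
theorem CurveBounds.abs_sum_tangent_tangent_sub_le (hB : CurveBounds C h J Ω d g₁ g₂ H v₁ v₂)
    {i : ℤ} {p q : ℕ} (hp : 1 ≤ p) (hq : 1 ≤ q) (hp1 : p * h ≤ 1) (hq1 : q * h ≤ 1)
    (hΩ : ∀ x ∈ Set.Icc (-(p * h)) (q * h), (i * h, x) ∈ Ω) :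
    |∑ k ∈ Finset.Icc (-(p : ℤ)) q,
        pairTerm h (gridPos h d) (gridTangent h d) (gridTangent h d) i (i + k)
      - (4 * zetaThree * ‖d 1 (i * h)‖⁻¹ ^ 3
        + h ^ 2 * localFinitePart d g₁ g₂ H (i * h) (p * h) (q * h))|
      ≤ 40 * C ^ 3 * (h ^ 3 + 1 / (p : ℝ) ^ 3 + 1 / (q : ℝ) ^ 3) := by
  have h0 := hB.h_pos
  have hC1 := hB.one_le
  have hC : 0 ≤ C := by linarith
  have hp0 : (0 : ℝ) < p := by exact_mod_cast hp
  have hq0 : (0 : ℝ) < q := by exact_mod_cast hq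
  have hX : 0 < p * h := by positivity
  have hY : 0 < q * h := by positivity
  set s : ℝ := i * h with hs_def
  have hs : s ∈ J := hB.dom.fst_mem _ (hΩ 0 ⟨by linarith, hY.le⟩)
  set w := ‖d 1 s‖⁻¹ with hw
  have hw0 : 0 ≤ w := by positivity
  have hwC : w ≤ C := hB.inv_speed_le s hs
  set G : ℝ → ℝ := fun x => inner ℝ (scaledField (segAvg 0 (d 1) (s, x)) (d 1 (s + x))) (d 1 s)
    with hG
  have hΩk : ∀ k ∈ Finset.Icc (-(p : ℤ)) q, (s, k * h) ∈ Ω := fun k hk => by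
    rw [Finset.mem_Icc] at hk
    have k1 : -(p : ℝ) ≤ k := by exact_mod_cast hk.1
    have k2 : (k : ℝ) ≤ q := by exact_mod_cast hk.2
    exact hΩ _ ⟨by nlinarith, by nlinarith⟩
  -- Replacing the speed at i + k by the speed at i costs h²·|k|h, and against |k|⁻³ this is
  -- summable to O(h³).
  have step1 : ∀ k ∈ Finset.Icc (-(p : ℤ)) q,
      |pairTerm h (gridPos h d) (gridTangent h d) (gridTangent h d) i (i + k)
        - w ^ 2 * (G (k * h) / |(k : ℝ)| ^ 3)| ≤ 4 * C ^ 3 * h ^ 3 * (1 / |(k : ℝ)| ^ 2) := by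
    intro k hk
    have hk' := hΩk k hk
    have e : s + k * h = ((i + k : ℤ) : ℝ) * h := by rw [hs_def]; push_cast; ring
    have hadd := hB.dom.add_mem _ hk'
    simp only at hadd
    rw [hB.pairTerm_eq hk', gridTangent, gridTangent, ← hs_def, ← e, scaledField_smul,
      inner_smul_left, inner_smul_right, real_inner_comm, ← hw]
    have hl := hB.inv_speed_lip _ hadd _ hs
    have hg := hB.abs_kernel_le hk'
    simp only at hg
    rw [← hw, add_sub_cancel_left, abs_mul, abs_of_pos h0] at hl
    change |G (k * h)| ≤ 4 * C at hg
    change |1 / |(k : ℝ)| ^ 3 * (w * (‖d 1 (s + k * h)‖⁻¹ * G (k * h)))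
      - w ^ 2 * (G (k * h) / |(k : ℝ)| ^ 3)| ≤ _
    have e2 : 1 / |(k : ℝ)| ^ 3 * (w * (‖d 1 (s + k * h)‖⁻¹ * G (k * h)))
      - w ^ 2 * (G (k * h) / |(k : ℝ)| ^ 3)
        = 1 / |(k : ℝ)| ^ 3 * (w * ((‖d 1 (s + k * h)‖⁻¹ - w) * G (k * h))) := by ring
    rw [e2, abs_mul, abs_mul, abs_mul, abs_of_nonneg hw0,
      abs_of_nonneg (show 0 ≤ 1 / |(k : ℝ)| ^ 3 by positivity)]
    calc 1 / |(k : ℝ)| ^ 3 * (w * (|‖d 1 (s + k * h)‖⁻¹ - w| * |G (k * h)|))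
        ≤ 1 / |(k : ℝ)| ^ 3 * (C * ((C * h ^ 2 * (|(k : ℝ)| * h)) * (4 * C))) := by gcongr
      _ = 4 * C ^ 3 * h ^ 3 * (|(k : ℝ)| / |(k : ℝ)| ^ 3) := by ring
      _ = _ := by
        congr 1
        rcases eq_or_ne (k : ℝ) 0 with hk | hk
        · simp [hk]
        · have := abs_ne_zero.mpr hk
          field_simp
  have habs : ∀ k : ℕ, |((((k : ℤ) + 1 : ℤ)) : ℝ)| = (k : ℝ) + 1 := fun k => by
    push_cast; exact abs_of_pos (by positivity)
  have habs' : ∀ k : ℕ, |(((-((k : ℤ) + 1) : ℤ)) : ℝ)| = (k : ℝ) + 1 := fun k => by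
    push_cast; rw [abs_neg]; exact abs_of_pos (by positivity)
  have step2 : |∑ k ∈ Finset.Icc (-(p : ℤ)) q,
        pairTerm h (gridPos h d) (gridTangent h d) (gridTangent h d) i (i + k)
      - w ^ 2 * ∑ k ∈ Finset.Icc (-(p : ℤ)) q, G (k * h) / |(k : ℝ)| ^ 3| ≤ 16 * C ^ 3 * h ^ 3 := by
    rw [Finset.mul_sum, ← Finset.sum_sub_distrib]
    refine (Finset.abs_sum_le_sum_abs _ _).trans ((Finset.sum_le_sum step1).trans ?_)
    rw [← Finset.mul_sum, sum_Icc_neg_eq]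
    simp only [habs, habs']
    have a1 := sum_inv_sq_le p
    have a2 := sum_inv_sq_le q
    have a3 : 0 ≤ C ^ 3 * h ^ 3 := by positivity
    simp only [Int.cast_zero, abs_zero, ne_eq, OfNat.ofNat_ne_zero, not_false_eq_true, zero_pow,
      div_zero, zero_add]
    nlinarith
  have hGe : ∀ x ∈ Set.Icc (-(p * h)) (q * h), G x
      = 2 * w + x * g₁ s + x ^ 2 * g₂ s + x ^ 3 * H (s, x) := fun x hx =>
    hB.kernel_eq _ (hΩ x hx)
  have step3 := abs_latticeSum_sub_le (H := fun x => H (s, x)) hq h0 hq1 (hB.zero_le s hs)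
    (hB.one_sq_le s hs) (hB.two_sq_le s hs) fun x hx y hy =>
      hB.abs_H_sub_le (hΩ x ⟨by linarith [hx.1], hx.2⟩) (hΩ y ⟨by linarith [hy.1], hy.2⟩)
  have step4 := abs_latticeSum_sub_le (H := fun x => -H (s, -x)) hp h0 hp1 (hB.zero_le s hs)
    (g₁ := -g₁ s) (by rw [abs_neg]; exact hB.one_sq_le s hs) (hB.two_sq_le s hs) fun x hx y hy => by
      have := hB.abs_H_sub_le (hΩ (-y) ⟨by linarith [hy.2], by linarith [hy.1]⟩)
        (hΩ (-x) ⟨by linarith [hx.2], by linarith [hx.1]⟩)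
      rwa [show -H (s, -x) - -H (s, -y) = H (s, -y) - H (s, -x) by ring,
        show x - y = -y - -x by ring]
  rw [← hw] at step3 step4
  have hsum : ∑ k ∈ Finset.Icc (-(p : ℤ)) q, G (k * h) / |(k : ℝ)| ^ 3
      = ∑ k ∈ Finset.range q, (2 * w + ((k + 1) * h) * g₁ s + ((k + 1) * h) ^ 2 * g₂ s
          + ((k + 1) * h) ^ 3 * H (s, (k + 1) * h)) / ((k : ℝ) + 1) ^ 3
        + ∑ k ∈ Finset.range p, (2 * w + ((k + 1) * h) * -g₁ s + ((k + 1) * h) ^ 2 * g₂ s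
          + ((k + 1) * h) ^ 3 * -H (s, -((k + 1) * h))) / ((k : ℝ) + 1) ^ 3 := by
    rw [sum_Icc_neg_eq]
    simp only [habs, habs']
    simp only [Int.cast_zero, abs_zero, ne_eq, OfNat.ofNat_ne_zero, not_false_eq_true, zero_pow,
      div_zero, zero_add]
    congr 1
    · refine Finset.sum_congr rfl fun k hk => ?_
      have hk' : (k : ℝ) + 1 ≤ q := by exact_mod_cast Finset.mem_range.mp hk
      have hk0 : (0 : ℝ) ≤ k := by positivity
      push_cast
      rw [hGe _ ⟨by nlinarith, by nlinarith⟩]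
    · refine Finset.sum_congr rfl fun k hk => ?_
      have hk' : (k : ℝ) + 1 ≤ p := by exact_mod_cast Finset.mem_range.mp hk
      have hk0 : (0 : ℝ) ≤ k := by positivity
      push_cast
      rw [hGe _ ⟨by nlinarith, by nlinarith⟩, neg_mul]
      ring
  have step5 := hB.abs_half_localFinitePart_le hX hp1 hY hq1 hΩ
  rw [hsum] at step2
  rw [localFinitePart, ← hw] at step5
  rw [localFinitePart, ← hw]
  set S := ∑ k ∈ Finset.Icc (-(p : ℤ)) q,
        pairTerm h (gridPos h d) (gridTangent h d) (gridTangent h d) i (i + k)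
  set A := ∑ k ∈ Finset.range q, (2 * w + ((k + 1) * h) * g₁ s + ((k + 1) * h) ^ 2 * g₂ s
          + ((k + 1) * h) ^ 3 * H (s, (k + 1) * h)) / ((k : ℝ) + 1) ^ 3
  set B := ∑ k ∈ Finset.range p, (2 * w + ((k + 1) * h) * -g₁ s + ((k + 1) * h) ^ 2 * g₂ s
          + ((k + 1) * h) ^ 3 * -H (s, -((k + 1) * h))) / ((k : ℝ) + 1) ^ 3
  set a := halfFinitePart (2 * w) (g₁ s) (g₂ s) (fun x => H (s, x)) (q * h)
  set b := halfFinitePart (2 * w) (-g₁ s) (g₂ s) (fun x => -H (s, -x)) (p * h)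
  have hw2 : |w ^ 2 - 1| ≤ 2 * C ^ 2 * h ^ 2 := by
    have e : w ^ 2 - 1 = (w - 1) * (w + 1) := by ring
    rw [e, abs_mul, abs_of_nonneg (show 0 ≤ w + 1 by linarith)]
    calc |w - 1| * (w + 1) ≤ (C * h ^ 2) * (C + C) := by
          gcongr
          exact hB.inv_speed_sub s hs
      _ = _ := by ring
  -- The two normalizations contribute w² to the leading coefficient 2w, so that each side of the
  -- row gives 2ζ(3)w³; in front of the finite part w² is replaced by 1.
  have key : S - (4 * zetaThree * w ^ 3 + h ^ 2 * (a + b))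
      = (S - w ^ 2 * (A + B)) + w ^ 2 * (A - (2 * w * zetaThree + h ^ 2 * a))
        + w ^ 2 * (B - (2 * w * zetaThree + h ^ 2 * b)) + (w ^ 2 - 1) * (h ^ 2 * (a + b)) := by ring
  have hwC2 : w ^ 2 ≤ C ^ 2 := by gcongr
  have t1 : |w ^ 2 * (A - (2 * w * zetaThree + h ^ 2 * a))|
      ≤ C ^ 3 * (6 * h ^ 3 + 1 / (q : ℝ) ^ 3) := by
    rw [abs_mul, abs_of_nonneg (sq_nonneg w)]
    exact (mul_le_mul hwC2 step3 (abs_nonneg _) (by positivity)).trans_eq (by ring)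
  have t2 : |w ^ 2 * (B - (2 * w * zetaThree + h ^ 2 * b))|
      ≤ C ^ 3 * (6 * h ^ 3 + 1 / (p : ℝ) ^ 3) := by
    rw [abs_mul, abs_of_nonneg (sq_nonneg w)]
    exact (mul_le_mul hwC2 step4 (abs_nonneg _) (by positivity)).trans_eq (by ring)
  -- That replacement costs h²·h²·(mh)⁻² = h²/m², which is at most m⁻³ because mh ≤ 1 and h ≤ 1.
  have hinv : ∀ m : ℕ, 1 ≤ m → m * h ≤ 1 → h ^ 4 * (1 / ((m : ℝ) * h) ^ 2) ≤ 1 / (m : ℝ) ^ 3 := by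
    intro m hm hm1
    have hm0 : (0 : ℝ) < m := by exact_mod_cast hm
    have e : h ^ 4 * (1 / ((m : ℝ) * h) ^ 2) = (h * (m * h)) / (m : ℝ) ^ 3 := by field_simp
    rw [e]
    gcongr
    have := hB.h_le
    have : 0 < m * h := by positivity
    nlinarith
  have t3 : |(w ^ 2 - 1) * (h ^ 2 * (a + b))|
      ≤ 8 * C ^ 3 * (1 / (p : ℝ) ^ 3 + 1 / (q : ℝ) ^ 3) := by
    rw [abs_mul, abs_mul, abs_of_nonneg (sq_nonneg h)]
    calc |w ^ 2 - 1| * (h ^ 2 * |a + b|)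
        ≤ (2 * C ^ 2 * h ^ 2) * (h ^ 2 * (4 * C / (q * h) ^ 2 + 4 * C / (p * h) ^ 2)) := by gcongr
      _ = 8 * C ^ 3 * (h ^ 4 * (1 / (p * h) ^ 2) + h ^ 4 * (1 / (q * h) ^ 2)) := by ring
      _ ≤ _ := by
        gcongr
        · exact hinv p hp hp1
        · exact hinv q hq hq1
  rw [key]
  refine (abs_add_le _ _).trans ?_
  have := abs_add_le (S - w ^ 2 * (A + B) + w ^ 2 * (A - (2 * w * zetaThree + h ^ 2 * a)))
    (w ^ 2 * (B - (2 * w * zetaThree + h ^ 2 * b)))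
  have := abs_add_le (S - w ^ 2 * (A + B)) (w ^ 2 * (A - (2 * w * zetaThree + h ^ 2 * a)))
  have c1 : 0 ≤ C ^ 3 * h ^ 3 := by positivity
  have c2 : 0 ≤ C ^ 3 * (1 / (p : ℝ) ^ 3) := by positivity
  have c3 : 0 ≤ C ^ 3 * (1 / (q : ℝ) ^ 3) := by positivity
  linarith

variable {n : ℕ} {lam ε : ℝ} {δ : ℤ → E3}

/-- Interaction of a transversal dipole with dipoles along the curve. -/
theorem CurveBounds.abs_sum_correction_tangent_le (hB : CurveBounds C h J Ω d g₁ g₂ H v₁ v₂)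
    (hlam : ∑ k ∈ Finset.range n, 1 / ((k : ℝ) + 1) ≤ lam) {i lo hi : ℤ}
    (hlo : -(n : ℤ) ≤ lo) (hhi : hi ≤ n)
    (hΩ : ∀ k ∈ Finset.Icc lo hi, ((i * h, k * h) : ℝ × ℝ) ∈ Ω)
    (hδ : ‖δ i‖ ≤ ε) (hδ' : |(inner ℝ (d 1 (i * h)) (δ i) : ℝ)| ≤ C * ε ^ 2) :
    |∑ k ∈ Finset.Icc lo hi, pairTerm h (gridPos h d) δ (gridTangent h d) i (i + k)|
      ≤ C ^ 2 * ε * h * (4 / (|(lo : ℝ)| + 1) + 8 / (|(hi : ℝ)| + 1))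
        + 2 * (2 * C ^ 5 * (ε ^ 2 + h ^ 2 * ε)) * lam := by
  rcases lt_or_ge hi lo with hlt | hle
  · have hlam0 : 0 ≤ lam := le_trans (Finset.sum_nonneg fun _ _ => by positivity) hlam
    have hε0 : 0 ≤ ε := (norm_nonneg _).trans hδ
    have := hB.h_pos
    have := hB.one_le
    rw [Finset.Icc_eq_empty (by omega), Finset.sum_empty, abs_zero]
    positivity
  have h0 := hB.h_pos
  have hC1 := hB.one_le
  have hC : 0 ≤ C := by linarith
  have hε0 : 0 ≤ ε := (norm_nonneg _).trans hδ
  set s : ℝ := i * h with hs_def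
  have hs : s ∈ J := hB.dom.fst_mem _ (hΩ lo (Finset.mem_Icc.mpr ⟨le_rfl, hle⟩))
  set w := ‖d 1 s‖⁻¹ with hw
  have hw0 : 0 ≤ w := by positivity
  have hwC : w ≤ C := hB.inv_speed_le s hs
  have hip : ∀ v : E3, ‖v‖ ≤ C → |(inner ℝ (δ i) v : ℝ)| ≤ ε * C := fun v hv =>
    (abs_real_inner_le_norm _ _).trans (mul_le_mul hδ hv (norm_nonneg _) hε0)
  -- β collects the term of the field linear in x, which is odd in k and leaves end effects only.
  refine abs_sum_almost_odd_le hlam hlo hhi (β := h * (w * inner ℝ (δ i) (v₁ s))) ?_ (by positivity)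
    fun k hk => ?_
  · rw [abs_mul, abs_mul, abs_of_pos h0, abs_of_nonneg hw0]
    calc h * (w * |(inner ℝ (δ i) (v₁ s) : ℝ)|) ≤ h * (C * (ε * C)) := by
          gcongr
          exact hip _ (hB.field_one_le s hs)
      _ = _ := by ring
  have hk' := hΩ k hk
  have hx1 := hB.dom.abs_le _ hk'
  simp only at hx1
  have e : s + k * h = ((i + k : ℤ) : ℝ) * h := by rw [hs_def]; push_cast; ring
  have hadd := hB.dom.add_mem _ hk'
  simp only at hadd
  have hfe := hB.field_eq _ hk'
  simp only at hfe
  rw [hB.pairTerm_eq hk', gridTangent, ← e, scaledField_smul, hfe, ← hw, inner_smul_right,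
    inner_add_right, inner_add_right, inner_smul_right, inner_smul_right, inner_smul_right]
  have hl := hB.inv_speed_lip _ hadd _ hs
  rw [← hw, add_sub_cancel_left, abs_mul, abs_of_pos h0] at hl
  have hz := hB.inv_speed_le _ hadd
  have hz0 : 0 ≤ ‖d 1 (s + k * h)‖⁻¹ := by positivity
  generalize ‖d 1 (s + k * h)‖⁻¹ = z at *
  rw [real_inner_comm] at hδ'
  have b1 := hip _ (hB.field_one_le s hs)
  have b2 := hip _ (hB.field_two_le _ hk')
  generalize (inner ℝ (δ i) (d 1 s) : ℝ) = α₀ at *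
  generalize (inner ℝ (δ i) (v₁ s) : ℝ) = α₁ at *
  generalize (inner ℝ (δ i) (v₂ (s, k * h)) : ℝ) = α₂ at *
  -- Three errors remain: the tangential leading field meets an almost orthogonal correction (ε²),
  -- the speed at i + k differs from that at i, and the field has a second-order term; each is at
  -- most a constant times (ε² + h²ε)/|k|.
  have e2 : 1 / |(k : ℝ)| ^ 3 * (z * (2 * w ^ 3 * α₀ + k * h * α₁ + (k * h) ^ 2 * α₂))
      - h * (w * α₁) * (k / |(k : ℝ)| ^ 3)
      = 1 / |(k : ℝ)| ^ 3 * (z * (2 * w ^ 3) * α₀ + (z - w) * (k * h) * α₁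
        + z * (k * h) ^ 2 * α₂) := by ring
  rw [e2, abs_mul, abs_of_nonneg (show 0 ≤ 1 / |(k : ℝ)| ^ 3 by positivity)]
  rcases eq_or_ne k 0 with rfl | hk0
  · simp
  have hk1 : (1 : ℝ) ≤ |(k : ℝ)| := by
    rw [← Int.cast_abs]; exact_mod_cast Int.one_le_abs hk0
  have hsq : |(k : ℝ) * h| ^ 2 ≤ |(k : ℝ)| ^ 2 * h ^ 2 := by
    rw [abs_mul, abs_of_pos h0, mul_pow]
  have a1 : |z * (2 * w ^ 3) * α₀| ≤ (2 * C ^ 5 * ε ^ 2) * |(k : ℝ)| ^ 2 := by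
    rw [abs_mul, abs_of_nonneg (by positivity)]
    calc z * (2 * w ^ 3) * |α₀| ≤ C * (2 * C ^ 3) * (C * ε ^ 2) := by gcongr
      _ = (2 * C ^ 5 * ε ^ 2) * 1 := by ring
      _ ≤ _ := by gcongr; exact one_le_pow₀ hk1
  have hC5 : C ^ 2 ≤ C ^ 5 := pow_le_pow_right₀ hC1 (by norm_num)
  have hh1 := hB.h_le
  have a2 : |(z - w) * (k * h) * α₁| ≤ (C ^ 5 * (h ^ 2 * ε)) * |(k : ℝ)| ^ 2 := by
    rw [abs_mul, abs_mul, abs_mul (k : ℝ) h, abs_of_pos h0]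
    calc |z - w| * (|(k : ℝ)| * h) * |α₁|
        ≤ (C * h ^ 2 * (|(k : ℝ)| * h)) * (|(k : ℝ)| * h) * (ε * C) := by gcongr
      _ = (C ^ 2 * (h ^ 2 * ε)) * |(k : ℝ)| ^ 2 * h ^ 2 := by ring
      _ ≤ (C ^ 5 * (h ^ 2 * ε)) * |(k : ℝ)| ^ 2 * 1 := by
        gcongr
        exact pow_le_one₀ h0.le hh1
      _ = _ := by ring
  have a3 : |z * (k * h) ^ 2 * α₂| ≤ (C ^ 5 * (h ^ 2 * ε)) * |(k : ℝ)| ^ 2 := by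
    rw [abs_mul, abs_mul, abs_of_nonneg hz0, abs_pow]
    calc z * |(k : ℝ) * h| ^ 2 * |α₂| ≤ C * (|(k : ℝ)| ^ 2 * h ^ 2) * (ε * C) := by gcongr
      _ = (C ^ 2 * (h ^ 2 * ε)) * |(k : ℝ)| ^ 2 := by ring
      _ ≤ _ := by gcongr
  have tri : |z * (2 * w ^ 3) * α₀ + (z - w) * (k * h) * α₁ + z * (k * h) ^ 2 * α₂|
      ≤ (2 * C ^ 5 * (ε ^ 2 + h ^ 2 * ε)) * |(k : ℝ)| ^ 2 := by
    refine (abs_add_le _ _).trans ?_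
    have := abs_add_le (z * (2 * w ^ 3) * α₀) ((z - w) * (k * h) * α₁)
    linarith
  calc 1 / |(k : ℝ)| ^ 3 * |z * (2 * w ^ 3) * α₀ + (z - w) * (k * h) * α₁ + z * (k * h) ^ 2 * α₂|
      ≤ 1 / |(k : ℝ)| ^ 3 * ((2 * C ^ 5 * (ε ^ 2 + h ^ 2 * ε)) * |(k : ℝ)| ^ 2) := by gcongr
    _ = _ := by
      have : |(k : ℝ)| ≠ 0 := by positivity
      field_simp

theorem CurveBounds.abs_sum_correction_correction_le (hB : CurveBounds C h J Ω d g₁ g₂ H v₁ v₂)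
    (hlam : ∑ k ∈ Finset.range n, 1 / ((k : ℝ) + 1) ≤ lam) {i lo hi : ℤ}
    (hlo : -(n : ℤ) ≤ lo) (hhi : hi ≤ n)
    (hΩ : ∀ k ∈ Finset.Icc lo hi, ((i * h, k * h) : ℝ × ℝ) ∈ Ω)
    (hδ : ‖δ i‖ ≤ ε) (hδ' : ∀ k ∈ Finset.Icc lo hi, ‖δ (i + k)‖ ≤ ε) :
    |∑ k ∈ Finset.Icc lo hi, pairTerm h (gridPos h d) δ δ i (i + k)|
      ≤ 8 * C ^ 3 * ε ^ 2 * lam := by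
  have hC : 0 ≤ C := by linarith [hB.one_le]
  have hε0 : 0 ≤ ε := (norm_nonneg _).trans hδ
  have hf : ∀ k ∈ Finset.Icc lo hi, |pairTerm h (gridPos h d) δ δ i (i + k)|
      ≤ 4 * C ^ 3 * ε ^ 2 * (1 / |(k : ℝ)|) := fun k hk => by
    rw [hB.pairTerm_eq (hΩ k hk), abs_mul, abs_of_nonneg (show 0 ≤ 1 / |(k : ℝ)| ^ 3 by positivity)]
    have hk3 : 1 / |(k : ℝ)| ^ 3 ≤ 1 / |(k : ℝ)| := by
      rcases eq_or_ne k 0 with rfl | hk0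
      · simp
      have hk1 : (1 : ℝ) ≤ |(k : ℝ)| := by
        rw [← Int.cast_abs]; exact_mod_cast Int.one_le_abs hk0
      exact one_div_le_one_div_of_le (by linarith) (le_self_pow₀ hk1 (by norm_num))
    calc _ ≤ 1 / |(k : ℝ)| * (ε * (4 * C ^ 3 * ε)) := by
          gcongr
          refine (abs_real_inner_le_norm _ _).trans ?_
          gcongr
          refine (norm_scaledField_le _ _).trans ?_
          gcongr
          · exact hB.inv_chord_le _ (hΩ k hk)
          · exact hδ' k hk
      _ = _ := by ring
  refine (Finset.abs_sum_le_sum_abs _ _).trans ((Finset.sum_le_sum hf).trans ?_)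
  rw [← Finset.mul_sum]
  have := sum_inv_abs_le hlam hlo hhi
  have h3 : 0 ≤ 4 * C ^ 3 * ε ^ 2 := by positivity
  nlinarith

end CurveEnergy

/-! ### Double sums over all pairs of magnets. -/

section DoubleSums

theorem zetaThree_nonneg : 0 ≤ zetaThree := hasSum_zetaThree.nonneg fun _ => by positivity

theorem zetaThree_le_two : zetaThree ≤ 2 := by
  refine le_of_tendsto' hasSum_zetaThree.tendsto_sum_nat fun q => le_trans ?_ (sum_inv_sq_le q)
  refine Finset.sum_le_sum fun k _ => one_div_le_one_div_of_le (by positivity) ?_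
  exact pow_le_pow_right₀ (by linarith [(Nat.cast_nonneg k : (0 : ℝ) ≤ k)]) (by norm_num)

theorem sum_Icc_inv_cube_le {a b : ℕ} (ha : 0 < a) :
    ∑ i ∈ Finset.Icc a b, 1 / (i : ℝ) ^ 3 ≤ 2 / (a : ℝ) ^ 2 := by
  have key : ∀ m : ℕ, ∑ i ∈ Finset.Ico a (a + m), 1 / (i : ℝ) ^ 3
      ≤ 2 / (a : ℝ) ^ 2 - 2 / ((a : ℝ) + m) ^ 2 := by
    intro m
    induction m with
    | zero => simp
    | succ m ih =>
      rw [← add_assoc, Finset.sum_Ico_succ_top (by omega)]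
      push_cast
      have hx : (1 : ℝ) ≤ (a : ℝ) + m := by exact_mod_cast (by omega : 1 ≤ a + m)
      have e : ((a : ℝ) + (m + 1)) = (a : ℝ) + m + 1 := by ring
      rw [e]
      generalize (a : ℝ) + m = x at *
      have h1 : 1 / x ^ 3 ≤ 2 / x ^ 2 - 2 / (x + 1) ^ 2 := by
        have : 2 / x ^ 2 - 2 / (x + 1) ^ 2 - 1 / x ^ 3
            = (3 * x ^ 2 - 1) / (x ^ 3 * (x + 1) ^ 2) := by
          field_simp
          ring
        have h2 : 0 ≤ (3 * x ^ 2 - 1) / (x ^ 3 * (x + 1) ^ 2) :=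
          div_nonneg (by nlinarith) (by positivity)
        linarith
      linarith
  rcases lt_or_ge b a with hba | hab
  · rw [Finset.Icc_eq_empty (by omega), Finset.sum_empty]; positivity
  have e : Finset.Icc a b = Finset.Ico a (a + (b + 1 - a)) := by
    ext x; simp only [Finset.mem_Icc, Finset.mem_Ico]; omega
  rw [e]
  refine (key _).trans (sub_le_self _ (by positivity))

theorem sum_Icc_inv_cube_reflect_le {n a b : ℕ} (hb : b < n) :
    ∑ i ∈ Finset.Icc a b, 1 / ((n : ℝ) - i) ^ 3 ≤ 2 / ((n : ℝ) - b) ^ 2 := by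
  have h := sum_Icc_inv_cube_le (a := n - b) (b := n - a) (by omega)
  rw [Nat.cast_sub hb.le] at h
  refine le_of_eq_of_le ?_ h
  refine Finset.sum_nbij' (fun i => n - i) (fun i => n - i) ?_ ?_ ?_ ?_ ?_
  · intro i hi; rw [Finset.mem_Icc] at *; omega
  · intro i hi; rw [Finset.mem_Icc] at *; omega
  · intro i hi; rw [Finset.mem_Icc] at hi; omega
  · intro i hi; rw [Finset.mem_Icc] at hi; omega
  · intro i hi
    rw [Finset.mem_Icc] at hi
    rw [Nat.cast_sub (by omega)]

/-- Splitting off the tangential part of the moments. -/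
theorem sum_pairTerm_split {α : Type*} (S T : Finset α) (e : α → ℤ) (h : ℝ) (P t μ : ℤ → E3) :
    ∑ i ∈ S, ∑ j ∈ T, pairTerm h P μ μ (e i) (e j)
      = ∑ i ∈ S, ∑ j ∈ T, pairTerm h P t t (e i) (e j)
        + ∑ i ∈ S, ∑ j ∈ T, pairTerm h P (fun k => μ k - t k) t (e i) (e j)
        + ∑ j ∈ T, ∑ i ∈ S, pairTerm h P (fun k => μ k - t k) t (e j) (e i)
        + ∑ i ∈ S, ∑ j ∈ T, pairTerm h P (fun k => μ k - t k) (fun k => μ k - t k) (e i) (e j) := by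
  -- Both mixed sums have the correction as first entry, so one estimate with the index sets
  -- interchanged serves for both.
  rw [Finset.sum_comm (s := T) (t := S)]
  simp only [← Finset.sum_add_distrib]
  refine Finset.sum_congr rfl fun i _ => Finset.sum_congr rfl fun j _ => ?_
  have hμ : μ = fun k => t k + (μ k - t k) := by ext1 k; abel
  conv_lhs => rw [hμ]
  rw [pairTerm_add_left, pairTerm_add_right, pairTerm_add_right,
    pairTerm_comm (u := fun k => μ k - t k) (v := t) (i := e j)]
  ring

variable {C h : ℝ} {J : Set ℝ} {Ω : Set (ℝ × ℝ)} {d : ℕ → ℝ → E3} {g₁ g₂ : ℝ → ℝ}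
  {H : ℝ × ℝ → ℝ} {v₁ : ℝ → E3} {v₂ : ℝ × ℝ → E3} {n : ℕ} {lam K : ℝ} {μ : ℤ → E3}

/-- If μ and t are unit vectors, then t·(μ - t) = -‖μ - t‖²/2. -/
theorem CurveBounds.abs_inner_correction_le (hB : CurveBounds C h J Ω d g₁ g₂ H v₁ v₂) {ε : ℝ}
    {i : ℤ} (hi : (i : ℝ) * h ∈ J) (h1 : ‖μ i‖ = 1) (hε : ‖μ i - gridTangent h d i‖ ≤ ε) :
    |(inner ℝ (d 1 (i * h)) (μ i - gridTangent h d i) : ℝ)| ≤ C * ε ^ 2 := by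
  have hpos := hB.tangent_pos _ hi
  have ht : ‖gridTangent h d i‖ = 1 := by
    rw [gridTangent, norm_smul, norm_inv, norm_norm, inv_mul_cancel₀ hpos.ne']
  have hd : d 1 (i * h) = ‖d 1 (i * h)‖ • gridTangent h d i := by
    rw [gridTangent, smul_smul, mul_inv_cancel₀ hpos.ne', one_smul]
  have e := norm_sub_sq_real (μ i) (gridTangent h d i)
  rw [h1, ht] at e
  rw [hd, real_inner_smul_left, abs_mul, abs_norm, inner_sub_right, real_inner_self_eq_norm_sq, ht,
    real_inner_comm]
  have hC := hB.tangent_le _ hi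
  have hC0 := hB.one_le
  have hsq : ‖μ i - gridTangent h d i‖ ^ 2 ≤ ε ^ 2 := by gcongr
  refine mul_le_mul hC (abs_le.mpr ⟨?_, ?_⟩) (abs_nonneg _) (by linarith)
  · nlinarith
  · nlinarith [sq_nonneg ‖μ i - gridTangent h d i‖]

/-- The correction has size ε = K h² lam, with lam of the order of log n. Since h lam³ ≤ 1, one
power of h absorbs all logarithms. -/
theorem correction_bound (h0 : 0 < h) (hlam1 : 1 ≤ lam) (hlam3 : h * lam ^ 3 ≤ 1)
    (hK : 0 ≤ K) :
    (K * h ^ 2 * lam) * h * lam ≤ K * h ^ 2 ∧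
      ((K * h ^ 2 * lam) ^ 2 + h ^ 2 * (K * h ^ 2 * lam)) * lam ≤ (K ^ 2 + K) * h ^ 3 ∧
      (K * h ^ 2 * lam) ^ 2 * lam ≤ K ^ 2 * h ^ 3 := by
  have hlam2 : h * lam ^ 2 ≤ 1 := le_trans (by gcongr; norm_num) hlam3
  have b3 : (K * h ^ 2 * lam) ^ 2 * lam ≤ K ^ 2 * h ^ 3 := by
    calc (K * h ^ 2 * lam) ^ 2 * lam = K ^ 2 * h ^ 3 * (h * lam ^ 3) := by ring
      _ ≤ K ^ 2 * h ^ 3 * 1 := by gcongr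
      _ = _ := mul_one _
  refine ⟨?_, ?_, b3⟩
  · calc (K * h ^ 2 * lam) * h * lam = K * h ^ 2 * (h * lam ^ 2) := by ring
      _ ≤ K * h ^ 2 * 1 := by gcongr
      _ = _ := mul_one _
  · have : h ^ 2 * (K * h ^ 2 * lam) * lam ≤ K * h ^ 3 := by
      calc h ^ 2 * (K * h ^ 2 * lam) * lam = K * h ^ 3 * (h * lam ^ 2) := by ring
        _ ≤ K * h ^ 3 * 1 := by gcongr
        _ = _ := mul_one _
    rw [add_mul, add_mul]
    exact add_le_add b3 this

/-- Inserting the expansion of ‖r'‖⁻³ into the row sum turns 4ζ(3)‖r'‖⁻³ into 4ζ(3) - (ζ(3)/2)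
h²‖r''‖². -/
theorem CurveBounds.abs_tangent_energy_sub_le (hB : CurveBounds C h J Ω d g₁ g₂ H v₁ v₂)
    {i : ℤ} {p q : ℕ} (hp : 1 ≤ p) (hq : 1 ≤ q) (hp1 : p * h ≤ 1) (hq1 : q * h ≤ 1)
    (hΩ : ∀ x ∈ Set.Icc (-(p * h)) (q * h), (i * h, x) ∈ Ω) :
    |∑ k ∈ Finset.Icc (-(p : ℤ)) q,
        pairTerm h (gridPos h d) (gridTangent h d) (gridTangent h d) i (i + k)
      - (4 * zetaThree - zetaThree / 2 * h ^ 2 * ‖d 2 (i * h)‖ ^ 2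
        + h ^ 2 * localFinitePart d g₁ g₂ H (i * h) (p * h) (q * h))|
      ≤ 48 * C ^ 3 * (h ^ 3 + 1 / (p : ℝ) ^ 3 + 1 / (q : ℝ) ^ 3) := by
  have h0 := hB.h_pos
  have hC1 := hB.one_le
  have hp0 : (0 : ℝ) < p := by exact_mod_cast hp
  have hq0 : (0 : ℝ) < q := by exact_mod_cast hq
  have hX : 0 < p * h := by positivity
  have hY : 0 < q * h := by positivity
  have a1 := hB.abs_sum_tangent_tangent_sub_le hp hq hp1 hq1 hΩ
  have a2 := hB.inv_speed_cube _ (hB.dom.fst_mem _ (hΩ 0 ⟨by linarith, hY.le⟩))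
  simp only at a2
  have a3 : |4 * zetaThree * (‖d 1 (i * h)‖⁻¹ ^ 3 - 1 + h ^ 2 / 8 * ‖d 2 (i * h)‖ ^ 2)|
      ≤ 8 * C ^ 3 * h ^ 3 := by
    rw [abs_mul, abs_of_nonneg (by linarith [zetaThree_nonneg])]
    have hC3 : C ≤ C ^ 3 := le_self_pow₀ hC1 (by norm_num)
    calc _ ≤ (4 * 2) * (C ^ 3 * h ^ 3) := by
          refine mul_le_mul (by linarith [zetaThree_le_two]) (a2.trans ?_) (abs_nonneg _)
            (by norm_num)
          gcongr
      _ = _ := by ring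
  have e : ∀ S F : ℝ, S - (4 * zetaThree - zetaThree / 2 * h ^ 2 * ‖d 2 (i * h)‖ ^ 2 + h ^ 2 * F)
      = (S - (4 * zetaThree * ‖d 1 (i * h)‖⁻¹ ^ 3 + h ^ 2 * F))
        + 4 * zetaThree * (‖d 1 (i * h)‖⁻¹ ^ 3 - 1 + h ^ 2 / 8 * ‖d 2 (i * h)‖ ^ 2) := by
    intro S F; ring
  rw [e]
  refine (abs_add_le _ _).trans ((add_le_add a1 a3).trans ?_)
  have c2 : 0 ≤ C ^ 3 * (1 / (p : ℝ) ^ 3) := by positivity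
  have c3 : 0 ≤ C ^ 3 * (1 / (q : ℝ) ^ 3) := by positivity
  linarith

/-! ### Double sums for an open chain. -/

section Chain

variable (hB : CurveBounds C h J Ω d g₁ g₂ H v₁ v₂)
  (hn : (n : ℝ) * h = 1) (hΩ : ∀ s x : ℝ, 0 ≤ s → s ≤ 1 → 0 ≤ s + x → s + x ≤ 1 → (s, x) ∈ Ω)
  (hlam : ∑ k ∈ Finset.range n, 1 / ((k : ℝ) + 1) ≤ lam) (hlam1 : 1 ≤ lam)
  (hlam3 : h * lam ^ 3 ≤ 1) (hK : 0 ≤ K)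
  (hμ1 : ∀ i : ℤ, 0 ≤ i → i ≤ n → ‖μ i‖ = 1)
  (hμ : ∀ i : ℤ, 0 ≤ i → i ≤ n → ‖μ i - gridTangent h d i‖ ≤ K * h ^ 2 * lam)
include hB hn hΩ

theorem CurveBounds.chain_mem {i k : ℤ} (hi : 0 ≤ i) (hi' : i ≤ n) (hk : 0 ≤ i + k)
    (hk' : i + k ≤ n) : ((i * h, k * h) : ℝ × ℝ) ∈ Ω := by
  have h0 := hB.h_pos
  have a1 : (0 : ℝ) ≤ i := by exact_mod_cast hi
  have a2 : (i : ℝ) ≤ n := by exact_mod_cast hi'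
  have a3 : (0 : ℝ) ≤ i + k := by exact_mod_cast hk
  have a4 : (i : ℝ) + k ≤ n := by exact_mod_cast hk'
  refine hΩ _ _ (by positivity) (by nlinarith) (by nlinarith) (by nlinarith)

include hlam hlam1 hlam3 hK hμ1 hμ

/-- The end effects of the rows, of size εh over the distance to the end, sum to εh·lam = O(h²); the
remaining O(h³) per row is multiplied by n + 1. The two index intervals are independent because both
mixed sums are needed. -/
theorem CurveBounds.chain_correction_tangent_le {a b a' b' : ℕ} (hb : b ≤ n) (hb' : b' ≤ n) :
    |∑ i ∈ Finset.Icc a b, ∑ j ∈ Finset.Icc a' b', pairTerm h (gridPos h d)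
        (fun k => μ k - gridTangent h d k) (gridTangent h d) (i : ℤ) (j : ℤ)|
      ≤ (36 * C ^ 2 * K + 8 * C ^ 5 * (K ^ 2 + K)) * h ^ 2 := by
  have h0 := hB.h_pos
  have hC1 := hB.one_le
  rcases lt_or_ge b' a' with hab | hab'
  · rw [Finset.Icc_eq_empty (a := a') (by omega)]
    simp only [Finset.sum_empty, Finset.sum_const_zero, abs_zero]
    positivity
  have hrow : ∀ i ∈ Finset.Icc a b, |∑ j ∈ Finset.Icc a' b', pairTerm h (gridPos h d)
        (fun k => μ k - gridTangent h d k) (gridTangent h d) (i : ℤ) (j : ℤ)|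
      ≤ C ^ 2 * (K * h ^ 2 * lam) * h * (4 * (1 / (|(((a' : ℤ) - i : ℤ) : ℝ)| + 1))
          + 8 * (1 / (|(((b' : ℤ) - i : ℤ) : ℝ)| + 1)))
        + 4 * C ^ 5 * (((K * h ^ 2 * lam) ^ 2 + h ^ 2 * (K * h ^ 2 * lam)) * lam) := by
    intro i hi
    rw [Finset.mem_Icc] at hi
    have hmem : ((i : ℤ) : ℝ) * h ∈ J := by
      have := hB.dom.fst_mem _ (hB.chain_mem hn hΩ (i := i) (k := 0) (by omega) (by omega)
        (by omega) (by omega))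
      exact this
    rw [sum_Icc_nat_eq_offsets (fun j => pairTerm h (gridPos h d)
        (fun k => μ k - gridTangent h d k) (gridTangent h d) (i : ℤ) j) a' b' i]
    have hε := hμ i (by omega) (by omega)
    refine (hB.abs_sum_correction_tangent_le (δ := fun k => μ k - gridTangent h d k) (ε := K * h ^ 2 * lam)
      hlam (by omega) (by omega) (fun k hk => ?_) hε
      (hB.abs_inner_correction_le hmem (hμ1 i (by omega) (by omega)) hε)).trans_eq ?_
    · rw [Finset.mem_Icc] at hk
      exact hB.chain_mem hn hΩ (by omega) (by omega) (by omega) (by omega)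
    · ring
  refine (Finset.abs_sum_le_sum_abs _ _).trans ((Finset.sum_le_sum hrow).trans ?_)
  have hS : Finset.Icc a b ⊆ Finset.range (n + 1) := fun i hi => by
    rw [Finset.mem_Icc] at hi; rw [Finset.mem_range]; omega
  have s1 := sum_inv_dist_le hlam hlam1 hS (c := a') (by omega) (by omega)
  have s2 := sum_inv_dist_le hlam hlam1 hS (c := b') (by omega) (by omega)
  have hcard : ((Finset.Icc a b).card : ℝ) ≤ n + 1 := by
    exact_mod_cast (Finset.card_le_card hS).trans_eq (Finset.card_range _)
  rw [Finset.sum_add_distrib, ← Finset.mul_sum, Finset.sum_add_distrib, ← Finset.mul_sum,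
    ← Finset.mul_sum, Finset.sum_const, nsmul_eq_mul]
  obtain ⟨b1, b2, -⟩ := correction_bound h0 hlam1 hlam3 hK
  have hn1 : ((n : ℝ) + 1) * h ≤ 2 := by rw [add_mul, hn]; linarith [hB.h_le]
  refine (add_le_add (mul_le_mul_of_nonneg_left (c := 36 * lam) (by linarith) (by positivity))
    (mul_le_mul hcard (mul_le_mul_of_nonneg_left b2 (by positivity)) (by positivity)
      (by positivity))).trans ?_
  have c1 : C ^ 2 * (K * h ^ 2 * lam) * h * (36 * lam)
      = 36 * C ^ 2 * ((K * h ^ 2 * lam) * h * lam) := by ring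
  have c2 : ((n : ℝ) + 1) * (4 * C ^ 5 * ((K ^ 2 + K) * h ^ 3))
      = 4 * C ^ 5 * (K ^ 2 + K) * h ^ 2 * (((n : ℝ) + 1) * h) := by ring
  rw [c1, c2]
  calc _ ≤ 36 * C ^ 2 * (K * h ^ 2) + 4 * C ^ 5 * (K ^ 2 + K) * h ^ 2 * 2 := by gcongr
    _ = _ := by ring

theorem CurveBounds.chain_correction_correction_le {a b : ℕ} (hb : b ≤ n) :
    |∑ i ∈ Finset.Icc a b, ∑ j ∈ Finset.Icc 0 n, pairTerm h (gridPos h d)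
        (fun k => μ k - gridTangent h d k) (fun k => μ k - gridTangent h d k) (i : ℤ) (j : ℤ)|
      ≤ 16 * C ^ 3 * K ^ 2 * h ^ 2 := by
  have h0 := hB.h_pos
  have hC1 := hB.one_le
  have hrow : ∀ i ∈ Finset.Icc a b, |∑ j ∈ Finset.Icc 0 n, pairTerm h (gridPos h d)
        (fun k => μ k - gridTangent h d k) (fun k => μ k - gridTangent h d k) (i : ℤ) (j : ℤ)|
      ≤ 8 * C ^ 3 * ((K * h ^ 2 * lam) ^ 2 * lam) := by
    intro i hi
    rw [Finset.mem_Icc] at hi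
    rw [sum_Icc_nat_eq_offsets (fun j => pairTerm h (gridPos h d)
        (fun k => μ k - gridTangent h d k) (fun k => μ k - gridTangent h d k) (i : ℤ) j) 0 n i]
    refine (hB.abs_sum_correction_correction_le (δ := fun k => μ k - gridTangent h d k) (ε := K * h ^ 2 * lam)
      hlam (by omega) (by omega) (fun k hk => ?_)
      (hμ i (by omega) (by omega)) (fun k hk => ?_)).trans_eq ?_
    · rw [Finset.mem_Icc] at hk
      exact hB.chain_mem hn hΩ (by omega) (by omega) (by omega) (by omega)
    · rw [Finset.mem_Icc] at hk
      exact hμ _ (by omega) (by omega)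
    · ring
  refine (Finset.abs_sum_le_sum_abs _ _).trans ((Finset.sum_le_sum hrow).trans ?_)
  have hS : Finset.Icc a b ⊆ Finset.range (n + 1) := fun i hi => by
    rw [Finset.mem_Icc] at hi; rw [Finset.mem_range]; omega
  have hcard : ((Finset.Icc a b).card : ℝ) ≤ n + 1 := by
    exact_mod_cast (Finset.card_le_card hS).trans_eq (Finset.card_range _)
  rw [Finset.sum_const, nsmul_eq_mul]
  obtain ⟨-, -, b3⟩ := correction_bound h0 hlam1 hlam3 hK
  have hn1 : ((n : ℝ) + 1) * h ≤ 2 := by rw [add_mul, hn]; linarith [hB.h_le]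
  calc _ ≤ ((n : ℝ) + 1) * (8 * C ^ 3 * (K ^ 2 * h ^ 3)) := by gcongr
    _ = 8 * C ^ 3 * K ^ 2 * h ^ 2 * (((n : ℝ) + 1) * h) := by ring
    _ ≤ 8 * C ^ 3 * K ^ 2 * h ^ 2 * 2 := by gcongr
    _ = _ := by ring

/-- Magnet i sees i neighbours on its left and n - i on its right; truncating the ζ(3) sums there
costs i⁻³ + (n - i)⁻³, which sums to the end terms. -/
theorem CurveBounds.abs_chain_sum_sub_le {a b : ℕ} (ha : 0 < a) (hab : a ≤ b) (hb : b < n) :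
    |∑ i ∈ Finset.Icc a b, ∑ j ∈ Finset.Icc 0 n, pairTerm h (gridPos h d) μ μ (i : ℤ) (j : ℤ)
      - ∑ i ∈ Finset.Icc a b, (4 * zetaThree - zetaThree / 2 * h ^ 2 * ‖d 2 (i * h)‖ ^ 2
        + h ^ 2 * localFinitePart d g₁ g₂ H (i * h) (i * h) (1 - i * h))|
      ≤ 400 * C ^ 5 * (1 + K) ^ 2 * (1 / (a : ℝ) ^ 2 + 1 / ((n : ℝ) - b) ^ 2) := by
  have h0 := hB.h_pos
  have hC1 := hB.one_le
  have c1 := hB.chain_correction_tangent_le hn hΩ hlam hlam1 hlam3 hK hμ1 hμ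
    (a := a) (b := b) (a' := 0) (b' := n) hb.le le_rfl
  have c2 := hB.chain_correction_tangent_le hn hΩ hlam hlam1 hlam3 hK hμ1 hμ
    (a := 0) (b := n) (a' := a) (b' := b) le_rfl hb.le
  have c3 := hB.chain_correction_correction_le hn hΩ hlam hlam1 hlam3 hK hμ1 hμ (a := a) hb.le
  have c0 : |∑ i ∈ Finset.Icc a b, ∑ j ∈ Finset.Icc 0 n, pairTerm h (gridPos h d)
        (gridTangent h d) (gridTangent h d) (i : ℤ) (j : ℤ)
      - ∑ i ∈ Finset.Icc a b, (4 * zetaThree - zetaThree / 2 * h ^ 2 * ‖d 2 (i * h)‖ ^ 2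
        + h ^ 2 * localFinitePart d g₁ g₂ H (i * h) (i * h) (1 - i * h))|
      ≤ 96 * C ^ 3 * (h ^ 2 + 1 / (a : ℝ) ^ 2 + 1 / ((n : ℝ) - b) ^ 2) := by
    rw [← Finset.sum_sub_distrib]
    have hrow : ∀ i ∈ Finset.Icc a b, |∑ j ∈ Finset.Icc 0 n, pairTerm h (gridPos h d)
        (gridTangent h d) (gridTangent h d) (i : ℤ) (j : ℤ)
      - (4 * zetaThree - zetaThree / 2 * h ^ 2 * ‖d 2 (i * h)‖ ^ 2
        + h ^ 2 * localFinitePart d g₁ g₂ H (i * h) (i * h) (1 - i * h))|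
        ≤ 48 * C ^ 3 * (h ^ 3 + 1 / (i : ℝ) ^ 3 + 1 / ((n : ℝ) - i) ^ 3) := by
      intro i hi
      rw [Finset.mem_Icc] at hi
      have hin : (i : ℝ) + 1 ≤ n := by exact_mod_cast (by omega : i + 1 ≤ n)
      have hi0 : (0 : ℝ) ≤ i := by positivity
      have ecast : ((n - i : ℕ) : ℝ) = (n : ℝ) - i := Nat.cast_sub (by omega)
      have e1 : ((n - i : ℕ) : ℝ) * h = 1 - i * h := by rw [ecast, sub_mul, hn]
      have key := hB.abs_tangent_energy_sub_le (i := i) (p := i) (q := n - i) (by omega) (by omega)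
        (by nlinarith) (by rw [e1]; nlinarith) (fun x hx => by
          rw [e1] at hx
          push_cast
          exact hΩ _ _ (by positivity) (by nlinarith) (by linarith [hx.1]) (by linarith [hx.2]))
      rw [e1, ecast] at key
      rw [sum_Icc_nat_eq_offsets (fun j => pairTerm h (gridPos h d) (gridTangent h d)
        (gridTangent h d) (i : ℤ) j) 0 n i]
      rw [show ((0 : ℕ) : ℤ) - i = -(i : ℤ) by simp, ← Nat.cast_sub (by omega : i ≤ n)]
      exact key
    refine (Finset.abs_sum_le_sum_abs _ _).trans ((Finset.sum_le_sum hrow).trans ?_)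
    have hcard : ((Finset.Icc a b).card : ℝ) ≤ n := by
      have : (Finset.Icc a b).card ≤ n := by rw [Nat.card_Icc]; omega
      exact_mod_cast this
    rw [← Finset.mul_sum, Finset.sum_add_distrib, Finset.sum_add_distrib, Finset.sum_const,
      nsmul_eq_mul]
    have s1 := sum_Icc_inv_cube_le (b := b) ha
    have s2 := sum_Icc_inv_cube_reflect_le (a := a) hb
    have s3 : ((Finset.Icc a b).card : ℝ) * h ^ 3 ≤ h ^ 2 := by
      calc _ ≤ (n : ℝ) * h ^ 3 := by gcongr
        _ = (n * h) * h ^ 2 := by ring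
        _ = _ := by rw [hn, one_mul]
    have h2 : 0 ≤ h ^ 2 := sq_nonneg h
    calc _ ≤ 48 * C ^ 3 * (2 * h ^ 2 + 2 / (a : ℝ) ^ 2 + 2 / ((n : ℝ) - b) ^ 2) :=
          mul_le_mul_of_nonneg_left (by linarith) (by positivity)
      _ = _ := by ring
  have ha0 : (0 : ℝ) < a := by exact_mod_cast ha
  -- Since a ≤ n, bulk errors O(h²) are dominated by the end terms.
  have hha : h ^ 2 ≤ 1 / (a : ℝ) ^ 2 := by
    rw [le_div_iff₀ (by positivity), ← mul_pow]
    have : (a : ℝ) ≤ n := by exact_mod_cast (by omega : a ≤ n)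
    exact pow_le_one₀ (by positivity) (by nlinarith)
  have hfin : 0 ≤ 1 / ((n : ℝ) - b) ^ 2 := by positivity
  rw [sum_pairTerm_split _ _ (fun i : ℕ => (i : ℤ)) h _ (gridTangent h d) μ]
  set X := 1 / (a : ℝ) ^ 2 + 1 / ((n : ℝ) - b) ^ 2
  have hX : h ^ 2 ≤ X := by simp only [X]; linarith
  have hX0 : 0 ≤ X := (sq_nonneg h).trans hX
  have p1 : C ^ 2 ≤ C ^ 5 := pow_le_pow_right₀ hC1 (by norm_num)
  have p2 : C ^ 3 ≤ C ^ 5 := pow_le_pow_right₀ hC1 (by norm_num)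
  have hC5 : 0 ≤ C ^ 5 := by positivity
  have f1 : (36 * C ^ 2 * K + 8 * C ^ 5 * (K ^ 2 + K)) * h ^ 2
      ≤ C ^ 5 * (36 * K + 8 * (K ^ 2 + K)) * X := by
    calc _ ≤ (36 * C ^ 5 * K + 8 * C ^ 5 * (K ^ 2 + K)) * X := by gcongr
      _ = _ := by ring
  have f2 : 16 * C ^ 3 * K ^ 2 * h ^ 2 ≤ C ^ 5 * (16 * K ^ 2) * X := by
    calc _ ≤ 16 * C ^ 5 * K ^ 2 * X := by gcongr
      _ = _ := by ring
  have f3 : 96 * C ^ 3 * (h ^ 2 + 1 / (a : ℝ) ^ 2 + 1 / ((n : ℝ) - b) ^ 2) ≤ C ^ 5 * 192 * X := by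
    calc _ = 96 * C ^ 3 * (h ^ 2 + X) := by simp only [X]; ring
      _ ≤ 96 * C ^ 5 * (X + X) := by gcongr
      _ = _ := by ring
  have f4 : C ^ 5 * (36 * K + 8 * (K ^ 2 + K)) * X + C ^ 5 * (36 * K + 8 * (K ^ 2 + K)) * X
      + C ^ 5 * (16 * K ^ 2) * X + C ^ 5 * 192 * X ≤ 400 * C ^ 5 * (1 + K) ^ 2 * X := by
    have : 0 ≤ C ^ 5 * X * (208 + 712 * K + 368 * K ^ 2) := by positivity
    linarith
  rw [abs_le] at c0 c1 c2 c3 ⊢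
  constructor <;> linarith [c0.1, c0.2, c1.1, c1.2, c2.1, c2.2, c3.1, c3.2]

end Chain

/-! ### Double sums for a closed ring. -/

section Ring

variable (hB : CurveBounds C h J Ω d g₁ g₂ H v₁ v₂)
  (hn : (n : ℝ) * h = 1) (hΩ : ∀ s x : ℝ, 0 ≤ s → s ≤ 1 → |x| ≤ 1 / 2 → (s, x) ∈ Ω)
  (hper : ∀ k s, d k (s + 1) = d k s)
  (hlam : ∑ k ∈ Finset.range n, 1 / ((k : ℝ) + 1) ≤ lam) (hlam1 : 1 ≤ lam)
  (hlam3 : h * lam ^ 3 ≤ 1) (hK : 0 ≤ K)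
  (hμper : ∀ i, μ (i + n) = μ i)
  (hμ1 : ∀ i : ℤ, ‖μ i‖ = 1)
  (hμ : ∀ i : ℤ, ‖μ i - gridTangent h d i‖ ≤ K * h ^ 2 * lam)

theorem gridPos_periodic (hn : (n : ℝ) * h = 1) (hper : ∀ k s, d k (s + 1) = d k s) (i : ℤ) :
    gridPos h d (i + n) = gridPos h d i := by
  have e : ((i + n : ℤ) : ℝ) * h = i * h + 1 := by push_cast; rw [add_mul, hn]
  rw [gridPos, gridPos, e, hper]

theorem gridTangent_periodic (hn : (n : ℝ) * h = 1) (hper : ∀ k s, d k (s + 1) = d k s) (i : ℤ) :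
    gridTangent h d (i + n) = gridTangent h d i := by
  have e : ((i + n : ℤ) : ℝ) * h = i * h + 1 := by push_cast; rw [add_mul, hn]
  rw [gridTangent, gridTangent, e, hper]

include hB hn hΩ hper

theorem CurveBounds.ring_sum_eq {u v : ℤ → E3} (hv : ∀ i, v (i + n) = v i) {p q : ℕ}
    (hpq : p + q + 1 = n) (i : ℤ) :
    ∑ j ∈ Finset.range n, pairTerm h (gridPos h d) u v i j
      = ∑ k ∈ Finset.Icc (-(p : ℤ)) q, pairTerm h (gridPos h d) u v i (i + k) :=
  sum_range_eq_of_periodic (F := fun j => pairTerm h (gridPos h d) u v i j)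
    (fun k => by simp only [pairTerm, hv, gridPos_periodic hn hper]) hpq i

theorem CurveBounds.ring_mem {p q : ℕ} (hp : 2 * p ≤ n) (hq : 2 * q ≤ n) {i : ℕ} (hi : i < n)
    {x : ℝ} (hx : x ∈ Set.Icc (-(p * h)) (q * h)) : (((i : ℤ) : ℝ) * h, x) ∈ Ω := by
  have h0 := hB.h_pos
  have a1 : (2 : ℝ) * p ≤ n := by exact_mod_cast hp
  have a2 : (2 : ℝ) * q ≤ n := by exact_mod_cast hq
  have a3 : (i : ℝ) ≤ n := by exact_mod_cast hi.le
  push_cast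
  exact hΩ _ _ (by positivity) (by nlinarith) (abs_le.mpr ⟨by nlinarith [hx.1], by nlinarith [hx.2]⟩)

theorem CurveBounds.ring_mem_int {p q : ℕ} (hp : 2 * p ≤ n) (hq : 2 * q ≤ n) {i : ℕ} (hi : i < n)
    {k : ℤ} (hk : k ∈ Finset.Icc (-(p : ℤ)) q) : ((((i : ℤ) : ℝ) * h, k * h) : ℝ × ℝ) ∈ Ω := by
  have h0 := hB.h_pos
  rw [Finset.mem_Icc] at hk
  have a1 : -(p : ℝ) ≤ k := by exact_mod_cast hk.1
  have a2 : (k : ℝ) ≤ q := by exact_mod_cast hk.2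
  exact hB.ring_mem hn hΩ hper hp hq hi ⟨by nlinarith, by nlinarith⟩

include hlam hlam1 hlam3 hK hμ1 hμ

theorem CurveBounds.ring_correction_tangent_le (hn3 : 3 ≤ n) :
    |∑ i ∈ Finset.range n, ∑ j ∈ Finset.range n, pairTerm h (gridPos h d)
        (fun k => μ k - gridTangent h d k) (gridTangent h d) (i : ℤ) (j : ℤ)|
      ≤ (24 * C ^ 2 * K + 4 * C ^ 5 * (K ^ 2 + K)) * h ^ 2 := by
  have h0 := hB.h_pos
  have hC1 := hB.one_le
  have hrow : ∀ i ∈ Finset.range n, |∑ j ∈ Finset.range n, pairTerm h (gridPos h d)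
        (fun k => μ k - gridTangent h d k) (gridTangent h d) (i : ℤ) (j : ℤ)|
      ≤ C ^ 2 * (K * h ^ 2 * lam) * h * (24 * h)
        + 4 * C ^ 5 * (((K * h ^ 2 * lam) ^ 2 + h ^ 2 * (K * h ^ 2 * lam)) * lam) := by
    intro i hi
    rw [Finset.mem_range] at hi
    have hmem : ((i : ℤ) : ℝ) * h ∈ J := hB.dom.fst_mem _
      (hB.ring_mem hn hΩ hper (p := 0) (q := 0) (by omega) (by omega) hi (x := 0) (by simp))
    -- The row is centred at i, with (n - 1)/2 neighbours on one side and n/2 on the other, so both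
    -- ends of the window lie about n/2 away and the odd terms leave only O(h).
    rw [hB.ring_sum_eq hn hΩ hper (gridTangent_periodic hn hper)
      (p := (n - 1) / 2) (q := n / 2) (by omega)]
    have hε := hμ i
    refine (hB.abs_sum_correction_tangent_le (δ := fun k => μ k - gridTangent h d k) (ε := K * h ^ 2 * lam)
      hlam (by omega) (by omega) (fun k hk =>
      hB.ring_mem_int hn hΩ hper (by omega) (by omega) hi hk) hε
      (hB.abs_inner_correction_le hmem (hμ1 i) hε)).trans ?_
    have hb : ∀ m : ℕ, n ≤ 2 * (m + 1) → 1 / ((m : ℝ) + 1) ≤ 2 * h := fun m hm => by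
      rw [div_le_iff₀ (by positivity)]
      have : (n : ℝ) ≤ 2 * (m + 1) := by exact_mod_cast hm
      nlinarith
    have hb1 := hb ((n - 1) / 2) (by omega)
    have hb2 := hb (n / 2) (by omega)
    have e : 4 / (|((-(((n - 1) / 2 : ℕ) : ℤ) : ℤ) : ℝ)| + 1)
        + 8 / (|((((n / 2 : ℕ) : ℤ)) : ℝ)| + 1) ≤ 24 * h := by
      rw [Int.cast_neg, abs_neg, Int.cast_natCast, Int.cast_natCast, Nat.abs_cast, Nat.abs_cast,
        div_eq_mul_one_div 4, div_eq_mul_one_div 8]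
      linarith
    calc _ ≤ C ^ 2 * (K * h ^ 2 * lam) * h * (24 * h)
        + 2 * (2 * C ^ 5 * ((K * h ^ 2 * lam) ^ 2 + h ^ 2 * (K * h ^ 2 * lam))) * lam := by gcongr
      _ = _ := by ring
  refine (Finset.abs_sum_le_sum_abs _ _).trans ((Finset.sum_le_sum hrow).trans ?_)
  rw [Finset.sum_const, nsmul_eq_mul, Finset.card_range]
  obtain ⟨b1, b2, -⟩ := correction_bound h0 hlam1 hlam3 hK
  have b1' : K * h ^ 2 * lam * h ≤ K * h ^ 2 := le_trans (le_mul_of_one_le_right (by positivity)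
    hlam1) b1
  calc _ ≤ (n : ℝ) * (C ^ 2 * (K * h ^ 2) * (24 * h) + 4 * C ^ 5 * ((K ^ 2 + K) * h ^ 3)) := by
        gcongr (n : ℝ) * (?_ * (24 * h) + ?_)
        · rw [mul_assoc]; gcongr
        · gcongr
    _ = (n * h) * ((24 * C ^ 2 * K + 4 * C ^ 5 * (K ^ 2 + K)) * h ^ 2) := by ring
    _ = _ := by rw [hn, one_mul]

include hμper

theorem CurveBounds.ring_correction_correction_le (hn3 : 3 ≤ n) :
    |∑ i ∈ Finset.range n, ∑ j ∈ Finset.range n, pairTerm h (gridPos h d)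
        (fun k => μ k - gridTangent h d k) (fun k => μ k - gridTangent h d k) (i : ℤ) (j : ℤ)|
      ≤ 8 * C ^ 3 * K ^ 2 * h ^ 2 := by
  have h0 := hB.h_pos
  have hC1 := hB.one_le
  have hrow : ∀ i ∈ Finset.range n, |∑ j ∈ Finset.range n, pairTerm h (gridPos h d)
        (fun k => μ k - gridTangent h d k) (fun k => μ k - gridTangent h d k) (i : ℤ) (j : ℤ)|
      ≤ 8 * C ^ 3 * ((K * h ^ 2 * lam) ^ 2 * lam) := by
    intro i hi
    rw [Finset.mem_range] at hi
    rw [hB.ring_sum_eq hn hΩ hper (fun k => by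
      simp only [hμper, gridTangent_periodic hn hper]) (p := (n - 1) / 2) (q := n / 2) (by omega)]
    exact (hB.abs_sum_correction_correction_le (δ := fun k => μ k - gridTangent h d k) (ε := K * h ^ 2 * lam)
      hlam (by omega) (by omega) (fun k hk =>
      hB.ring_mem_int hn hΩ hper (by omega) (by omega) hi hk) (hμ i) fun k _ => hμ _).trans_eq
      (by ring)
  refine (Finset.abs_sum_le_sum_abs _ _).trans ((Finset.sum_le_sum hrow).trans ?_)
  rw [Finset.sum_const, nsmul_eq_mul, Finset.card_range]
  obtain ⟨-, -, b3⟩ := correction_bound h0 hlam1 hlam3 hK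
  calc _ ≤ (n : ℝ) * (8 * C ^ 3 * (K ^ 2 * h ^ 3)) := by gcongr
    _ = (n * h) * (8 * C ^ 3 * K ^ 2 * h ^ 2) := by ring
    _ = _ := by rw [hn, one_mul]

theorem CurveBounds.abs_ring_sum_sub_le (hn3 : 3 ≤ n) :
    |∑ i ∈ Finset.range n, ∑ j ∈ Finset.range n, pairTerm h (gridPos h d) μ μ (i : ℤ) (j : ℤ)
      - ∑ i ∈ Finset.range n, (4 * zetaThree - zetaThree / 2 * h ^ 2 * ‖d 2 (i * h)‖ ^ 2
        + h ^ 2 * localFinitePart d g₁ g₂ H (i * h) (((n - 1) / 2 : ℕ) * h) ((n / 2 : ℕ) * h))|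
      ≤ 7000 * C ^ 5 * (1 + K) ^ 2 * h ^ 2 := by
  have h0 := hB.h_pos
  have hC1 := hB.one_le
  have c1 := hB.ring_correction_tangent_le hn hΩ hper hlam hlam1 hlam3 hK hμ1 hμ hn3
  have c3 := hB.ring_correction_correction_le hn hΩ hper hlam hlam1 hlam3 hK hμper hμ1 hμ hn3
  have c0 : |∑ i ∈ Finset.range n, ∑ j ∈ Finset.range n, pairTerm h (gridPos h d)
        (gridTangent h d) (gridTangent h d) (i : ℤ) (j : ℤ)
      - ∑ i ∈ Finset.range n, (4 * zetaThree - zetaThree / 2 * h ^ 2 * ‖d 2 (i * h)‖ ^ 2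
        + h ^ 2 * localFinitePart d g₁ g₂ H (i * h) (((n - 1) / 2 : ℕ) * h) ((n / 2 : ℕ) * h))|
      ≤ 6192 * C ^ 3 * h ^ 2 := by
    rw [← Finset.sum_sub_distrib]
    -- For n ≥ 3 both half-rows contain at least n/4 magnets, which makes the truncation error
    -- O(h³).
    have hinv : ∀ m : ℕ, n ≤ 4 * m → 1 / (m : ℝ) ^ 3 ≤ 64 * h ^ 3 := fun m hm => by
      have hm' : (n : ℝ) ≤ 4 * m := by exact_mod_cast hm
      have hm0 : (0 : ℝ) < m := by exact_mod_cast (by omega : 0 < m)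
      rw [div_le_iff₀ (by positivity)]
      have : 1 ≤ (4 * m * h) ^ 3 := one_le_pow₀ (by nlinarith)
      linarith
    have hhalf : ∀ m : ℕ, 2 * m ≤ n → m * h ≤ 1 := fun m hm => by
      have hm' : (2 : ℝ) * m ≤ n := by exact_mod_cast hm
      nlinarith
    have hrow : ∀ i ∈ Finset.range n, |∑ j ∈ Finset.range n, pairTerm h (gridPos h d)
        (gridTangent h d) (gridTangent h d) (i : ℤ) (j : ℤ)
      - (4 * zetaThree - zetaThree / 2 * h ^ 2 * ‖d 2 (i * h)‖ ^ 2
        + h ^ 2 * localFinitePart d g₁ g₂ H (i * h) (((n - 1) / 2 : ℕ) * h) ((n / 2 : ℕ) * h))|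
        ≤ 6192 * C ^ 3 * h ^ 3 := by
      intro i hi
      rw [Finset.mem_range] at hi
      rw [hB.ring_sum_eq hn hΩ hper (gridTangent_periodic hn hper)
        (p := (n - 1) / 2) (q := n / 2) (by omega)]
      refine (hB.abs_tangent_energy_sub_le (i := i) (by omega) (by omega) (hhalf _ (by omega))
        (hhalf _ (by omega)) fun x hx =>
          hB.ring_mem hn hΩ hper (by omega) (by omega) hi hx).trans ?_
      have i1 := hinv ((n - 1) / 2) (by omega)
      have i2 := hinv (n / 2) (by omega)
      calc _ ≤ 48 * C ^ 3 * (h ^ 3 + 64 * h ^ 3 + 64 * h ^ 3) := by gcongr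
        _ = _ := by ring
    refine (Finset.abs_sum_le_sum_abs _ _).trans ((Finset.sum_le_sum hrow).trans ?_)
    rw [Finset.sum_const, nsmul_eq_mul, Finset.card_range]
    calc _ = (n * h) * (6192 * C ^ 3 * h ^ 2) := by ring
      _ ≤ _ := by rw [hn, one_mul]
  rw [sum_pairTerm_split _ _ (fun i : ℕ => (i : ℤ)) h _ (gridTangent h d) μ]
  have p1 : C ^ 2 ≤ C ^ 5 := pow_le_pow_right₀ hC1 (by norm_num)
  have p2 : C ^ 3 ≤ C ^ 5 := pow_le_pow_right₀ hC1 (by norm_num)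
  have f1 : (24 * C ^ 2 * K + 4 * C ^ 5 * (K ^ 2 + K)) * h ^ 2
      ≤ C ^ 5 * (24 * K + 4 * (K ^ 2 + K)) * h ^ 2 := by
    calc _ ≤ (24 * C ^ 5 * K + 4 * C ^ 5 * (K ^ 2 + K)) * h ^ 2 := by gcongr
      _ = _ := by ring
  have f2 : 8 * C ^ 3 * K ^ 2 * h ^ 2 ≤ C ^ 5 * (8 * K ^ 2) * h ^ 2 := by
    calc _ ≤ 8 * C ^ 5 * K ^ 2 * h ^ 2 := by gcongr
      _ = _ := by ring
  have f3 : 6192 * C ^ 3 * h ^ 2 ≤ C ^ 5 * 6192 * h ^ 2 := by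
    calc _ ≤ 6192 * C ^ 5 * h ^ 2 := by gcongr
      _ = _ := by ring
  have f4 : 2 * (C ^ 5 * (24 * K + 4 * (K ^ 2 + K)) * h ^ 2)
      + C ^ 5 * (8 * K ^ 2) * h ^ 2 + C ^ 5 * 6192 * h ^ 2 ≤ 7000 * C ^ 5 * (1 + K) ^ 2 * h ^ 2 := by
    have : 0 ≤ C ^ 5 * h ^ 2 * (808 + 13944 * K + 6984 * K ^ 2) := by positivity
    linarith
  rw [abs_le] at c0 c1 c3 ⊢
  constructor <;> linarith [c0.1, c0.2, c1.1, c1.2, c3.1, c3.2]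

end Ring

end DoubleSums

/-! ### Identification with Hadamard finite parts. -/

section FiniteParts

theorem hasFinitePart_of_tendsto {f : ℝ → ℝ} {a b s L : ℝ} (has : a < s) (hsb : s < b)
    (hc : ContinuousOn f (Set.Icc a b \ {s})) (N : ℕ) (c : ℕ → ℝ) (e : ℝ)
    (hL : Tendsto (fun ε : ℝ => (∫ η in a..(s - ε), f η) + (∫ η in (s + ε)..b, f η)
      - ∑ k ∈ Finset.range N, c k / ε ^ (k + 1) - e * Real.log ε) (𝓝[>] 0) (𝓝 L)) :
    HasFinitePart f a b s L := by
  have hl : ∀ ε > 0, MeasureTheory.IntegrableOn f (Set.Icc a (s - ε)) := fun ε hε =>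
    (hc.mono fun x hx => ⟨⟨hx.1, by linarith [hx.2]⟩, by
      simp only [Set.mem_singleton_iff]; linarith [hx.2]⟩).integrableOn_Icc
  have hr : ∀ ε > 0, MeasureTheory.IntegrableOn f (Set.Icc (s + ε) b) := fun ε hε =>
    (hc.mono fun x hx => ⟨⟨by linarith [hx.1], hx.2⟩, by
      simp only [Set.mem_singleton_iff]; linarith [hx.1]⟩).integrableOn_Icc
  refine ⟨fun ε hε => ((hl ε hε).union (hr ε hε)).mono_set fun x hx => ?_, N, c, e, hL.congr' ?_⟩
  · by_cases h1 : x ≤ s - ε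
    · exact Or.inl ⟨hx.1.1, h1⟩
    · refine Or.inr ⟨?_, hx.1.2⟩
      by_contra h2
      exact hx.2 ⟨not_le.mp h1, not_le.mp h2⟩
  · have hlt : ∀ᶠ ε : ℝ in 𝓝[>] 0, ε < min (s - a) (b - s) :=
      nhdsWithin_le_nhds (Iio_mem_nhds (lt_min (by linarith) (by linarith)))
    filter_upwards [self_mem_nhdsWithin, hlt] with ε hε hlt
    have hε : 0 < ε := hε
    have h1 := hlt.trans_le (min_le_left _ _)
    have h2 := hlt.trans_le (min_le_right _ _)
    have hset : Set.Icc a b \ Set.Ioo (s - ε) (s + ε)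
        = Set.Icc a (s - ε) ∪ Set.Icc (s + ε) b := by
      ext x
      simp only [Set.mem_sdiff, Set.mem_Icc, Set.mem_Ioo, Set.mem_union, not_and, not_lt]
      constructor
      · rintro ⟨⟨ha, hb⟩, hx⟩
        by_cases h : x ≤ s - ε
        · exact Or.inl ⟨ha, h⟩
        · exact Or.inr ⟨hx (not_le.mp h), hb⟩
      · rintro (⟨ha, hx⟩ | ⟨hx, hb⟩)
        · exact ⟨⟨ha, by linarith⟩, fun h => absurd h (not_lt.mpr hx)⟩
        · exact ⟨⟨by linarith, hb⟩, fun _ => hx⟩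
    have hdisj : Disjoint (Set.Icc a (s - ε)) (Set.Icc (s + ε) b) :=
      Set.disjoint_left.mpr fun x hx hx' => by linarith [hx.2, hx'.1]
    rw [hset, MeasureTheory.setIntegral_union hdisj measurableSet_Icc (hl ε hε) (hr ε hε),
      intervalIntegral.integral_of_le (by linarith), intervalIntegral.integral_of_le (by linarith),
      MeasureTheory.integral_Icc_eq_integral_Ioc, MeasureTheory.integral_Icc_eq_integral_Ioc]

theorem continuousAt_kernel {r : ℝ → E3} {s η : ℝ} (hr : Continuous r) (hr' : Continuous (deriv r))
    (hne : r s ≠ r η) : ContinuousAt (kernel r s) η := by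
  have h0 : ‖r s - r η‖ ≠ 0 := norm_ne_zero_iff.mpr (sub_ne_zero.mpr hne)
  unfold kernel
  have h5 : ‖r s - r η‖ ^ 5 ≠ 0 := pow_ne_zero _ h0
  have h3 : ‖r s - r η‖ ^ 3 ≠ 0 := pow_ne_zero _ h0
  refine ContinuousAt.sub (ContinuousAt.div ?_ ?_ h5) (ContinuousAt.div ?_ ?_ h3) <;>
  exact Continuous.continuousAt (by fun_prop)

variable {C h : ℝ} {J : Set ℝ} {Ω : Set (ℝ × ℝ)} {d : ℕ → ℝ → E3} {g₁ g₂ : ℝ → ℝ}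
  {H : ℝ × ℝ → ℝ} {v₁ : ℝ → E3} {v₂ : ℝ × ℝ → E3}

/-- Apart from the factor |x|⁻³ the kernel of the continuum energy is the rescaled kernel used in
the lattice sums, so both share one expansion. -/
theorem CurveBounds.kernel_add_eq (hB : CurveBounds C h J Ω d g₁ g₂ H v₁ v₂)
    (hd : ∀ s, HasDerivAt (d 0) (d 1 s) s) {s x : ℝ} (hΩ : (s, x) ∈ Ω) :
    kernel (d 0) s (s + x) = 1 / |x| ^ 3
      * (2 * ‖d 1 s‖⁻¹ + x * g₁ s + x ^ 2 * g₂ s + x ^ 3 * H (s, x)) := by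
  have hpq := hB.smul_chord (s, x)
  have hk := hB.kernel_eq _ hΩ
  simp only at hpq hk
  have e : d 0 s - d 0 (s + x) = -(x • segAvg 0 (d 1) (s, x)) := by rw [hpq, neg_sub]
  rw [kernel, (hd s).deriv, (hd (s + x)).deriv, e, norm_neg, norm_smul, Real.norm_eq_abs,
    inner_neg_left, inner_neg_left, real_inner_smul_left, real_inner_smul_left, ← hk, scaledField,
    inner_sub_left, real_inner_smul_left, real_inner_smul_left]
  have hD : ‖segAvg 0 (d 1) (s, x)‖ ≠ 0 := (hB.chord_pos _ hΩ).ne'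
  rcases eq_or_ne x 0 with rfl | hx
  · simp
  have hx' : |x| ≠ 0 := abs_ne_zero.mpr hx
  generalize segAvg 0 (d 1) (s, x) = D at *
  have h2 : x * x = |x| ^ 2 := by rw [sq_abs]; ring
  have : 3 * -(x * inner ℝ D (d 1 (s + x))) * -(x * inner ℝ D (d 1 s))
      = 3 * (|x| ^ 2 * (inner ℝ D (d 1 (s + x)) * inner ℝ D (d 1 s))) := by
    rw [← h2]; ring
  rw [this]
  field_simp

theorem CurveBounds.ne_of_mem (hB : CurveBounds C h J Ω d g₁ g₂ H v₁ v₂) {s x : ℝ}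
    (hΩ : (s, x) ∈ Ω) (hx : x ≠ 0) : d 0 s ≠ d 0 (s + x) := by
  intro he
  have hpq := hB.smul_chord (s, x)
  simp only [he, sub_self, smul_eq_zero] at hpq
  have := hB.chord_pos _ hΩ
  rcases hpq with h1 | h1
  · exact hx h1
  · rw [h1, norm_zero] at this; exact lt_irrefl _ this

theorem CurveBounds.continuousOn_H (hB : CurveBounds C h J Ω d g₁ g₂ H v₁ v₂) {s : ℝ} {S : Set ℝ}
    (hΩ : ∀ x ∈ S, (s, x) ∈ Ω) : ContinuousOn (fun x => H (s, x)) S := by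
  have hC : 0 ≤ C := by linarith [hB.one_le]
  refine (LipschitzOnWith.of_dist_le_mul (K := ⟨C, hC⟩) fun x hx y hy => ?_).continuousOn
  rw [Real.dist_eq, Real.dist_eq]
  exact hB.abs_H_sub_le (hΩ x hx) (hΩ y hy)

theorem CurveBounds.continuousOn_H_neg (hB : CurveBounds C h J Ω d g₁ g₂ H v₁ v₂) {s : ℝ}
    {S : Set ℝ} (hΩ : ∀ x ∈ S, (s, -x) ∈ Ω) : ContinuousOn (fun x => -H (s, -x)) S := by
  have h1 : ContinuousOn (fun x => H (s, x)) (Neg.neg '' S) := hB.continuousOn_H (by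
    rintro _ ⟨x, hx, rfl⟩
    exact hΩ x hx)
  exact (h1.comp continuousOn_neg (Set.mapsTo_image _ _)).neg

/-- Adding both sides of the singularity, the terms ±g₁/ε cancel; the divergent part is 2‖r'‖⁻¹ε⁻² -
2g₂ log ε. The index k = 1 stands for ε⁻². -/
theorem CurveBounds.tendsto_integral_kernel (hB : CurveBounds C h J Ω d g₁ g₂ H v₁ v₂)
    (hd : ∀ s, HasDerivAt (d 0) (d 1 s) s) {s X Y : ℝ} (hX : 0 < X) (hY : 0 < Y)
    (hΩ : ∀ x ∈ Set.Icc (-X) Y, (s, x) ∈ Ω) :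
    Tendsto (fun ε : ℝ => (∫ η in (s - X)..(s - ε), kernel (d 0) s η)
        + (∫ η in (s + ε)..(s + Y), kernel (d 0) s η)
        - ∑ k ∈ Finset.range 2, (if k = 1 then 2 * ‖d 1 s‖⁻¹ else 0) / ε ^ (k + 1)
        - (-2 * g₂ s) * Real.log ε) (𝓝[>] 0)
      (𝓝 (localFinitePart d g₁ g₂ H s X Y)) := by
  have hΩ1 : ∀ x ∈ Set.Icc 0 Y, (s, x) ∈ Ω := fun x hx => hΩ x ⟨by linarith [hx.1], hx.2⟩
  have hΩ2 : ∀ x ∈ Set.Icc 0 X, (s, -x) ∈ Ω := fun x hx =>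
    hΩ (-x) ⟨by linarith [hx.2], by linarith [hx.1]⟩
  have hH1 := hB.continuousOn_H hΩ1
  have hH2 := hB.continuousOn_H_neg hΩ2
  have hlim : ∀ {F : ℝ → ℝ} {Z : ℝ}, 0 < Z → ContinuousOn F (Set.Icc 0 Z) →
      Tendsto (fun ε : ℝ => ∫ x in (0 : ℝ)..ε, F x) (𝓝[>] 0) (𝓝 0) := by
    intro F Z hZ hF
    have hc := intervalIntegral.continuousOn_primitive_interval (a := 0) (b := Z) (f := F)
      (μ := MeasureTheory.volume) (by rw [Set.uIcc_of_le hZ.le]; exact hF.integrableOn_Icc)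
    rw [Set.uIcc_of_le hZ.le] at hc
    have h1 := (hc 0 ⟨le_rfl, hZ.le⟩).tendsto
    rw [intervalIntegral.integral_same] at h1
    exact h1.mono_left (nhdsWithin_le_of_mem (Icc_mem_nhdsGT hZ))
  have hT : Tendsto (fun ε : ℝ => localFinitePart d g₁ g₂ H s X Y
      - (∫ x in (0 : ℝ)..ε, -H (s, -x)) - ∫ x in (0 : ℝ)..ε, H (s, x)) (𝓝[>] 0)
      (𝓝 (localFinitePart d g₁ g₂ H s X Y - 0 - 0)) :=
    (tendsto_const_nhds.sub (hlim hX hH2)).sub (hlim hY hH1)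
  rw [sub_zero, sub_zero] at hT
  refine hT.congr' ?_
  have hlt : ∀ᶠ ε : ℝ in 𝓝[>] 0, ε < min X Y :=
    nhdsWithin_le_nhds (Iio_mem_nhds (lt_min hX hY))
  filter_upwards [self_mem_nhdsWithin, hlt] with ε hε hlt
  have hε : 0 < ε := hε
  have h1 := (hlt.trans_le (min_le_left _ _)).le
  have h2 := (hlt.trans_le (min_le_right _ _)).le
  have i1 : ∫ η in (s + ε)..(s + Y), kernel (d 0) s η
      = ∫ x in ε..Y, (2 * ‖d 1 s‖⁻¹ / x ^ 3 + g₁ s / x ^ 2 + g₂ s / x + H (s, x)) := by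
    rw [← intervalIntegral.integral_comp_add_left]
    refine intervalIntegral.integral_congr fun x hx => ?_
    rw [Set.uIcc_of_le h2] at hx
    have hx0 : 0 < x := hε.trans_le hx.1
    rw [hB.kernel_add_eq hd (hΩ1 x ⟨hx0.le, hx.2⟩), abs_of_pos hx0]
    field_simp
  have i2 : ∫ η in (s - X)..(s - ε), kernel (d 0) s η
      = ∫ x in ε..X, (2 * ‖d 1 s‖⁻¹ / x ^ 3 + -g₁ s / x ^ 2 + g₂ s / x + -H (s, -x)) := by
    rw [← intervalIntegral.integral_comp_sub_left]
    refine intervalIntegral.integral_congr fun x hx => ?_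
    rw [Set.uIcc_of_le h1] at hx
    have hx0 : 0 < x := hε.trans_le hx.1
    rw [sub_eq_add_neg, hB.kernel_add_eq hd (hΩ2 x ⟨hx0.le, hx.2⟩), abs_neg, abs_of_pos hx0]
    field_simp
  rw [i1, i2, integral_singular_eq hε h2 hH1, integral_singular_eq hε h1 hH2, localFinitePart]
  simp only [Finset.sum_range_succ, Finset.range_zero, Finset.sum_empty]
  norm_num
  ring

theorem CurveBounds.abs_localFinitePart_sub_le (hB : CurveBounds C h J Ω d g₁ g₂ H v₁ v₂)
    {s t X Y X' Y' δ : ℝ} (hX : 0 < X) (hY : 0 < Y) (hX' : 0 < X') (hY' : 0 < Y') (hX1 : X ≤ 1)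
    (hY1 : Y ≤ 1) (hX1' : X' ≤ 1) (hY1' : Y' ≤ 1) (hst : |s - t| ≤ δ) (hXX : |X - X'| ≤ δ)
    (hYY : |Y - Y'| ≤ δ) (hs : ∀ x ∈ Set.Icc (-X) Y, (s, x) ∈ Ω)
    (ht : ∀ x ∈ Set.Icc (-X') Y', (t, x) ∈ Ω) :
    |localFinitePart d g₁ g₂ H s X Y - localFinitePart d g₁ g₂ H t X' Y'|
      ≤ 10 * C * δ / min Y Y' ^ 3 + 10 * C * δ / min X X' ^ 3 := by
  have hC : 0 ≤ C := by linarith [hB.one_le]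
  have hh : h ^ 2 ≤ 1 := pow_le_one₀ hB.h_pos.le hB.h_le
  have hsJ : s ∈ J := hB.dom.fst_mem _ (hs 0 ⟨by linarith, hY.le⟩)
  have htJ : t ∈ J := hB.dom.fst_mem _ (ht 0 ⟨by linarith, hY'.le⟩)
  have hδ : C * |s - t| ≤ C * δ := by gcongr
  have b1 : ∀ s ∈ J, |g₁ s| ≤ C := fun s hs => (hB.one_sq_le s hs).trans (by nlinarith)
  have b2 : ∀ s ∈ J, |g₂ s| ≤ C := fun s hs => (hB.two_sq_le s hs).trans (by nlinarith)
  have l0 := (hB.zero_lip s hsJ t htJ).trans hδ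
  have l1 := (hB.one_lip s hsJ t htJ).trans hδ
  have l2 := (hB.two_lip s hsJ t htJ).trans hδ
  have lH : ∀ x, (s, x) ∈ Ω → (t, x) ∈ Ω → |H (s, x) - H (t, x)| ≤ C * δ := fun x h1 h2 => by
    have := hB.rem_lip _ h1 _ h2
    rw [dist_prod_same_right, Real.dist_eq] at this
    exact this.trans hδ
  have hs1 : ∀ x ∈ Set.Icc 0 Y, (s, x) ∈ Ω := fun x hx => hs x ⟨by linarith [hx.1], hx.2⟩
  have ht1 : ∀ x ∈ Set.Icc 0 Y', (t, x) ∈ Ω := fun x hx => ht x ⟨by linarith [hx.1], hx.2⟩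
  have hs2 : ∀ x ∈ Set.Icc 0 X, (s, -x) ∈ Ω := fun x hx =>
    hs (-x) ⟨by linarith [hx.2], by linarith [hx.1]⟩
  have ht2 : ∀ x ∈ Set.Icc 0 X', (t, -x) ∈ Ω := fun x hx =>
    ht (-x) ⟨by linarith [hx.2], by linarith [hx.1]⟩
  have e : localFinitePart d g₁ g₂ H s X Y - localFinitePart d g₁ g₂ H t X' Y'
      = (halfFinitePart (2 * ‖d 1 s‖⁻¹) (g₁ s) (g₂ s) (fun x => H (s, x)) Y
          - halfFinitePart (2 * ‖d 1 t‖⁻¹) (g₁ t) (g₂ t) (fun x => H (t, x)) Y')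
        + (halfFinitePart (2 * ‖d 1 s‖⁻¹) (-g₁ s) (g₂ s) (fun x => -H (s, -x)) X
          - halfFinitePart (2 * ‖d 1 t‖⁻¹) (-g₁ t) (g₂ t) (fun x => -H (t, -x)) X') := by
    rw [localFinitePart, localFinitePart]; ring
  rw [e]
  refine (abs_add_le _ _).trans (add_le_add ?_ ?_)
  · exact abs_halfFinitePart_sub_le hY hY' hY1 hY1' hYY (hB.zero_le s hsJ) (b1 s hsJ) (b2 s hsJ)
      (hB.zero_le t htJ) (b1 t htJ) (b2 t htJ) l0 l1 l2
      (fun x hx => hB.rem_le _ (hs1 x hx)) (fun x hx => hB.rem_le _ (ht1 x hx))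
      (fun x h0 h1 h2 => lH x (hs1 x ⟨h0, h1⟩) (ht1 x ⟨h0, h2⟩))
      (hB.continuousOn_H hs1) (hB.continuousOn_H ht1)
  · refine abs_halfFinitePart_sub_le hX hX' hX1 hX1' hXX (hB.zero_le s hsJ)
      (by rw [abs_neg]; exact b1 s hsJ) (b2 s hsJ)
      (hB.zero_le t htJ) (by rw [abs_neg]; exact b1 t htJ) (b2 t htJ) l0
      (by rwa [neg_sub_neg, abs_sub_comm]) l2
      (fun x hx => by rw [abs_neg]; exact hB.rem_le _ (hs2 x hx))
      (fun x hx => by rw [abs_neg]; exact hB.rem_le _ (ht2 x hx))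
      (fun x h0 h1 h2 => ?_) (hB.continuousOn_H_neg hs2) (hB.continuousOn_H_neg ht2)
    rw [neg_sub_neg, abs_sub_comm]
    exact lH _ (hs2 x ⟨h0, h1⟩) (ht2 x ⟨h0, h2⟩)

section Chain

variable (hB : CurveBounds C h J Ω d g₁ g₂ H v₁ v₂)
  (hΩ : ∀ s x : ℝ, 0 ≤ s → s ≤ 1 → 0 ≤ s + x → s + x ≤ 1 → (s, x) ∈ Ω)
  (hd : ∀ k s, HasDerivAt (d k) (d (k + 1) s) s)
include hB hΩ

/-- The Lipschitz constant degenerates at the ends of the chain, hence the restriction to an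
interval compactly inside (0, 1). -/
theorem CurveBounds.continuousOn_localFinitePart_chain {α β : ℝ} (hα : 0 < α) (hβ : β < 1) :
    ContinuousOn (fun s => localFinitePart d g₁ g₂ H s s (1 - s)) (Set.Icc α β) := by
  have hC : 0 ≤ C := by linarith [hB.one_le]
  have hK : 0 ≤ 10 * C / (1 - β) ^ 3 + 10 * C / α ^ 3 := by
    have : 0 < 1 - β := by linarith
    positivity
  refine (LipschitzOnWith.of_dist_le_mul (K := ⟨_, hK⟩) fun s hs t ht => ?_).continuousOn
  obtain ⟨s1, s2⟩ := hs
  obtain ⟨t1, t2⟩ := ht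
  rw [Real.dist_eq, Real.dist_eq]
  have key := hB.abs_localFinitePart_sub_le (s := s) (t := t) (X := s) (X' := t) (Y := 1 - s)
    (Y' := 1 - t) (δ := |s - t|) (by linarith) (by linarith) (by linarith) (by linarith)
    (by linarith) (by linarith) (by linarith) (by linarith) le_rfl le_rfl
    (by rw [sub_sub_sub_cancel_left, abs_sub_comm])
    (fun x hx => hΩ _ _ (by linarith) (by linarith) (by linarith [hx.1]) (by linarith [hx.2]))
    (fun x hx => hΩ _ _ (by linarith) (by linarith) (by linarith [hx.1]) (by linarith [hx.2]))
  refine key.trans ?_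
  have hβ' : 0 < 1 - β := by linarith
  have m1 : 1 - β ≤ min (1 - s) (1 - t) := le_min (by linarith) (by linarith)
  have m2 : α ≤ min s t := le_min s1 t1
  calc _ ≤ 10 * C * |s - t| / (1 - β) ^ 3 + 10 * C * |s - t| / α ^ 3 := by gcongr
    _ = (10 * C / (1 - β) ^ 3 + 10 * C / α ^ 3) * |s - t| := by ring

include hd

theorem CurveBounds.hasFinitePart_chain {s : ℝ} (h0 : 0 < s) (h1 : s < 1) :
    HasFinitePart (kernel (d 0) s) 0 1 s (localFinitePart d g₁ g₂ H s s (1 - s)) := by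
  have hc : ∀ k, Continuous (d k) := fun k =>
    continuous_iff_continuousAt.mpr fun s => (hd k s).continuousAt
  have hderiv : deriv (d 0) = d 1 := funext fun s => (hd 0 s).deriv
  refine hasFinitePart_of_tendsto h0 h1 (fun η hη => ?_) 2
    (fun k => if k = 1 then 2 * ‖d 1 s‖⁻¹ else 0) (-2 * g₂ s) ?_
  · refine (continuousAt_kernel (hc 0) (hderiv ▸ hc 1) ?_).continuousWithinAt
    have := hB.ne_of_mem (s := s) (x := η - s) (hΩ _ _ h0.le h1.le (by linarith [hη.1.1])
      (by linarith [hη.1.2])) (sub_ne_zero.mpr hη.2)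
    rwa [add_sub_cancel] at this
  · have := hB.tendsto_integral_kernel (hd 0) (s := s) (X := s) (Y := 1 - s) h0 (by linarith)
      (fun x hx => hΩ _ _ h0.le h1.le (by linarith [hx.1]) (by linarith [hx.2]))
    rwa [sub_self, add_sub_cancel] at this

theorem CurveBounds.nonlocalDensity_chain {s : ℝ} (h0 : 0 < s) (h1 : s < 1) :
    nonlocalDensity (d 0) s = localFinitePart d g₁ g₂ H s s (1 - s) :=
  (hB.hasFinitePart_chain hΩ hd h0 h1).finitePart_eq

theorem CurveBounds.continuousOn_nonlocalDensity_chain {α β : ℝ} (hα : 0 < α) (hβ : β < 1) :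
    ContinuousOn (nonlocalDensity (d 0)) (Set.Icc α β) :=
  (hB.continuousOn_localFinitePart_chain hΩ hα hβ).congr fun s hs =>
    hB.nonlocalDensity_chain hΩ hd (by linarith [hs.1]) (by linarith [hs.2])

theorem CurveBounds.continuumEnergyExists_chain {α β : ℝ} (hα : 0 < α) (hαβ : α ≤ β)
    (hβ : β < 1) : ContinuumEnergyExists (d 0) α β :=
  ⟨fun s hs => ⟨_, hB.hasFinitePart_chain hΩ hd (by linarith [hs.1]) (by linarith [hs.2])⟩,
    (hB.continuousOn_nonlocalDensity_chain hΩ hd hα hβ).intervalIntegrable_of_Icc hαβ⟩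

end Chain

section Ring

variable (hB : CurveBounds C h J Ω d g₁ g₂ H v₁ v₂)
  (hΩ : ∀ s x : ℝ, 0 ≤ s → s ≤ 1 → |x| ≤ 1 / 2 → (s, x) ∈ Ω)
  (hd : ∀ k s, HasDerivAt (d k) (d (k + 1) s) s) (hper : ∀ k s, d k (s + 1) = d k s)
include hB hΩ

theorem CurveBounds.continuousOn_localFinitePart_ring :
    ContinuousOn (fun s => localFinitePart d g₁ g₂ H s (1 / 2) (1 / 2)) (Set.Icc 0 1) := by
  have hC : 0 ≤ C := by linarith [hB.one_le]
  refine (LipschitzOnWith.of_dist_le_mul (K := ⟨160 * C, by positivity⟩)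
    fun s hs t ht => ?_).continuousOn
  rw [Real.dist_eq, Real.dist_eq]
  have key := hB.abs_localFinitePart_sub_le (s := s) (t := t) (X := 1 / 2) (X' := 1 / 2)
    (Y := 1 / 2) (Y' := 1 / 2) (δ := |s - t|) (by norm_num) (by norm_num) (by norm_num)
    (by norm_num) (by norm_num) (by norm_num) (by norm_num) (by norm_num) le_rfl (by simp) (by simp)
    (fun x hx => hΩ _ _ hs.1 hs.2 (abs_le.mpr hx))
    (fun x hx => hΩ _ _ ht.1 ht.2 (abs_le.mpr hx))
  refine key.trans_eq ?_
  rw [min_self]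
  change _ = 160 * C * |s - t|
  ring

include hd hper

/-- Separation is available up to half a period; more distant parameters are first moved by one
period. -/
theorem CurveBounds.ne_ring {s η : ℝ} (h0 : 0 ≤ s) (h1 : s ≤ 1) (hlo : s - 1 < η) (hhi : η < s + 1)
    (hne : η ≠ s) : d 0 s ≠ d 0 η := by
  have key : ∀ x, |x| ≤ 1 / 2 → x ≠ 0 → d 0 s ≠ d 0 (s + x) := fun x hx h =>
    hB.ne_of_mem (hΩ _ _ h0 h1 hx) h
  rcases lt_or_ge η (s - 1 / 2) with h2 | h2
  · rw [← hper 0 η]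
    have := key (η + 1 - s) (abs_le.mpr ⟨by linarith, by linarith⟩) (by linarith)
    rwa [add_sub_cancel] at this
  rcases le_or_gt η (s + 1 / 2) with h3 | h3
  · have := key (η - s) (abs_le.mpr ⟨by linarith, by linarith⟩) (sub_ne_zero.mpr hne)
    rwa [add_sub_cancel] at this
  · have e := hper 0 (η - 1)
    rw [sub_add_cancel] at e
    rw [e]
    have := key (η - 1 - s) (abs_le.mpr ⟨by linarith, by linarith⟩) (by linarith)
    rwa [add_sub_cancel] at this

/-- The expansion lives on [s - 1/2, s + 1/2] and the definition integrates over [0, 1]. The piece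
that sticks out is shifted by one period; for small ε it stays away from the singularity, so the two
punctured integrals agree exactly. -/
theorem CurveBounds.hasFinitePart_ring {s : ℝ} (h0 : 0 < s) (h1 : s < 1) :
    HasFinitePart (kernel (d 0) s) 0 1 s (localFinitePart d g₁ g₂ H s (1 / 2) (1 / 2)) := by
  have hc : ∀ k, Continuous (d k) := fun k =>
    continuous_iff_continuousAt.mpr fun s => (hd k s).continuousAt
  have hderiv : deriv (d 0) = d 1 := funext fun s => (hd 0 s).deriv
  have hcont : ∀ η, s - 1 < η → η < s + 1 → η ≠ s → ContinuousAt (kernel (d 0) s) η :=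
    fun η h2 h3 h4 => continuousAt_kernel (hc 0) (hderiv ▸ hc 1)
      (hB.ne_ring hΩ hd hper h0.le h1.le h2 h3 h4)
  refine hasFinitePart_of_tendsto h0 h1 (fun η hη => (hcont η (by linarith [hη.1.1])
    (by linarith [hη.1.2]) hη.2).continuousWithinAt) 2
    (fun k => if k = 1 then 2 * ‖d 1 s‖⁻¹ else 0) (-2 * g₂ s) ?_
  refine (hB.tendsto_integral_kernel (hd 0) (s := s) (X := 1 / 2) (Y := 1 / 2) (by norm_num)
    (by norm_num) (fun x hx => hΩ _ _ h0.le h1.le (abs_le.mpr hx))).congr' ?_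
  have hlt : ∀ᶠ ε : ℝ in 𝓝[>] 0, ε < min (min s (1 - s)) (1 / 2) :=
    nhdsWithin_le_nhds (Iio_mem_nhds (lt_min (lt_min h0 (by linarith)) (by norm_num)))
  filter_upwards [self_mem_nhdsWithin, hlt] with ε hε hlt
  have hε : 0 < ε := hε
  have e1 := (hlt.trans_le (min_le_left _ _)).trans_le (min_le_left _ _)
  have e2 := (hlt.trans_le (min_le_left _ _)).trans_le (min_le_right _ _)
  have e3 := hlt.trans_le (min_le_right _ _)
  have hI1 : ∀ x y, s - 1 < x → x < s → s - 1 < y → y < s →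
      IntervalIntegrable (kernel (d 0) s) MeasureTheory.volume x y := fun x y hx hx' hy hy' =>
    ContinuousOn.intervalIntegrable fun η hη => by
      have := Set.uIcc_subset_Icc (a₂ := min x y) (b₂ := max x y) ⟨min_le_left _ _, le_max_left _ _⟩
        ⟨min_le_right _ _, le_max_right _ _⟩ hη
      have m1 := lt_of_lt_of_le (lt_min hx hy) this.1
      have m2 := lt_of_le_of_lt this.2 (max_lt hx' hy')
      exact (hcont η m1 (by linarith) m2.ne).continuousWithinAt
  have hI2 : ∀ x y, s < x → x < s + 1 → s < y → y < s + 1 →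
      IntervalIntegrable (kernel (d 0) s) MeasureTheory.volume x y := fun x y hx hx' hy hy' =>
    ContinuousOn.intervalIntegrable fun η hη => by
      have := Set.uIcc_subset_Icc (a₂ := min x y) (b₂ := max x y) ⟨min_le_left _ _, le_max_left _ _⟩
        ⟨min_le_right _ _, le_max_right _ _⟩ hη
      have m1 := lt_of_lt_of_le (lt_min hx hy) this.1
      have m2 := lt_of_le_of_lt this.2 (max_lt hx' hy')
      exact (hcont η (by linarith) m2 m1.ne').continuousWithinAt
  have a1 := intervalIntegral.integral_add_adjacent_intervals
    (hI1 0 (s - 1 / 2) (by linarith) (by linarith) (by linarith) (by linarith))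
    (hI1 (s - 1 / 2) (s - ε) (by linarith) (by linarith) (by linarith) (by linarith))
  have a2 := intervalIntegral.integral_add_adjacent_intervals
    (hI2 (s + ε) (s + 1 / 2) (by linarith) (by linarith) (by linarith) (by linarith))
    (hI2 (s + 1 / 2) 1 (by linarith) (by linarith) (by linarith) (by linarith))
  have a3 : ∫ η in (s + 1 / 2)..1, kernel (d 0) s η = ∫ η in (s - 1 / 2)..0, kernel (d 0) s η := by
    have hk : ∀ η, kernel (d 0) s (η + 1) = kernel (d 0) s η := fun η => by
      simp only [kernel, hderiv, hper]
    have := intervalIntegral.integral_comp_add_right (a := s - 1 / 2) (b := 0) (kernel (d 0) s) 1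
    simp only [hk] at this
    rw [this]
    congr 1 <;> ring
  have a4 := intervalIntegral.integral_symm (μ := MeasureTheory.volume) (f := kernel (d 0) s) 0
    (s - 1 / 2)
  have a5 : (∫ η in (s - 1 / 2)..(s - ε), kernel (d 0) s η)
        + (∫ η in (s + ε)..(s + 1 / 2), kernel (d 0) s η)
      = (∫ η in (0 : ℝ)..(s - ε), kernel (d 0) s η)
        + (∫ η in (s + ε)..1, kernel (d 0) s η) := by linarith
  rw [a5]

theorem CurveBounds.nonlocalDensity_ring {s : ℝ} (h0 : 0 < s) (h1 : s < 1) :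
    nonlocalDensity (d 0) s = localFinitePart d g₁ g₂ H s (1 / 2) (1 / 2) :=
  (hB.hasFinitePart_ring hΩ hd hper h0 h1).finitePart_eq

theorem CurveBounds.continuumEnergyExists_ring : ContinuumEnergyExists (d 0) 0 1 := by
  refine ⟨fun s hs => ⟨_, hB.hasFinitePart_ring hΩ hd hper hs.1 hs.2⟩, ?_⟩
  -- The identification of the density is made for 0 < s < 1 only, which suffices for integrals.
  refine ((hB.continuousOn_localFinitePart_ring hΩ).intervalIntegrable_of_Icc
    zero_le_one).congr_uIoo fun s hs => ?_
  rw [Set.uIoo_of_le zero_le_one] at hs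
  exact (hB.nonlocalDensity_ring hΩ hd hper hs.1 hs.2).symm

theorem CurveBounds.integral_nonlocalDensity_ring : ∫ s in (0 : ℝ)..1, nonlocalDensity (d 0) s
    = ∫ s in (0 : ℝ)..1, localFinitePart d g₁ g₂ H s (1 / 2) (1 / 2) := by
  refine intervalIntegral.integral_congr_uIoo fun s hs => ?_
  rw [Set.uIoo_of_le zero_le_one] at hs
  exact hB.nonlocalDensity_ring hΩ hd hper hs.1 hs.2

end Ring

end FiniteParts

/-! ### From sums over magnets to integrals along the curve. -/

section ContinuumLimit

variable {C h : ℝ} {J : Set ℝ} {Ω : Set (ℝ × ℝ)} {d : ℕ → ℝ → E3} {g₁ g₂ : ℝ → ℝ}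
  {H : ℝ × ℝ → ℝ} {v₁ : ℝ → E3} {v₂ : ℝ × ℝ → E3} {n : ℕ} {lam K : ℝ} {μ : ℤ → E3}

theorem continuumEnergy_eq (hd : ∀ k s, HasDerivAt (d k) (d (k + 1) s) s) (x y : ℝ) :
    continuumEnergy (d 0) x y = zetaThree / 4 * (∫ s in x..y, ‖d 2 s‖ ^ 2)
      - 1 / 2 * ∫ s in x..y, nonlocalDensity (d 0) s := by
  have h1 : deriv (d 0) = d 1 := funext fun s => (hd 0 s).deriv
  have h2 : deriv (d 1) = d 2 := funext fun s => (hd 1 s).deriv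
  rw [continuumEnergy, iteratedDeriv_succ, iteratedDeriv_one, h1, h2,
    intervalIntegral.integral_div]
  ring

theorem CurveBounds.abs_sum_curvature_sub_integral_le
    (hB : CurveBounds C h J Ω d g₁ g₂ H v₁ v₂) (hc : Continuous (d 2)) {α : ℝ} {q : ℕ}
    (hJ : ∀ s ∈ Set.Icc α (α + q * h), s ∈ J) (hq : q * h ≤ 1) :
    |h * ∑ k ∈ Finset.range q, ‖d 2 (α + k * h)‖ ^ 2 - ∫ s in α..(α + q * h), ‖d 2 s‖ ^ 2|
      ≤ C * h := by
  have h0 := hB.h_pos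
  have hC : 0 ≤ C := by linarith [hB.one_le]
  refine (abs_riemannSum_sub_integral_le (f := fun s => ‖d 2 s‖ ^ 2)
    (t := fun k : ℕ => ‖d 2 (α + k * h)‖ ^ 2) (e := fun _ => C * h) h0 q
    (fun k _ => (by fun_prop : Continuous fun s => ‖d 2 s‖ ^ 2).continuousOn)
    fun k hk x hx => ?_).trans ?_
  · have hkq : (k : ℝ) + 1 ≤ q := by exact_mod_cast hk
    have hk0 : (0 : ℝ) ≤ k := by positivity
    refine (hB.curv_lip _ (hJ _ ⟨by nlinarith, by nlinarith⟩) _ (hJ _ ⟨by nlinarith [hx.1],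
      by nlinarith [hx.2]⟩)).trans ?_
    gcongr
    exact abs_le.mpr ⟨by linarith [hx.2], by linarith [hx.1]⟩
  · rw [Finset.sum_const, nsmul_eq_mul, Finset.card_range]
    calc h * (q * (C * h)) = (q * h) * (C * h) := by ring
      _ ≤ 1 * (C * h) := by gcongr
      _ = _ := one_mul _

section Chain

variable (hB : CurveBounds C h J Ω d g₁ g₂ H v₁ v₂)
  (hn : (n : ℝ) * h = 1) (hΩ : ∀ s x : ℝ, 0 ≤ s → s ≤ 1 → 0 ≤ s + x → s + x ≤ 1 → (s, x) ∈ Ω)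
  (hd : ∀ k s, HasDerivAt (d k) (d (k + 1) s) s)
include hB hn hΩ hd

/-- On the cell of magnet i the finite part varies by about h/(ih)³ + h/((n - i - 1)h)³;
multiplication by h² makes this i⁻³ + (n - i - 1)⁻³, which is summable. -/
theorem CurveBounds.abs_sum_localFinitePart_chain_le {a b : ℕ} (ha : 0 < a) (hab : a ≤ b)
    (hb : b < n) :
    |h ^ 2 * ∑ i ∈ Finset.Icc a b, localFinitePart d g₁ g₂ H (i * h) (i * h) (1 - i * h)
      - h * ∫ s in (a * h)..(b * h), nonlocalDensity (d 0) s|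
      ≤ 24 * C * (1 / (a : ℝ) ^ 2 + 1 / ((n : ℝ) - b) ^ 2) := by
  have h0 := hB.h_pos
  have hC : 0 ≤ C := by linarith [hB.one_le]
  obtain ⟨q, rfl⟩ := Nat.exists_eq_add_of_le hab
  have ha1 : (1 : ℝ) ≤ a := by exact_mod_cast ha
  have hbn : (a : ℝ) + q + 1 ≤ n := by exact_mod_cast hb
  have hq0 : (0 : ℝ) ≤ q := by positivity
  push_cast
  have hR := abs_riemannSum_sub_integral_le (f := nonlocalDensity (d 0)) (a := a * h) (h := h)
    (t := fun k : ℕ => localFinitePart d g₁ g₂ H ((a + k : ℕ) * h) ((a + k : ℕ) * h)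
      (1 - (a + k : ℕ) * h))
    -- A point of the cell may be as far right as a + k + 1, so the distance to the right end is
    -- counted from there and the one to the left end from a + k.
    (e := fun k : ℕ => 10 * C * h / (((n : ℝ) - (a + k + 1 : ℕ)) * h) ^ 3
      + 10 * C * h / ((a + k : ℕ) * h) ^ 3) h0 q
    (fun k hk => by
      have hkq : (k : ℝ) + 1 ≤ q := by exact_mod_cast hk
      have hk0 : (0 : ℝ) ≤ k := by positivity
      exact hB.continuousOn_nonlocalDensity_chain hΩ hd (by positivity) (by nlinarith))
    (fun k hk x hx => by
      have hkq : (k : ℝ) + 1 ≤ q := by exact_mod_cast hk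
      have hk0 : (0 : ℝ) ≤ k := by positivity
      have hx1 : ((a + k : ℕ) : ℝ) * h ≤ x := by push_cast; linarith [hx.1]
      have hx2 : x ≤ ((a + k : ℕ) : ℝ) * h + h := by push_cast; linarith [hx.2]
      have hs0 : 0 < ((a + k : ℕ) : ℝ) * h := by push_cast; positivity
      have hsn : (((a + k : ℕ) : ℝ) + 1) * h < n * h := by
        push_cast; exact mul_lt_mul_of_pos_right (by linarith) h0
      rw [hn, add_mul, one_mul] at hsn
      have e1 : ((n : ℝ) - (a + k + 1 : ℕ)) * h = 1 - ((a + k : ℕ) : ℝ) * h - h := by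
        push_cast; rw [sub_mul, hn]; ring
      rw [hB.nonlocalDensity_chain hΩ hd (by linarith) (by linarith), e1]
      generalize ((a + k : ℕ) : ℝ) * h = s at *
      have key := hB.abs_localFinitePart_sub_le (s := s) (t := x) (X := s) (X' := x) (Y := 1 - s)
        (Y' := 1 - x) (δ := h) (by linarith) (by linarith) (by linarith) (by linarith)
        (by linarith) (by linarith) (by linarith) (by linarith)
        (abs_le.mpr ⟨by linarith, by linarith⟩) (abs_le.mpr ⟨by linarith, by linarith⟩)
        (abs_le.mpr ⟨by linarith, by linarith⟩)
        (fun y hy => hΩ _ _ (by linarith) (by linarith) (by linarith [hy.1]) (by linarith [hy.2]))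
        (fun y hy => hΩ _ _ (by linarith) (by linarith) (by linarith [hy.1]) (by linarith [hy.2]))
      refine key.trans ?_
      have m1 : 1 - s - h ≤ min (1 - s) (1 - x) := le_min (by linarith) (by linarith)
      have m2 : s ≤ min s x := le_min le_rfl hx1
      have m3 : 0 < 1 - s - h := by linarith
      gcongr)
  have hE : h * (h * ∑ k ∈ Finset.range q, (10 * C * h / (((n : ℝ) - (a + k + 1 : ℕ)) * h) ^ 3
      + 10 * C * h / ((a + k : ℕ) * h) ^ 3))
      ≤ 20 * C * (1 / (a : ℝ) ^ 2 + 1 / ((n : ℝ) - (a + q : ℕ)) ^ 2) := by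
    have e : ∀ k : ℕ, h ^ 2 * (10 * C * h / (((n : ℝ) - (a + k + 1 : ℕ)) * h) ^ 3
        + 10 * C * h / ((a + k : ℕ) * h) ^ 3)
        = 10 * C * (1 / ((n : ℝ) - ((a + k) + 1 : ℕ)) ^ 3 + 1 / ((a + k : ℕ) : ℝ) ^ 3) := fun k => by
      rw [mul_pow, mul_pow]
      rw [mul_add, mul_add, ← mul_div_assoc, ← mul_div_assoc]
      congr 1 <;> rw [mul_one_div] <;> rw [show h ^ 2 * (10 * C * h) = 10 * C * h ^ 3 by ring,
        mul_div_mul_right _ _ (by positivity)]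
    rw [← mul_assoc, ← pow_two, Finset.mul_sum, Finset.sum_congr rfl fun k _ => e k,
      ← Finset.mul_sum, Finset.sum_add_distrib]
    have s1 : ∑ k ∈ Finset.range q, 1 / ((a + k : ℕ) : ℝ) ^ 3 ≤ 2 / (a : ℝ) ^ 2 := by
      refine le_trans ?_ (sum_Icc_inv_cube_le (b := a + q) ha)
      have := Finset.sum_Ico_eq_sum_range (fun i : ℕ => 1 / (i : ℝ) ^ 3) a (a + q)
      rw [add_tsub_cancel_left] at this
      rw [← this]
      exact Finset.sum_le_sum_of_subset_of_nonneg (fun x hx => by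
        rw [Finset.mem_Ico] at hx; rw [Finset.mem_Icc]; omega) fun _ _ _ => by positivity
    have s2 : ∑ k ∈ Finset.range q, 1 / ((n : ℝ) - ((a + k) + 1 : ℕ)) ^ 3
        ≤ 2 / ((n : ℝ) - (a + q : ℕ)) ^ 2 := by
      refine le_trans ?_ (sum_Icc_inv_cube_reflect_le (a := a + 1) hb)
      have := Finset.sum_Ico_eq_sum_range (fun i : ℕ => 1 / ((n : ℝ) - i) ^ 3) (a + 1) (a + 1 + q)
      rw [add_tsub_cancel_left] at this
      have e2 : ∀ k, (a + k) + 1 = (a + 1) + k := fun k => by ring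
      simp only [e2]
      rw [← this]
      refine Finset.sum_le_sum_of_subset_of_nonneg (fun x hx => by
        rw [Finset.mem_Ico] at hx; rw [Finset.mem_Icc]; omega) fun i hi _ => ?_
      rw [Finset.mem_Icc] at hi
      have : (i : ℝ) ≤ n := by exact_mod_cast (by omega : i ≤ n)
      have : 0 ≤ (n : ℝ) - i := by linarith
      positivity
    calc _ ≤ 10 * C * (2 / ((n : ℝ) - (a + q : ℕ)) ^ 2 + 2 / (a : ℝ) ^ 2) := by gcongr
      _ = _ := by ring
  -- There is one magnet more than there are cells; the last one is within the admitted error.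
  have hlast : h ^ 2 * |localFinitePart d g₁ g₂ H ((a + q : ℕ) * h) ((a + q : ℕ) * h)
      (1 - (a + q : ℕ) * h)| ≤ 4 * C * (1 / (a : ℝ) ^ 2 + 1 / ((n : ℝ) - (a + q : ℕ)) ^ 2) := by
    have hY : 1 - ((a + q : ℕ) : ℝ) * h = (n - (a + q : ℕ)) * h := by rw [sub_mul, hn]
    have hX0 : 0 < ((a + q : ℕ) : ℝ) * h := by push_cast; positivity
    have hY0 : 0 < ((n : ℝ) - (a + q : ℕ)) * h := by
      push_cast; exact mul_pos (by linarith) h0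
    have hbd := hB.abs_half_localFinitePart_le (s := (a + q : ℕ) * h) (X := (a + q : ℕ) * h)
      (Y := (n - (a + q : ℕ)) * h) hX0 (by linarith) hY0 (by linarith)
      (fun y hy => hΩ _ _ (by linarith) (by linarith) (by linarith [hy.1]) (by linarith [hy.2]))
    rw [hY]
    have hn0 : (n : ℝ) - (a + q : ℕ) ≠ 0 := fun h => by rw [h, zero_mul] at hY0; linarith
    have haq : ((a + q : ℕ) : ℝ) ≠ 0 := fun h => by rw [h, zero_mul] at hX0; linarith
    calc _ ≤ h ^ 2 * (4 * C / ((n - (a + q : ℕ)) * h) ^ 2 + 4 * C / ((a + q : ℕ) * h) ^ 2) := by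
          gcongr
      _ = 4 * C * (1 / ((a + q : ℕ) : ℝ) ^ 2 + 1 / ((n : ℝ) - (a + q : ℕ)) ^ 2) := by
          field_simp
          ring
      _ ≤ _ := by
          gcongr
  have hsplit : ∑ i ∈ Finset.Icc a (a + q), localFinitePart d g₁ g₂ H (i * h) (i * h) (1 - i * h)
      = ∑ k ∈ Finset.range q, localFinitePart d g₁ g₂ H ((a + k : ℕ) * h) ((a + k : ℕ) * h)
          (1 - (a + k : ℕ) * h)
        + localFinitePart d g₁ g₂ H ((a + q : ℕ) * h) ((a + q : ℕ) * h)
          (1 - (a + q : ℕ) * h) := by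
    rw [← Finset.sum_range_succ (fun k : ℕ => localFinitePart d g₁ g₂ H ((a + k : ℕ) * h)
      ((a + k : ℕ) * h) (1 - (a + k : ℕ) * h)), ← Finset.Ico_add_one_right_eq_Icc,
      Finset.sum_Ico_eq_sum_range]
    congr 2
    omega
  rw [hsplit]
  have hend : (a : ℝ) * h + q * h = (a + q) * h := by ring
  rw [hend] at hR
  push_cast at hE hlast hR ⊢
  set T := ∑ k ∈ Finset.range q, localFinitePart d g₁ g₂ H (((a : ℝ) + k) * h) (((a : ℝ) + k) * h)
          (1 - ((a : ℝ) + k) * h)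
  set L := localFinitePart d g₁ g₂ H (((a : ℝ) + q) * h) (((a : ℝ) + q) * h)
      (1 - ((a : ℝ) + q) * h)
  set I := ∫ x in (a * h)..((a + q) * h), nonlocalDensity (d 0) x
  have e : h ^ 2 * (T + L) - h * I = h * (h * T - I) + h ^ 2 * L := by ring
  rw [e]
  refine (abs_add_le _ _).trans ?_
  rw [abs_mul, abs_mul, abs_of_pos h0, abs_of_nonneg (sq_nonneg h)]
  have := mul_le_mul_of_nonneg_left hR h0.le
  linarith

/-- The b - a + 1 magnets contribute -2ζ(3) each, whereas the integral covers b - a cells; this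
accounts for the separate -2ζ(3). -/
theorem CurveBounds.abs_chain_energy_sub_le
    (hlam : ∑ k ∈ Finset.range n, 1 / ((k : ℝ) + 1) ≤ lam) (hlam1 : 1 ≤ lam)
    (hlam3 : h * lam ^ 3 ≤ 1) (hK : 0 ≤ K)
    (hμ1 : ∀ i : ℤ, 0 ≤ i → i ≤ n → ‖μ i‖ = 1)
    (hμ : ∀ i : ℤ, 0 ≤ i → i ≤ n → ‖μ i - gridTangent h d i‖ ≤ K * h ^ 2 * lam)
    {a b : ℕ} (ha : 0 < a) (hab : a ≤ b) (hb : b < n) :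
    |-(1 / 2) * ∑ i ∈ Finset.Icc a b, ∑ j ∈ Finset.Icc 0 n,
        pairTerm h (gridPos h d) μ μ (i : ℤ) (j : ℤ)
      - (-2 * zetaThree * ((b : ℝ) - a) - 2 * zetaThree
        + h * continuumEnergy (d 0) (a * h) (b * h))|
      ≤ 300 * C ^ 5 * (1 + K) ^ 2 * (1 / (a : ℝ) ^ 2 + 1 / ((n : ℝ) - b) ^ 2) := by
  have h0 := hB.h_pos
  have hC1 := hB.one_le
  have c1 := hB.abs_chain_sum_sub_le hn hΩ hlam hlam1 hlam3 hK hμ1 hμ ha hab hb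
  have c2 := hB.abs_sum_localFinitePart_chain_le hn hΩ hd ha hab hb
  rw [continuumEnergy_eq hd]
  rw [Finset.sum_add_distrib, Finset.sum_sub_distrib, Finset.sum_const, Nat.card_Icc, nsmul_eq_mul,
    Nat.cast_sub (by omega), ← Finset.mul_sum, ← Finset.mul_sum] at c1
  push_cast at c1
  have ha0 : (0 : ℝ) < a := by exact_mod_cast ha
  have hha : h ^ 2 ≤ 1 / (a : ℝ) ^ 2 := by
    rw [le_div_iff₀ (by positivity), ← mul_pow]
    have : (a : ℝ) ≤ n := by exact_mod_cast (by omega : a ≤ n)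
    exact pow_le_one₀ (by positivity) (by nlinarith)
  have hfin : 0 ≤ 1 / ((n : ℝ) - b) ^ 2 := by positivity
  have c3 : |h ^ 2 * ∑ i ∈ Finset.Icc a b, ‖d 2 (i * h)‖ ^ 2
      - h * ∫ s in (a * h)..(b * h), ‖d 2 s‖ ^ 2| ≤ 2 * C * h ^ 2 := by
    obtain ⟨q, rfl⟩ := Nat.exists_eq_add_of_le hab
    have hbn : (a : ℝ) + q + 1 ≤ n := by exact_mod_cast hb
    have hJ : ∀ s, 0 ≤ s → s ≤ 1 → s ∈ J := fun s h0 h1 =>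
      hB.dom.fst_mem _ (hΩ s 0 h0 h1 (by linarith) (by linarith))
    have key := hB.abs_sum_curvature_sub_integral_le
      (continuous_iff_continuousAt.mpr fun s => (hd 2 s).continuousAt) (α := a * h) (q := q)
      (fun s hs => hJ s (by nlinarith [hs.1]) (by nlinarith [hs.2])) (by nlinarith)
    have hk := hB.curv_le ((a + q : ℕ) * h) (hJ _ (by positivity) (by push_cast; nlinarith))
    have hsplit : ∑ i ∈ Finset.Icc a (a + q), ‖d 2 (i * h)‖ ^ 2
        = ∑ k ∈ Finset.range q, ‖d 2 (a * h + k * h)‖ ^ 2 + ‖d 2 ((a + q : ℕ) * h)‖ ^ 2 := by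
      have e : ∀ k : ℕ, (a : ℝ) * h + k * h = (a + k : ℕ) * h := fun k => by push_cast; ring
      simp only [e]
      rw [← Finset.sum_range_succ (fun k : ℕ => ‖d 2 ((a + k : ℕ) * h)‖ ^ 2),
        ← Finset.Ico_add_one_right_eq_Icc, Finset.sum_Ico_eq_sum_range]
      congr 2
      omega
    rw [hsplit]
    have hend : ((a + q : ℕ) : ℝ) * h = a * h + q * h := by push_cast; ring
    rw [hend] at hk ⊢
    set T := ∑ k ∈ Finset.range q, ‖d 2 (a * h + k * h)‖ ^ 2
    set I := ∫ s in (a * h)..(a * h + q * h), ‖d 2 s‖ ^ 2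
    have e : h ^ 2 * (T + ‖d 2 (a * h + q * h)‖ ^ 2) - h * I
        = h * (h * T - I) + h ^ 2 * ‖d 2 (a * h + q * h)‖ ^ 2 := by ring
    rw [e]
    refine (abs_add_le _ _).trans ?_
    rw [abs_mul, abs_mul, abs_of_pos h0, abs_of_nonneg (sq_nonneg h),
      abs_of_nonneg (sq_nonneg ‖d 2 (a * h + q * h)‖)]
    calc _ ≤ h * (C * h) + h ^ 2 * C := by gcongr
      _ = _ := by ring
  set P := ∑ i ∈ Finset.Icc a b, ∑ j ∈ Finset.Icc 0 n,
    pairTerm h (gridPos h d) μ μ (i : ℤ) (j : ℤ)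
  set F := ∑ i ∈ Finset.Icc a b, localFinitePart d g₁ g₂ H (i * h) (i * h) (1 - i * h)
  set Q := ∑ i ∈ Finset.Icc a b, ‖d 2 (i * h)‖ ^ 2
  set I₁ := ∫ s in (a * h)..(b * h), ‖d 2 s‖ ^ 2
  set I₂ := ∫ s in (a * h)..(b * h), nonlocalDensity (d 0) s
  set X := 1 / (a : ℝ) ^ 2 + 1 / ((n : ℝ) - b) ^ 2
  have hX : h ^ 2 ≤ X := by simp only [X]; linarith
  have hX0 : 0 ≤ X := (sq_nonneg h).trans hX
  have e : -(1 / 2) * P - (-2 * zetaThree * ((b : ℝ) - a) - 2 * zetaThree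
        + h * (zetaThree / 4 * I₁ - 1 / 2 * I₂))
      = -(1 / 2) * (P - (((b : ℝ) + 1 - a) * (4 * zetaThree) - zetaThree / 2 * h ^ 2 * Q
          + h ^ 2 * F)) + zetaThree / 4 * (h ^ 2 * Q - h * I₁) + -(1 / 2) * (h ^ 2 * F - h * I₂) := by
    ring
  rw [e]
  have hz : |zetaThree / 4 * (h ^ 2 * Q - h * I₁)| ≤ C * X := by
    rw [abs_mul, abs_of_nonneg (by linarith [zetaThree_nonneg])]
    calc _ ≤ (1 / 2) * (2 * C * h ^ 2) :=
          mul_le_mul (by linarith [zetaThree_le_two]) c3 (abs_nonneg _) (by norm_num)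
      _ = C * h ^ 2 := by ring
      _ ≤ _ := by gcongr
  refine (abs_add_le _ _).trans ?_
  have t1 := abs_add_le (-(1 / 2) * (P - (((b : ℝ) + 1 - a) * (4 * zetaThree)
    - zetaThree / 2 * h ^ 2 * Q + h ^ 2 * F))) (zetaThree / 4 * (h ^ 2 * Q - h * I₁))
  have hhalf : |(-(1 / 2) : ℝ)| = 1 / 2 := by norm_num
  rw [abs_mul (-(1 / 2)), hhalf] at t1 ⊢
  have hCX0 : 0 ≤ C * X := by positivity
  have hCX : C * X ≤ C ^ 5 * (1 + K) ^ 2 * X := by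
    gcongr
    calc C ≤ C ^ 5 := le_self_pow₀ hC1 (by norm_num)
      _ = C ^ 5 * 1 := (mul_one _).symm
      _ ≤ _ := by gcongr; exact one_le_pow₀ (by linarith)
  linarith

end Chain

section Ring

variable (hB : CurveBounds C h J Ω d g₁ g₂ H v₁ v₂)
  (hn : (n : ℝ) * h = 1) (hΩ : ∀ s x : ℝ, 0 ≤ s → s ≤ 1 → |x| ≤ 1 / 2 → (s, x) ∈ Ω)
include hB hn hΩ

/-- The window lengths ((n - 1)/2)h and (n/2)h lie in [1/4, 1/2] and differ from 1/2 by at most h,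
so moving both to 1/2 costs no more than moving s within a cell. -/
theorem CurveBounds.abs_sum_localFinitePart_ring_le (hn3 : 3 ≤ n) :
    |h * ∑ i ∈ Finset.range n, localFinitePart d g₁ g₂ H (i * h) (((n - 1) / 2 : ℕ) * h)
        ((n / 2 : ℕ) * h)
      - ∫ s in (0 : ℝ)..1, localFinitePart d g₁ g₂ H s (1 / 2) (1 / 2)| ≤ 1280 * C * h := by
  have h0 := hB.h_pos
  have hC : 0 ≤ C := by linarith [hB.one_le]
  have hcast : ∀ m : ℕ, n ≤ 4 * m → 2 * m ≤ n → n ≤ 2 * m + 2 →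
      1 / 4 ≤ m * h ∧ m * h ≤ 1 / 2 ∧ 1 / 2 - h ≤ m * h := fun m h1 h2 h3 => by
    have h1' : (n : ℝ) ≤ 4 * m := by exact_mod_cast h1
    have h2' : (2 : ℝ) * m ≤ n := by exact_mod_cast h2
    have h3' : (n : ℝ) ≤ 2 * m + 2 := by exact_mod_cast h3
    exact ⟨by nlinarith, by nlinarith, by nlinarith⟩
  obtain ⟨p1, p2, p3⟩ := hcast ((n - 1) / 2) (by omega) (by omega) (by omega)
  obtain ⟨q1, q2, q3⟩ := hcast (n / 2) (by omega) (by omega) (by omega)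
  generalize (((n - 1) / 2 : ℕ) : ℝ) * h = X at *
  generalize ((n / 2 : ℕ) : ℝ) * h = Y at *
  have key := abs_riemannSum_sub_integral_le (a := 0) (h := h)
    (f := fun s => localFinitePart d g₁ g₂ H s (1 / 2) (1 / 2))
    (t := fun k : ℕ => localFinitePart d g₁ g₂ H (k * h) X Y) (e := fun _ => 1280 * C * h) h0 n
    (fun k hk => (hB.continuousOn_localFinitePart_ring hΩ).mono fun x hx => by
      have hk' : (k : ℝ) + 1 ≤ n := by exact_mod_cast hk
      have hk0 : (0 : ℝ) ≤ k := by positivity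
      exact ⟨by nlinarith [hx.1], by nlinarith [hx.2]⟩)
    fun k hk x hx => by
      have hk' : (k : ℝ) + 1 ≤ n := by exact_mod_cast hk
      have hk0 : (0 : ℝ) ≤ k := by positivity
      have hx0 : 0 ≤ x := by nlinarith [hx.1]
      have hx1 : x ≤ 1 := by nlinarith [hx.2]
      have b := hB.abs_localFinitePart_sub_le (s := k * h) (t := x) (X := X) (X' := 1 / 2) (Y := Y)
        (Y' := 1 / 2) (δ := h) (by linarith) (by linarith) (by norm_num) (by norm_num)
        (by linarith) (by linarith) (by norm_num) (by norm_num)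
        (abs_le.mpr ⟨by linarith [hx.2], by linarith [hx.1]⟩)
        (abs_le.mpr ⟨by linarith, by linarith⟩) (abs_le.mpr ⟨by linarith, by linarith⟩)
        (fun y hy => hΩ _ _ (by positivity) (by nlinarith)
          (abs_le.mpr ⟨by linarith [hy.1], by linarith [hy.2]⟩))
        (fun y hy => hΩ _ _ hx0 hx1 (abs_le.mpr hy))
      refine b.trans ?_
      have m1 : 1 / 4 ≤ min Y (1 / 2) := le_min q1 (by norm_num)
      have m2 : 1 / 4 ≤ min X (1 / 2) := le_min p1 (by norm_num)
      calc _ ≤ 10 * C * h / (1 / 4) ^ 3 + 10 * C * h / (1 / 4) ^ 3 := by gcongr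
        _ = _ := by ring
  rw [zero_add, hn, Finset.sum_const, nsmul_eq_mul, Finset.card_range] at key
  refine key.trans_eq ?_
  calc h * (n * (1280 * C * h)) = (n * h) * (1280 * C * h) := by ring
    _ = _ := by rw [hn, one_mul]

theorem CurveBounds.abs_ring_energy_sub_le
    (hd : ∀ k s, HasDerivAt (d k) (d (k + 1) s) s) (hper : ∀ k s, d k (s + 1) = d k s)
    (hlam : ∑ k ∈ Finset.range n, 1 / ((k : ℝ) + 1) ≤ lam) (hlam1 : 1 ≤ lam)
    (hlam3 : h * lam ^ 3 ≤ 1) (hK : 0 ≤ K) (hμper : ∀ i, μ (i + n) = μ i)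
    (hμ1 : ∀ i : ℤ, ‖μ i‖ = 1)
    (hμ : ∀ i : ℤ, ‖μ i - gridTangent h d i‖ ≤ K * h ^ 2 * lam) (hn3 : 3 ≤ n) :
    |-(1 / 2) * ∑ i ∈ Finset.range n, ∑ j ∈ Finset.range n,
        pairTerm h (gridPos h d) μ μ (i : ℤ) (j : ℤ)
      - (-2 * zetaThree * (n : ℝ) + h * continuumEnergy (d 0) 0 1)|
      ≤ 5000 * C ^ 5 * (1 + K) ^ 2 * h ^ 2 := by
  have h0 := hB.h_pos
  have hC1 := hB.one_le
  have c1 := hB.abs_ring_sum_sub_le hn hΩ hper hlam hlam1 hlam3 hK hμper hμ1 hμ hn3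
  have c2 := hB.abs_sum_localFinitePart_ring_le hn hΩ hn3
  rw [continuumEnergy_eq hd, hB.integral_nonlocalDensity_ring hΩ hd hper]
  rw [Finset.sum_add_distrib, Finset.sum_sub_distrib, Finset.sum_const, Finset.card_range,
    nsmul_eq_mul, ← Finset.mul_sum, ← Finset.mul_sum] at c1
  have c3 := hB.abs_sum_curvature_sub_integral_le
      (continuous_iff_continuousAt.mpr fun s => (hd 2 s).continuousAt) (α := 0) (q := n)
      (fun s hs => hB.dom.fst_mem _ (hΩ s 0 hs.1 (by linarith [hs.2]) (by norm_num))) hn.le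
  simp only [zero_add, hn] at c3
  set P := ∑ i ∈ Finset.range n, ∑ j ∈ Finset.range n,
    pairTerm h (gridPos h d) μ μ (i : ℤ) (j : ℤ)
  set F := ∑ i ∈ Finset.range n, localFinitePart d g₁ g₂ H (i * h) (((n - 1) / 2 : ℕ) * h)
        ((n / 2 : ℕ) * h)
  set Q := ∑ i ∈ Finset.range n, ‖d 2 (i * h)‖ ^ 2
  set I₁ := ∫ s in (0 : ℝ)..1, ‖d 2 s‖ ^ 2
  set I₂ := ∫ s in (0 : ℝ)..1, localFinitePart d g₁ g₂ H s (1 / 2) (1 / 2)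
  have e : -(1 / 2) * P - (-2 * zetaThree * (n : ℝ) + h * (zetaThree / 4 * I₁ - 1 / 2 * I₂))
      = -(1 / 2) * (P - ((n : ℝ) * (4 * zetaThree) - zetaThree / 2 * h ^ 2 * Q
          + h ^ 2 * F)) + zetaThree / 4 * h * (h * Q - I₁) + -(1 / 2) * h * (h * F - I₂) := by
    ring
  rw [e]
  have hz : |zetaThree / 4 * h * (h * Q - I₁)| ≤ C * h ^ 2 := by
    rw [abs_mul, abs_of_nonneg (mul_nonneg (by linarith [zetaThree_nonneg]) h0.le)]
    calc _ ≤ (1 * h) * (C * h) := by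
          gcongr
          linarith [zetaThree_le_two]
      _ = C * h ^ 2 := by ring
  have hf : |-(1 / 2) * h * (h * F - I₂)| ≤ 640 * C * h ^ 2 := by
    rw [abs_mul, abs_mul, abs_of_pos h0]
    have hhalf : |(-(1 / 2) : ℝ)| = 1 / 2 := by norm_num
    rw [hhalf]
    calc _ ≤ 1 / 2 * h * (1280 * C * h) := by gcongr
      _ = _ := by ring
  refine (abs_add_le _ _).trans ?_
  have t1 := abs_add_le (-(1 / 2) * (P - ((n : ℝ) * (4 * zetaThree)
    - zetaThree / 2 * h ^ 2 * Q + h ^ 2 * F))) (zetaThree / 4 * h * (h * Q - I₁))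
  have hhalf : |(-(1 / 2) : ℝ)| = 1 / 2 := by norm_num
  rw [abs_mul (-(1 / 2)), hhalf] at t1
  have hCX0 : 0 ≤ C * h ^ 2 := by positivity
  have hCX : C * h ^ 2 ≤ C ^ 5 * (1 + K) ^ 2 * h ^ 2 := by
    gcongr
    calc C ≤ C ^ 5 := le_self_pow₀ hC1 (by norm_num)
      _ = C ^ 5 * 1 := (mul_one _).symm
      _ ≤ _ := by gcongr; exact one_le_pow₀ (by linarith)
  linarith

end Ring

end ContinuumLimit

/-! ### Uniform constants for families, and the logarithm. -/

section Families

theorem hasDerivAt_iteratedDeriv {f : ℝ → E3} (hf : ContDiff ℝ ∞ f) (k : ℕ) (s : ℝ) :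
    HasDerivAt (iteratedDeriv k f) (iteratedDeriv (k + 1) f s) s := by
  rw [iteratedDeriv_succ]
  exact (hf.differentiable_iteratedDeriv k (by exact_mod_cast ENat.natCast_lt_top k) s).hasDerivAt

theorem iteratedDeriv_add_one {f : ℝ → E3} (hf : Function.Periodic f 1) (k : ℕ) (s : ℝ) :
    iteratedDeriv k f (s + 1) = iteratedDeriv k f s := by
  have h := iteratedDeriv_comp_add_const k f 1
  rw [show (fun z => f (z + 1)) = f from funext hf] at h
  exact (congrFun h s).symm

/-- Beyond some N all hypotheses hold simultaneously; the curves with n ≥ N form a single family,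
and its uniform constant is the required one. -/
theorem exists_curveBounds_eventually {r : ℕ → ℝ → E3} {J : Set ℝ} {Ω : Set (ℝ × ℝ)}
    (dom : IsIncrDomain J Ω) (A B : ℕ → ℤ) {M c : ℝ} (hc : 0 < c)
    (hJ : ∀ᶠ n : ℕ in atTop, J = Set.Icc (A n * (1 / (n : ℝ))) (B n * (1 / (n : ℝ))))
    (hAB : ∀ᶠ n in atTop, A n + 5 ≤ B n)
    (smooth : ∀ᶠ n in atTop, ContDiff ℝ ∞ (r n))
    (bdd : ∀ᶠ n in atTop, ∀ k, 1 ≤ k → k ≤ 6 → ∀ s ∈ J, ‖iteratedDeriv k (r n) s‖ ≤ M)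
    (spacing : ∀ᶠ n : ℕ in atTop, ∀ j : ℤ, A n ≤ j → j < B n →
      ‖r n ((j + 1) * (1 / (n : ℝ))) - r n (j * (1 / (n : ℝ)))‖ = 1 / n)
    (sep : ∀ᶠ n in atTop, ∀ p ∈ Ω, c * |p.2| ≤ ‖r n (p.1 + p.2) - r n p.1‖) :
    ∃ C : ℝ, ∀ᶠ n : ℕ in atTop, ∃ g₁ g₂ H v₁ v₂,
      CurveBounds C (1 / (n : ℝ)) J Ω (fun k => iteratedDeriv k (r n)) g₁ g₂ H v₁ v₂ := by
  -- This makes 10000 M² h ≤ 1/2, which keeps ‖r'‖² above 1/2.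
  have hlarge : ∀ᶠ n : ℕ in atTop, 20000 * M ^ 2 + 1 ≤ (n : ℝ) :=
    tendsto_natCast_atTop_atTop.eventually_ge_atTop _
  obtain ⟨N, hN⟩ := eventually_atTop.mp
    (hJ.and (hAB.and (smooth.and (bdd.and (spacing.and (sep.and hlarge))))))
  let ι := {n : ℕ // N ≤ n}
  have hpos : ∀ i : ι, (0 : ℝ) < (i.1 : ℕ) := fun i => by
    have := (hN i.1 i.2).2.2.2.2.2.2
    have := sq_nonneg M
    linarith
  have hh : ∀ i : ι, 0 < 1 / ((i.1 : ℕ) : ℝ) := fun i => one_div_pos.mpr (hpos i)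
  have hh1 : ∀ i : ι, 1 / ((i.1 : ℕ) : ℝ) ≤ 1 := fun i => by
    rw [div_le_one (hpos i)]
    have := (hN i.1 i.2).2.2.2.2.2.2
    have := sq_nonneg M
    linarith
  have hsmall : ∀ i : ι, 10000 * M ^ 2 * (1 / ((i.1 : ℕ) : ℝ)) ≤ 1 / 2 := fun i => by
    rw [mul_one_div, div_le_iff₀ (hpos i)]
    have := (hN i.1 i.2).2.2.2.2.2.2
    linarith
  have hd : ∀ (i : ι) k s, HasDerivAt (iteratedDeriv k (r i.1)) (iteratedDeriv (k + 1) (r i.1) s) s :=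
    fun i k s => hasDerivAt_iteratedDeriv (hN i.1 i.2).2.2.1 k s
  have hM : ∀ (i : ι) k, 1 ≤ k → k ≤ 6 → ∀ s ∈ J, ‖iteratedDeriv k (r i.1) s‖ ≤ M := fun i =>
    (hN i.1 i.2).2.2.2.1
  have hspeed : ∀ (i : ι), ∀ s ∈ J, _ := fun i s hs =>
    speed_estimates (d := fun k => iteratedDeriv k (r i.1)) (M := M) (hd i) (hN i.1 i.2).2.1 (hh i)
      (hh1 i) (by rw [← (hN i.1 i.2).1]; exact hM i)
      (by simpa only [iteratedDeriv_zero] using (hN i.1 i.2).2.2.2.2.1)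
      (s := s) (by rw [← (hN i.1 i.2).1]; exact hs)
  simp only [real_inner_self_eq_norm_sq] at hspeed
  have hdist : ∀ (i : ι), ∀ s ∈ J, |‖iteratedDeriv 1 (r i.1) s‖ ^ 2 - 1|
      ≤ 10001 * M ^ 2 * (1 / ((i.1 : ℕ) : ℝ)) ^ 2 ∧ 1 / 2 ≤ ‖iteratedDeriv 1 (r i.1) s‖ ^ 2 := by
    intro i s hs
    have h3 := (hspeed i s hs).2.2
    have h2 := hM i 2 (by norm_num) (by norm_num) s hs
    have h2' : ‖iteratedDeriv 2 (r i.1) s‖ ^ 2 ≤ M ^ 2 := by gcongr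
    have hs := hsmall i
    have p0 := hh i
    have p1 := hh1 i
    generalize 1 / ((i.1 : ℕ) : ℝ) = h at *
    have q1 : M ^ 2 * h ^ 3 ≤ M ^ 2 * h ^ 2 := by
      gcongr M ^ 2 * ?_
      exact pow_le_pow_of_le_one p0.le p1 (by norm_num)
    have q2 : M ^ 2 * h ^ 3 ≤ M ^ 2 * h := by
      gcongr M ^ 2 * ?_
      exact pow_le_of_le_one p0.le p1 (by norm_num)
    have q3 : h ^ 2 / 12 * ‖iteratedDeriv 2 (r i.1) s‖ ^ 2 ≤ M ^ 2 * h ^ 2 := by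
      calc _ ≤ h ^ 2 / 1 * M ^ 2 := by gcongr; norm_num
        _ = _ := by ring
    have q4 : 0 ≤ h ^ 2 / 12 * ‖iteratedDeriv 2 (r i.1) s‖ ^ 2 := by positivity
    rw [abs_le] at h3 ⊢
    exact ⟨⟨by nlinarith, by nlinarith⟩, by nlinarith⟩
  have hF : CurveFamily (ι := ι) J Ω (fun i => 1 / ((i.1 : ℕ) : ℝ))
      (fun k i => iteratedDeriv k (r i.1)) :=
    { dom := dom
      deriv := fun k i s => hd i k s
      bdd := fun k h1 h6 => ⟨M, fun i s hs => hM i k h1 h6 s hs⟩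
      sep := ⟨c, hc, fun i p hp => by
        simpa only [iteratedDeriv_zero] using (hN i.1 i.2).2.2.2.2.2.1 p hp⟩
      speed_ge := fun i s hs => (hdist i s hs).2
      speed := UnifSq.of_bound (C := 10001 * M ^ 2) fun i s hs => (hdist i s hs).1
      inner_one_two := UnifSq.of_bound (C := 10000 * M ^ 2) fun i s hs => (hspeed i s hs).2.1
      inner_one_three := UnifSq.of_bound (C := 10000 * M ^ 2) fun i s hs => by
        rw [add_comm, Real.norm_eq_abs]
        exact (hspeed i s hs).1 }
  obtain ⟨C, hC⟩ := hF.exists_curveBounds hh hh1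
    ⟨10000 * M ^ 2, fun i s hs => (hspeed i s hs).2.2⟩
  exact ⟨C, eventually_atTop.mpr ⟨N, fun n hn => hC ⟨n, hn⟩⟩⟩

theorem exists_uniform_bound {r : ℕ → ℝ → E3}
    (hb : ∀ k : ℕ, 1 ≤ k → ∃ C : ℝ, ∀ᶠ n in atTop, ∀ s ∈ Set.Icc (0 : ℝ) 1,
      ‖iteratedDeriv k (r n) s‖ ≤ C) :
    ∃ M : ℝ, ∀ᶠ n in atTop, ∀ k, 1 ≤ k → k ≤ 6 → ∀ s ∈ Set.Icc (0 : ℝ) 1,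
      ‖iteratedDeriv k (r n) s‖ ≤ M := by
  choose! C hC using hb
  refine ⟨∑ k ∈ Finset.Icc 1 6, |C k|, ?_⟩
  have := (eventually_all_finset (Finset.Icc 1 6)).mpr fun k hk =>
    hC k (Finset.mem_Icc.mp hk).1
  filter_upwards [this] with n hn k h1 h6 s hs
  have hk := Finset.mem_Icc.mpr ⟨h1, h6⟩
  exact (hn k hk s hs).trans ((le_abs_self _).trans
    (Finset.single_le_sum (f := fun k => |C k|) (fun _ _ => abs_nonneg _) hk))

theorem sum_inv_le_one_add_log (n : ℕ) :
    ∑ k ∈ Finset.range n, 1 / ((k : ℝ) + 1) ≤ 1 + Real.log n := by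
  have h := harmonic_le_one_add_log n
  rw [harmonic] at h
  push_cast at h
  simpa only [one_div] using h

theorem eventually_log_le :
    ∀ᶠ n : ℕ in atTop, 1 ≤ 1 + Real.log n ∧ 1 / (n : ℝ) * (1 + Real.log n) ^ 3 ≤ 1 := by
  -- The factor 1/8 compensates (1 + log n)³ ≤ (2 log n)³, valid once log n ≥ 1.
  have h1 := (Real.isLittleO_pow_log_id_atTop (n := 3)).bound (show (0 : ℝ) < 1 / 8 by norm_num)
  have h2 := tendsto_natCast_atTop_atTop.eventually h1
  have h3 : ∀ᶠ n : ℕ in atTop, Real.exp 1 ≤ (n : ℝ) :=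
    tendsto_natCast_atTop_atTop.eventually_ge_atTop _
  filter_upwards [h2, h3] with n h2 h3
  have hn : (0 : ℝ) < n := (Real.exp_pos 1).trans_le h3
  have hlog : 1 ≤ Real.log n := (Real.le_log_iff_exp_le hn).mpr h3
  refine ⟨by linarith, ?_⟩
  rw [id, Real.norm_eq_abs, Real.norm_eq_abs, abs_of_pos hn, abs_of_nonneg (by positivity)] at h2
  rw [one_div_mul_eq_div, div_le_one hn]
  calc (1 + Real.log n) ^ 3 ≤ (2 * Real.log n) ^ 3 := by gcongr; linarith
    _ = 8 * Real.log n ^ 3 := by ring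
    _ ≤ n := by linarith

theorem energyOf_eq {n N : ℕ} {r m : ℝ → E3} {P μ : ℤ → E3} {S : Finset ℕ}
    (hS : S ⊆ Finset.range N) (hP : ∀ i ∈ Finset.range N, P i = r ((i : ℝ) / n))
    (hμ : ∀ i ∈ Finset.range N, μ i = m ((i : ℝ) / n)) :
    energyOf n N r m S = -(1 / 2) * ∑ i ∈ S, ∑ j ∈ Finset.range N,
      pairTerm (1 / (n : ℝ)) P μ μ (i : ℤ) (j : ℤ) := by
  have key : ∀ i ∈ S, magnetEnergy n N r m i
      = -∑ j ∈ Finset.range N, pairTerm (1 / (n : ℝ)) P μ μ (i : ℤ) (j : ℤ) := fun i hi => by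
    rw [magnetEnergy, fieldAtMagnet, real_inner_smul_right, inner_sum, Finset.mul_sum,
      ← Finset.sum_erase (Finset.range N) (pairTerm_self (i : ℤ))]
    congr 1
    refine Finset.sum_congr rfl fun j hj => ?_
    have hj := Finset.mem_of_mem_erase hj
    rw [pairTerm, hP i (hS hi), hP j hj, hμ i (hS hi), hμ j hj, one_div_pow]
  rw [energyOf, Finset.sum_congr rfl key, Finset.sum_neg_distrib]
  ring

end Families

/-! ### The expansion for chains. -/

section Chain

theorem isIncrDomain_chain : IsIncrDomain (Set.Icc (0 : ℝ) 1)
    {p : ℝ × ℝ | p.1 ∈ Set.Icc (0 : ℝ) 1 ∧ p.1 + p.2 ∈ Set.Icc (0 : ℝ) 1} where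
  convex := convex_Icc 0 1
  fst_mem _ hp := hp.1
  add_mem _ hp := hp.2
  abs_le _ hp := abs_le.mpr ⟨by linarith [hp.1.2, hp.2.1], by linarith [hp.1.1, hp.2.2]⟩

theorem IsChain.exists_curveBounds {r m : ℕ → ℝ → E3} (hr : IsChain r m) :
    ∃ C : ℝ, ∀ᶠ n : ℕ in atTop, ∃ g₁ g₂ H v₁ v₂,
      CurveBounds C (1 / (n : ℝ)) (Set.Icc (0 : ℝ) 1)
        {p : ℝ × ℝ | p.1 ∈ Set.Icc (0 : ℝ) 1 ∧ p.1 + p.2 ∈ Set.Icc (0 : ℝ) 1}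
        (fun k => iteratedDeriv k (r n)) g₁ g₂ H v₁ v₂ := by
  obtain ⟨M, hM⟩ := exists_uniform_bound hr.bounded
  obtain ⟨c, hc, hsep⟩ := hr.separated
  refine exists_curveBounds_eventually isIncrDomain_chain (fun _ => 0) (fun n => n) hc ?_ ?_
    hr.smooth hM ?_ ?_
  · filter_upwards [eventually_ge_atTop 1] with n hn
    have : (n : ℝ) ≠ 0 := by positivity
    simp [this]
  · filter_upwards [eventually_ge_atTop 5] with n hn
    omega
  · filter_upwards [hr.spacing] with n hn j h0 h1
    obtain ⟨i, rfl⟩ := Int.eq_ofNat_of_zero_le h0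
    simpa only [mul_one_div, Int.ofNat_eq_natCast, Int.cast_natCast] using hn i (by exact_mod_cast h1)
  · filter_upwards [hsep] with n hn p hp
    have := hn _ hp.2 _ hp.1
    rwa [add_sub_cancel_left] at this

theorem IsChain.energy_expansion {r m : ℕ → ℝ → E3} (hr : IsChain r m) :
    ∃ C : ℝ, ∀ᶠ n : ℕ in atTop, ∀ a b : ℕ, 0 < a → a ≤ b → b < n →
      ContinuumEnergyExists (r n) ((a : ℝ) / n) ((b : ℝ) / n) ∧
      |energyOf n (n + 1) (r n) (m n) (Finset.Icc a b)
          - (-2 * zetaThree * ((b : ℝ) - a) - 2 * zetaThree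
            + (1 / (n : ℝ)) * continuumEnergy (r n) ((a : ℝ) / n) ((b : ℝ) / n))|
        ≤ C * (1 / (a : ℝ) ^ 2 + 1 / ((n : ℝ) - b) ^ 2) := by
  obtain ⟨C, hC⟩ := hr.exists_curveBounds
  obtain ⟨K, hK⟩ := hr.tangent
  refine ⟨300 * C ^ 5 * (1 + max K 0) ^ 2, ?_⟩
  filter_upwards [hC, hK, hr.unit, hr.smooth, eventually_log_le, eventually_ge_atTop 1]
    with n ⟨g₁, g₂, H, v₁, v₂, hB⟩ hK hunit hsmooth hlog hn1 a b ha hab hb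
  have hn0 : (0 : ℝ) < n := by exact_mod_cast hn1
  have hn : (n : ℝ) * (1 / n) = 1 := mul_one_div_cancel hn0.ne'
  have hd := hasDerivAt_iteratedDeriv hsmooth
  have hΩ : ∀ s x : ℝ, 0 ≤ s → s ≤ 1 → 0 ≤ s + x → s + x ≤ 1 →
      (s, x) ∈ {p : ℝ × ℝ | p.1 ∈ Set.Icc (0 : ℝ) 1 ∧ p.1 + p.2 ∈ Set.Icc (0 : ℝ) 1} :=
    fun s x h1 h2 h3 h4 => ⟨⟨h1, h2⟩, ⟨h3, h4⟩⟩
  have ha0 : (0 : ℝ) < a := by exact_mod_cast ha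
  have hab' : (a : ℝ) ≤ b := by exact_mod_cast hab
  have hb' : (b : ℝ) < n := by exact_mod_cast hb
  constructor
  · have := hB.continuumEnergyExists_chain hΩ hd (α := a / n) (β := b / n) (by positivity)
      (by gcongr) (by rwa [div_lt_one hn0])
    rwa [iteratedDeriv_zero] at this
  · have key := hB.abs_chain_energy_sub_le hn hΩ hd (sum_inv_le_one_add_log n) hlog.1 hlog.2
      (le_max_right K 0) (μ := fun k : ℤ => m n ((k : ℝ) / n))
      (fun i h0 h1 => by
        obtain ⟨i, rfl⟩ := Int.eq_ofNat_of_zero_le h0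
        simpa using hunit i (by exact_mod_cast h1))
      (fun i h0 h1 => by
        obtain ⟨i, rfl⟩ := Int.eq_ofNat_of_zero_le h0
        have := hK i (by exact_mod_cast h1)
        simp only [gridTangent, iteratedDeriv_one, mul_one_div,
          Int.cast_natCast]
        refine this.trans ?_
        have hl : 0 ≤ Real.log n := Real.log_natCast_nonneg n
        calc K * (Real.log n / (n : ℝ) ^ 2) ≤ max K 0 * ((1 + Real.log n) / (n : ℝ) ^ 2) := by
              gcongr
              · exact le_max_left _ _
              · linarith
          _ = _ := by field_simp)
      ha hab hb
    have hI : Finset.Icc 0 n = Finset.range (n + 1) := by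
      ext x; simp only [Finset.mem_Icc, Finset.mem_range]; omega
    rw [energyOf_eq (P := gridPos (1 / (n : ℝ)) fun k => iteratedDeriv k (r n))
      (μ := fun k : ℤ => m n ((k : ℝ) / n)) (fun i hi => by
        rw [Finset.mem_Icc] at hi; rw [Finset.mem_range]; omega)
      (fun i _ => by simp [gridPos, div_eq_mul_inv]) (fun i _ => by simp), ← hI]
    simpa only [iteratedDeriv_zero, mul_one_div] using key

end Chain

/-! ### The expansion for rings. -/

section Ring

theorem isIncrDomain_ring : IsIncrDomain (Set.Icc (-1 : ℝ) 2)
    {p : ℝ × ℝ | p.1 ∈ Set.Icc (0 : ℝ) 1 ∧ |p.2| ≤ 1 / 2} where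
  convex := convex_Icc (-1) 2
  fst_mem _ hp := ⟨by linarith [hp.1.1], by linarith [hp.1.2]⟩
  add_mem _ hp := ⟨by linarith [hp.1.1, (abs_le.mp hp.2).1], by linarith [hp.1.2, (abs_le.mp hp.2).2]⟩
  abs_le _ hp := hp.2.trans (by norm_num)

/-- Lattice values of a function of period `1` are determined by residues. -/
theorem eq_of_periodic {α : Type*} {F : ℝ → α} (hF : Function.Periodic F 1) {n : ℕ} (hn : 1 ≤ n)
    (k : ℤ) : F ((k : ℝ) / n) = F (((k % n).toNat : ℝ) / n) := by
  have hn0 : (n : ℝ) ≠ 0 := by positivity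
  have e : ((k % n).toNat : ℤ) = k % n := Int.toNat_of_nonneg (Int.emod_nonneg _ (by omega))
  have h := Int.emod_add_mul_ediv k n
  rw [← e] at h
  have h' : (((k % n).toNat : ℕ) : ℝ) + n * ((k / n : ℤ) : ℝ) = k := by exact_mod_cast h
  have e2 : (k : ℝ) / n = (((k % n).toNat : ℕ) : ℝ) / n + ((k / n : ℤ) : ℝ) * 1 := by
    rw [← h']; field_simp
  rw [e2, hF.int_mul]

theorem toNat_emod_lt {n : ℕ} (hn : 1 ≤ n) (k : ℤ) : (k % n).toNat < n := by
  have := Int.emod_lt_of_pos k (show (0 : ℤ) < n by omega)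
  have := Int.emod_nonneg k (show (n : ℤ) ≠ 0 by omega)
  omega

/-- For s in [0, 1] and |x| ≤ 1/2 the point s + x may leave [0, 1]; the parameter interval [-1, 2]
leaves room for this, and periodicity transports the derivative bounds and the spacing to it. -/
theorem IsRing.exists_curveBounds {r m : ℕ → ℝ → E3} (hr : IsRing r m) :
    ∃ C : ℝ, ∀ᶠ n : ℕ in atTop, ∃ g₁ g₂ H v₁ v₂,
      CurveBounds C (1 / (n : ℝ)) (Set.Icc (-1 : ℝ) 2)
        {p : ℝ × ℝ | p.1 ∈ Set.Icc (0 : ℝ) 1 ∧ |p.2| ≤ 1 / 2}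
        (fun k => iteratedDeriv k (r n)) g₁ g₂ H v₁ v₂ := by
  obtain ⟨M, hM⟩ := exists_uniform_bound hr.bounded
  obtain ⟨c, hc, hsep⟩ := hr.separated
  refine exists_curveBounds_eventually (M := M) isIncrDomain_ring (fun n => -n) (fun n => 2 * n) hc
    ?_ ?_ hr.smooth ?_ ?_ ?_
  · filter_upwards [eventually_ge_atTop 1] with n hn
    have h1 : (n : ℝ) * (1 / n) = 1 := mul_one_div_cancel (by positivity)
    push_cast
    rw [neg_mul, mul_assoc, h1, mul_one]
  · filter_upwards [eventually_ge_atTop 5] with n hn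
    omega
  · filter_upwards [hM, hr.periodic] with n hn hper k h1 h6 s _
    obtain ⟨y, hy, e⟩ := Function.Periodic.exists_mem_Ico₀ (f := iteratedDeriv k (r n))
      (iteratedDeriv_add_one hper k) one_pos s
    rw [e]
    exact hn k h1 h6 y ⟨hy.1, hy.2.le⟩
  · filter_upwards [hr.spacing, hr.periodic, eventually_ge_atTop 1] with n hn hper hn1 j _ _
    have hF : Function.Periodic (fun s => ‖r n (s + 1 / n) - r n s‖) 1 := fun s => by
      simp only
      rw [add_right_comm, hper, hper]
    have := eq_of_periodic hF hn1 j
    rw [mul_one_div, mul_one_div, add_div, this, ← add_div]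
    exact hn _ (toNat_emod_lt hn1 j)
  · filter_upwards [hsep] with n hn p hp
    have := hn (p.1 + p.2) p.1 (by rw [add_sub_cancel_left]; exact hp.2)
    rwa [add_sub_cancel_left] at this

theorem IsRing.energy_expansion {r m : ℕ → ℝ → E3} (hr : IsRing r m) :
    ∃ C : ℝ, ∀ᶠ n : ℕ in atTop, ContinuumEnergyExists (r n) 0 1 ∧
      |totalEnergy n n (r n) (m n) - (-2 * zetaThree * (n : ℝ)
        + (1 / (n : ℝ)) * continuumEnergy (r n) 0 1)| ≤ C * (1 / (n : ℝ) ^ 2) := by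
  obtain ⟨C, hC⟩ := hr.exists_curveBounds
  obtain ⟨K, hK⟩ := hr.tangent
  refine ⟨5000 * C ^ 5 * (1 + max K 0) ^ 2, ?_⟩
  filter_upwards [hC, hK, hr.unit, hr.smooth, hr.periodic, eventually_log_le,
    eventually_ge_atTop 3] with n ⟨g₁, g₂, H, v₁, v₂, hB⟩ hK hunit hsmooth hper hlog hn3
  have hn1 : 1 ≤ n := by omega
  have hn0 : (0 : ℝ) < n := by exact_mod_cast hn1
  have hn : (n : ℝ) * (1 / n) = 1 := mul_one_div_cancel hn0.ne'
  have hd := hasDerivAt_iteratedDeriv hsmooth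
  have hdper := iteratedDeriv_add_one hper
  have hΩ : ∀ s x : ℝ, 0 ≤ s → s ≤ 1 → |x| ≤ 1 / 2 →
      (s, x) ∈ {p : ℝ × ℝ | p.1 ∈ Set.Icc (0 : ℝ) 1 ∧ |p.2| ≤ 1 / 2} :=
    fun s x h1 h2 h3 => ⟨⟨h1, h2⟩, h3⟩
  constructor
  · have := hB.continuumEnergyExists_ring hΩ hd hdper
    rwa [iteratedDeriv_zero] at this
  · have key := hB.abs_ring_energy_sub_le hn hΩ hd hdper (sum_inv_le_one_add_log n) hlog.1 hlog.2
      -- Only the moments with indices 0, …, n - 1 are given, and `m n` need not be periodic; they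
      -- are extended to all integers through residues modulo n.
      (le_max_right K 0) (μ := fun k : ℤ => m n (((k % n).toNat : ℝ) / n))
      (fun i => by simp only [Int.add_emod_right])
      (fun i => hunit _ (toNat_emod_lt hn1 i))
      (fun i => by
        have := hK _ (toNat_emod_lt hn1 i)
        have hT : Function.Periodic (fun s => ‖deriv (r n) s‖⁻¹ • deriv (r n) s) 1 := fun s => by
          have := hdper 1 s
          rw [iteratedDeriv_one] at this
          simp only [this]
        have hT' := eq_of_periodic hT hn1 i
        simp only [gridTangent, iteratedDeriv_one, mul_one_div]
        rw [hT']
        refine this.trans ?_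
        have hl : 0 ≤ Real.log n := Real.log_natCast_nonneg n
        calc K * (Real.log n / (n : ℝ) ^ 2) ≤ max K 0 * ((1 + Real.log n) / (n : ℝ) ^ 2) := by
              gcongr
              · exact le_max_left _ _
              · linarith
          _ = _ := by field_simp)
      hn3
    rw [totalEnergy, energyOf_eq (P := gridPos (1 / (n : ℝ)) fun k => iteratedDeriv k (r n))
      (μ := fun k : ℤ => m n (((k % n).toNat : ℝ) / n)) subset_rfl
      (fun i _ => by simp [gridPos, div_eq_mul_inv])
      (fun i hi => by
        have e : ((i : ℤ) % n).toNat = i := by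
          rw [Int.emod_eq_of_lt (by omega) (by exact_mod_cast Finset.mem_range.mp hi)]; simp
        simp only [e])]
    simpa only [iteratedDeriv_zero, one_div_pow] using key

end Ring

end MagnetChain

theorem mainTheorem1 :
    (∀ r m : ℕ → ℝ → MagnetChain.E3, MagnetChain.IsChain r m →
      ∃ C : ℝ, ∀ᶠ n : ℕ in atTop, ∀ a b : ℕ, 0 < a → a ≤ b → b < n →
        MagnetChain.ContinuumEnergyExists (r n) ((a : ℝ) / n) ((b : ℝ) / n) ∧
        |MagnetChain.energyOf n (n + 1) (r n) (m n) (Finset.Icc a b)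
            - (-2 * MagnetChain.zetaThree * ((b : ℝ) - a) - 2 * MagnetChain.zetaThree
              + (1 / (n : ℝ)) *
                MagnetChain.continuumEnergy (r n) ((a : ℝ) / n) ((b : ℝ) / n))|
          ≤ C * (1 / (a : ℝ) ^ 2 + 1 / ((n : ℝ) - b) ^ 2)) ∧
    (∀ r m : ℕ → ℝ → MagnetChain.E3, MagnetChain.IsRing r m →
      (∀ᶠ n : ℕ in atTop, MagnetChain.ContinuumEnergyExists (r n) 0 1) ∧
      (fun n : ℕ => MagnetChain.totalEnergy n n (r n) (m n)
          - (-2 * MagnetChain.zetaThree * (n : ℝ)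
            + (1 / (n : ℝ)) * MagnetChain.continuumEnergy (r n) 0 1))
        =O[atTop] fun n : ℕ => 1 / (n : ℝ) ^ 2) := by
  refine ⟨fun r m hr => hr.energy_expansion, fun r m hr => ?_⟩
  obtain ⟨C, hC⟩ := hr.energy_expansion
  refine ⟨hC.mono fun n hn => hn.1, IsBigO.of_bound C (hC.mono fun n hn => ?_)⟩
  rw [Real.norm_eq_abs, Real.norm_eq_abs, abs_of_nonneg (show 0 ≤ 1 / (n : ℝ) ^ 2 by positivity)]
  exact hn.2
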